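/- **Theorem.** Every Hermitian star product on a Poisson manifold is a completely positive deformation. Explicitly: let $M$ be a smooth manifold (finite-dimensional, Hausdorff, second countable, without boundary) with a Poisson bracket $\{\cdot,\cdot\}$, and let $C^\infty(M)$ be the $^*$-algebra of smooth complex-valued functions with complex conjugation as involution. A *Hermitian star product* on $M$ is an associative $\mathbb{C}[[\lambda]]$-bilinear multiplication $$f \star g = \sum_{r=0}^\infty \lambda^r C_r(f,g)$$ on $C^\infty(M)[[\lambda]]$ such that $C_0(f,g) = fg$, $C_1(f,g) - C_1(g,f) = \mathrm{i}\{f,g\}$, $1 \star f = f = f \star 1$, every $C_r$ is a bidifferential operator, and $\overline{f \star g} = \overline{g} \star \overline{f}$ (with $\overline{\lambda} = \lambda$). The ring $\mathbb{R}[[\lambda]]$ is ordered by calling a series positive if its lowest nonvanishing coefficient is positive; for $z$ in $\mathbb{C}$ or $\mathbb{C}[[\lambda]]$, the statement $z \ge 0$ means that $z$ lies in $\mathbb{R}$, respectively in $\mathbb{R}[[\lambda]]$, and is nonnegative there. Let $\star$ be a Hermitian star product on $M$ and let $m \in \mathbb{N}$. Extend $\star$ to $M_m(C^\infty(M))[[\lambda]]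 = M_m(C^\infty(M)[[\lambda]])$ by $(F \star G)_{ij} = \sum_k F_{ik} \star G_{kj}$, and put $(F^*)_{ij} = \overline{F_{ji}}$. Then for every $\mathbb{C}$-linear functional $\omega_0 : M_m(C^\infty(M)) \to \mathbb{C}$ that is positive, i.e. $\omega_0(A^*A) \ge 0$ for all $A \in M_m(C^\infty(M))$, there exist $\mathbb{C}$-linear functionals $\omega_r : M_m(C^\infty(M)) \to \mathbb{C}$, $r \ge 1$, such that the $\mathbb{C}[[\lambda]]$-linear functional $$\omega = \sum_{r=0}^\infty \lambda^r \omega_r : M_m(C^\infty(M))[[\lambda]] \to \mathbb{C}[[\lambda]]$$ is positive with respect to $\star$, i.e. $\omega(F^* \star F) \ge 0$ for all $F \in M_m(C^\infty(M))[[\lambda]]$. (For $m = 1$ this says that every positive functional of $C^\infty(M)$ can be deformed into a positive functional for $\star$.) -/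

import Mathlib

open scoped Manifold ContDiff ComplexOrder PowerSeries
open Finset.HasAntidiagonal (antidiagonal)

noncomputable section

namespace DefQuant

/-! ### Formal power series with coefficients in a complex vector space -/

/-- The space `A[[λ]]` of formal power series `∑ λ ^ r a_r` with coefficients `a_r` in `A`. -/
@[ext] structure FormalSeries (A : Type*) where
  /-- the coefficient `a_r` of `λ ^ r` -/
  coeff : ℕ → A

namespace FormalSeries

variable {A : Type*}

section Group

variable [AddCommGroup A]

instance : Zero (FormalSeries A) := ⟨⟨fun _ => 0⟩⟩
instance : Add (FormalSeries A) := ⟨fun a b => ⟨fun r => a.coeff r + b.coeff r⟩⟩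
instance : Neg (FormalSeries A) := ⟨fun a => ⟨fun r => -a.coeff r⟩⟩

@[simp] theorem coeff_zero (r : ℕ) : (0 : FormalSeries A).coeff r = 0 := rfl
@[simp] theorem coeff_add (a b : FormalSeries A) (r : ℕ) :
    (a + b).coeff r = a.coeff r + b.coeff r := rfl
@[simp] theorem coeff_neg (a : FormalSeries A) (r : ℕ) : (-a).coeff r = -a.coeff r := rfl

instance : AddCommGroup (FormalSeries A) where
  add_assoc a b c := by ext r; simp [add_assoc]
  zero_add a := by ext r; simp
  add_zero a := by ext r; simp
  add_comm a b := by ext r; simp [add_comm]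
  neg_add_cancel a := by ext r; simp
  nsmul := nsmulRec
  zsmul := zsmulRec

theorem coeff_sum {ι : Type*} (s : Finset ι) (a : ι → FormalSeries A) (r : ℕ) :
    (∑ k ∈ s, a k).coeff r = ∑ k ∈ s, (a k).coeff r :=
  map_sum (AddMonoidHom.mk' (fun b : FormalSeries A => b.coeff r) fun _ _ => rfl) a s

/-- The inclusion `A ⊆ A[[λ]]` as constant series. -/
def const (a : A) : FormalSeries A := ⟨fun r => if r = 0 then a else 0⟩

end Group

section Module

variable [AddCommGroup A] [Module ℂ A]

/-- Multiplication of a vector valued formal series by a scalar one (Cauchy product). -/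
instance : SMul ℂ⟦X⟧ (FormalSeries A) :=
  ⟨fun z a => ⟨fun r => ∑ p ∈ antidiagonal r, PowerSeries.coeff p.1 z • a.coeff p.2⟩⟩

theorem coeff_smul (z : ℂ⟦X⟧) (a : FormalSeries A) (r : ℕ) :
    (z • a).coeff r = ∑ p ∈ antidiagonal r, PowerSeries.coeff p.1 z • a.coeff p.2 := rfl

/-- `A[[λ]]` is a module over `ℂ[[λ]]`. -/
instance : Module ℂ⟦X⟧ (FormalSeries A) where
  one_smul a := by
    ext r
    rw [coeff_smul, Finset.sum_eq_single (0, r)]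
    · simp
    · rintro ⟨i, j⟩ h hne
      have hi : i ≠ 0 := by
        rintro rfl
        exact hne (by simpa using h)
      simp [PowerSeries.coeff_one, hi]
    · simp
  mul_smul z w a := by
    ext r
    simp only [coeff_smul, PowerSeries.coeff_mul, Finset.sum_smul, Finset.smul_sum,
      Finset.sum_sigma', smul_smul]
    refine Finset.sum_nbij'
      (fun p => ⟨(p.2.1, p.2.2 + p.1.2), (p.2.2, p.1.2)⟩)
      (fun p => ⟨(p.1.1 + p.2.1, p.2.2), (p.1.1, p.2.1)⟩) ?_ ?_ ?_ ?_ ?_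
    · rintro ⟨⟨a, b⟩, c, d⟩ h
      simp at h ⊢; omega
    · rintro ⟨⟨a, b⟩, c, d⟩ h
      simp at h ⊢; omega
    · rintro ⟨⟨a, b⟩, c, d⟩ h
      simp at h ⊢; omega
    · rintro ⟨⟨a, b⟩, c, d⟩ h
      simp at h ⊢; omega
    · rintro ⟨⟨a, b⟩, c, d⟩ h
      simp
  smul_zero z := by ext r; simp [coeff_smul]
  smul_add z a b := by ext r; simp [coeff_smul, Finset.sum_add_distrib]
  add_smul z w a := by ext r; simp [coeff_smul, add_smul, Finset.sum_add_distrib]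
  zero_smul a := by ext r; simp [coeff_smul]

end Module

/-- The involution of `A` extended coefficientwise to `A[[λ]]` (the parameter `λ` is real). -/
instance [Star A] : Star (FormalSeries A) := ⟨fun a => ⟨fun r => star (a.coeff r)⟩⟩

@[simp] theorem coeff_star [Star A] (a : FormalSeries A) (r : ℕ) :
    (star a).coeff r = star (a.coeff r) := rfl

section Matrix

variable [AddCommGroup A] [Module ℂ A] {m : ℕ}

/-- The `(i, j)` entry of a formal series of matrices: the identification of `M_m(A)[[λ]]` with
`M_m(A[[λ]])`. -/
def entry (i j : Fin m) :
    FormalSeries (Matrix (Fin m) (Fin m) A) →ₗ[ℂ⟦X⟧] FormalSeries A where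
  toFun a := ⟨fun r => a.coeff r i j⟩
  map_add' _ _ := rfl
  map_smul' z a := by ext r; simp [coeff_smul, Matrix.sum_apply]

/-- The formal series of matrices with given entries. -/
def ofEntries (a : Fin m → Fin m → FormalSeries A) :
    FormalSeries (Matrix (Fin m) (Fin m) A) := ⟨fun r => Matrix.of fun i j => (a i j).coeff r⟩

@[simp] theorem entry_ofEntries (a : Fin m → Fin m → FormalSeries A) (i j : Fin m) :
    entry i j (ofEntries a) = a i j := rfl

theorem ext_entry {a b : FormalSeries (Matrix (Fin m) (Fin m) A)}
    (h : ∀ i j, entry i j a = entry i j b) : a = b := by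
  ext r i j
  exact congrArg (fun c : FormalSeries A => c.coeff r) (h i j)

end Matrix

end FormalSeries

/-! ### The ordering of `ℝ[[λ]]` -/

/-- A real formal series is positive if its lowest nonvanishing coefficient is positive. -/
def RealSeriesPos (z : ℝ⟦X⟧) : Prop :=
  ∃ k, 0 < PowerSeries.coeff k z ∧ ∀ i < k, PowerSeries.coeff i z = 0

/-- `z ≥ 0` for `z ∈ ℂ[[λ]]`: the series `z` is real, and is zero or positive in the ordered ring
`ℝ[[λ]]`. -/
def SeriesNonneg (z : ℂ⟦X⟧) : Prop :=
  ∃ x : ℝ⟦X⟧, z = PowerSeries.map Complex.ofRealHom x ∧ (x = 0 ∨ RealSeriesPos x)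

/-! ### Positive functionals and Hermitian deformations of `*`-algebras over `ℂ` -/

section Deformation

variable {A : Type*} [Ring A] [StarRing A] [Algebra ℂ A] [StarModule ℂ A]

/-- A linear functional `φ : A → ℂ` is positive if `φ (a* a) ≥ 0` for all `a`. -/
def IsPositiveFunctional (φ : A →ₗ[ℂ] ℂ) : Prop := ∀ a : A, 0 ≤ φ (star a * a)

variable (A) in
/-- A Hermitian deformation of the `*`-algebra `A`: an associative `ℂ[[λ]]`-bilinear
multiplication `⋆` on `A[[λ]]` that agrees with the product of `A` in order zero and for which the
(undeformed) involution is an involution. -/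
structure HermitianDeformation where
  /-- the deformed multiplication -/
  mul : FormalSeries A →ₗ[ℂ⟦X⟧] FormalSeries A →ₗ[ℂ⟦X⟧] FormalSeries A
  mul_assoc : ∀ a b c, mul (mul a b) c = mul a (mul b c)
  mul_coeff_zero : ∀ a b : A, (mul (.const a) (.const b)).coeff 0 = a * b
  star_mul : ∀ a b, star (mul a b) = mul (star b) (star a)

namespace HermitianDeformation

/-- The coefficient `C_r : A × A → A` in `a ⋆ b = ∑ λ ^ r C_r(a, b)`. -/
def coeff (D : HermitianDeformation A) (r : ℕ) (a b : A) : A := (D.mul (.const a) (.const b)).coeff r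

/-- A `ℂ[[λ]]`-linear functional on `A[[λ]]` is positive with respect to `⋆` if
`φ (a* ⋆ a) ≥ 0` for all `a ∈ A[[λ]]`. -/
def IsPositiveFunctional (D : HermitianDeformation A) (φ : FormalSeries A →ₗ[ℂ⟦X⟧] ℂ⟦X⟧) : Prop :=
  ∀ a, SeriesNonneg (φ (D.mul (star a) a))

/-- A deformation is positive if every positive functional `φ₀` of `A` is the order zero part of
a `ℂ[[λ]]`-linear functional `φ = φ₀ + λ φ₁ + ⋯` that is positive with respect to `⋆`. -/
def IsPositiveDeformation (D : HermitianDeformation A) : Prop :=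
  ∀ φ₀ : A →ₗ[ℂ] ℂ, DefQuant.IsPositiveFunctional φ₀ →
    ∃ φ : FormalSeries A →ₗ[ℂ⟦X⟧] ℂ⟦X⟧,
      (∀ a : A, PowerSeries.coeff 0 (φ (.const a)) = φ₀ a) ∧ D.IsPositiveFunctional φ

/-- The deformation `M_m(A[[λ]], ⋆)` of `M_m(A)`: matrix multiplication built with `⋆`. -/
def matrix (D : HermitianDeformation A) (m : ℕ) :
    HermitianDeformation (Matrix (Fin m) (Fin m) A) where
  mul := LinearMap.mk₂ ℂ⟦X⟧
    (fun a b => .ofEntries fun i j => ∑ k, D.mul (.entry i k a) (.entry k j b))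
    (fun a a' b => FormalSeries.ext_entry fun i j => by simp [Finset.sum_add_distrib])
    (fun z a b => FormalSeries.ext_entry fun i j => by simp [Finset.smul_sum])
    (fun a b b' => FormalSeries.ext_entry fun i j => by simp [Finset.sum_add_distrib])
    (fun z a b => FormalSeries.ext_entry fun i j => by simp [Finset.smul_sum])
  mul_assoc a b c := FormalSeries.ext_entry fun i j => by
    simp only [LinearMap.mk₂_apply, FormalSeries.entry_ofEntries, map_sum, LinearMap.sum_apply,
      D.mul_assoc]
    exact Finset.sum_comm
  mul_coeff_zero a b := by
    ext i j
    have h (c : Matrix (Fin m) (Fin m) A) (i j : Fin m) :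
        FormalSeries.entry i j (.const c) = .const (c i j) := by
      ext r
      change (if r = 0 then c else 0) i j = if r = 0 then c i j else 0
      split_ifs <;> rfl
    simp [FormalSeries.ofEntries, FormalSeries.coeff_sum, h, D.mul_coeff_zero, Matrix.mul_apply]
  star_mul a b := FormalSeries.ext_entry fun i j => by
    have h (c : FormalSeries (Matrix (Fin m) (Fin m) A)) (i j : Fin m) :
        FormalSeries.entry i j (star c) = star (FormalSeries.entry j i c) := rfl
    have hs (c : Fin m → FormalSeries A) : star (∑ k, c k) = ∑ k, star (c k) := by
      ext r
      simp [FormalSeries.coeff_sum]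
    simp [h, hs, D.star_mul]

/-- A deformation is completely positive if all the matrix deformations are positive. -/
def IsCompletelyPositive (D : HermitianDeformation A) : Prop :=
  ∀ m : ℕ, (D.matrix m).IsPositiveDeformation

end HermitianDeformation

end Deformation

/-! ### Smooth functions, Poisson brackets and star products -/

section Manifold

variable (n : ℕ) (M : Type*) [TopologicalSpace M] [ChartedSpace (EuclideanSpace ℝ (Fin n)) M]

/-- The `*`-algebra `C^∞(M)` of smooth complex valued functions on `M` with pointwise operations
and complex conjugation. -/
def SmoothFn : StarSubalgebra ℂ (M → ℂ) where
  carrier := {f | ContMDiff (𝓡 n) 𝓘(ℝ, ℂ) ∞ f}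
  mul_mem' hf hg := (contDiff_fst.mul contDiff_snd : ContDiff ℝ ∞ fun p : ℂ × ℂ => p.1 * p.2).contMDiff.comp
      (hf.prodMk_space hg)
  add_mem' hf hg := ContMDiff.add hf hg
  algebraMap_mem' _ := contMDiff_const
  star_mem' hf := Complex.conjCLE.contDiff.contMDiff.comp hf

/-- A Poisson bracket on `C^∞(M)`, extended `ℂ`-bilinearly from the real valued functions. -/
structure PoissonBracket where
  /-- the bracket `{f, g}` -/
  bracket : SmoothFn n M →ₗ[ℂ] SmoothFn n M →ₗ[ℂ] SmoothFn n M
  skew : ∀ f g, bracket f g = -bracket g f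
  leibniz : ∀ f g h, bracket f (g * h) = bracket f g * h + g * bracket f h
  jacobi : ∀ f g h,
    bracket f (bracket g h) + bracket g (bracket h f) + bracket h (bracket f g) = 0
  real : ∀ f g, star (bracket f g) = bracket (star f) (star g)

variable {n M}

/-- The partial derivative `∂_{i 0} ⋯ ∂_{i (k-1)} f` at `y` in the coordinates of the preferred
chart at `x` (meaningful for `y` in the domain of that chart). -/
def partialDeriv (x : M) {k : ℕ} (i : Fin k → Fin n) (f : M → ℂ) (y : M) : ℂ :=
  let c := chartAt (EuclideanSpace ℝ (Fin n)) x
  iteratedFDeriv ℝ k (f ∘ c.symm) (c y) fun s => EuclideanSpace.single (i s) 1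

/-- `B` is a bidifferential operator: around every point it is given, in a chart, by a finite sum
`∑ a ∂_i f ∂_j g` with smooth coefficients `a`. -/
def IsBidifferential (B : SmoothFn n M → SmoothFn n M → SmoothFn n M) : Prop :=
  ∀ x : M, ∃ U : Set M, IsOpen U ∧ x ∈ U ∧ U ⊆ (chartAt (EuclideanSpace ℝ (Fin n)) x).source ∧
    ∃ (N : ℕ) (a : ∀ k l : ℕ, (Fin k → Fin n) → (Fin l → Fin n) → M → ℂ),
      (∀ k l i j, ContMDiffOn (𝓡 n) 𝓘(ℝ, ℂ) ∞ (a k l i j) U) ∧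
      ∀ f g : SmoothFn n M, ∀ y ∈ U,
        (B f g : M → ℂ) y =
          ∑ k ∈ Finset.range (N + 1), ∑ l ∈ Finset.range (N + 1),
            ∑ i : Fin k → Fin n, ∑ j : Fin l → Fin n,
              a k l i j y * partialDeriv x i f y * partialDeriv x j g y

/-- A Hermitian star product `f ⋆ g = ∑ λ ^ r C_r(f, g)` for a Poisson manifold. -/
structure HermitianStarProduct (P : PoissonBracket n M) extends
    HermitianDeformation (SmoothFn n M) where
  commutator : ∀ f g,
    toHermitianDeformation.coeff 1 f g - toHermitianDeformation.coeff 1 g f =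
      Complex.I • P.bracket f g
  one_mul : ∀ f, mul (.const 1) f = f
  mul_one : ∀ f, mul f (.const 1) = f
  bidifferential : ∀ r, IsBidifferential (toHermitianDeformation.coeff r)

end Manifold

end DefQuant

end

/-!
Write `A` for the algebra of smooth functions and `m_y` for the ideal of the functions vanishing at
the point `y`. The proof has two halves, a pointwise construction and its integration against `ω₀`.

**Deforming all evaluations at once.** There are linear maps `Φ_r : A → A` with `Φ_0 = id` such that,
for each `y`, the functional `Φ_y(f) = ∑ λ ^ r Φ_r(f)(y)` is positive
(`exists_lexNonneg_ptFunctional`). Positive functionals may be added, so by a partition of unity it is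
enough to find the `Φ_r` near a given point. Fix real coordinates `x` there and let `x ^ I` be the
`⋆`-monomials in the coordinates centred at `y`. Filter `A[[λ]]` by weight, where elements of `m_y`
have weight one and `λ` has weight two (`weightFilt`). As the star product is commutative modulo `λ`,
reordering a monomial costs a factor `λ` and two factors of `m_y`, so that modulo weight `s + 1` an
element of weight `s` is a combination of the `λ ^ i x ^ I` with `2 i + |I| = s`
(`exists_sub_weightedSum_mem`). The functionals are chosen so that `Φ_y(x ^ I)` is `λ ^ (|I| / 2)`
times a number, which is zero for `|I|` odd. Then `Φ_y` maps weight `k` to multiples of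
`λ ^ ⌈k / 2⌉` (`map_weightFilt_dvd`), and for `f` of weight exactly `s` the lowest coefficient of
`Φ_y(f* ⋆ f)` is the value of a form, the Gram matrix of weight `s`, on the leading coefficients of
`f`. So positivity only requires these Gram matrices to be positive definite
(`LocalCoordinates.lexNonneg_ptFunctional`). This is arranged recursively
(`LocalCoordinates.exists_isStage`): the choice of `Φ_r` determines the numbers
`Φ_y(x ^ I) / λ ^ r` for `|I| = 2 r`, which are taken to be a large multiple `t` of the moments of the
counting measure of a grid. They contribute `t` times a Hankel matrix to the Gram matrix of weight
`r`. That matrix is positive definite on the exponents of degree `r`, because a polynomial that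
vanishes on a large grid is zero, and on the exponents of smaller degree the Gram matrix of weight
`r` is the one of weight `r - 2`. By compactness one `t` serves all points near the given one. That the
functionals see only finitely many Taylor coefficients, and that everything depends smoothly on `y`,
follows from the star product being bidifferential (`ptFilt_le_orderFilt`, `exists_taylorCoeff`,
`IsTame`).

**Integration.** For `F` in `M_m(A)[[λ]]`, applying the `Φ_r` to the entries of `F* ⋆ F` gives Hermitian
matrices `H_q` over `A` for which at each point the lowest nonvanishing one of the numbers
`v* H_q(y) v` is positive, and `ω = ∑ λ ^ r ω₀ ∘ Φ_r` takes `F* ⋆ F` to `∑ λ ^ q ω₀(H_q)`. The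
matrix `H_k + ε` becomes positive definite after adding suitable smooth multiples of
`H_0, …, H_{k-1}`; a positive definite matrix of functions is a sum of squares by the Cholesky
decomposition, so `ω₀` is nonnegative on it. If `ω₀(H_i) = 0` for `i < k`, the Cauchy–Schwarz
inequality shows that `ω₀` also vanishes on the multiples of these `H_i`, and therefore
`ω₀(H_k) ≥ 0` (`IsPositiveFunctional.lexNonneg`).
-/


noncomputable section

namespace DefQuant

/-! ### The weight filtration of an almost commutative algebra -/

section WeightFiltration

variable {R B : Type*} [CommRing R] [Ring B] [Algebra R B]

/-- A two-sided ideal `J`, containing the multiples of the parameter `l`, of an algebra that is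
commutative modulo `l`. -/
structure IsClassicalIdeal (l : R) (J : Submodule R B) : Prop where
  mul_left_mem : ∀ a, ∀ j ∈ J, a * j ∈ J
  mul_right_mem : ∀ a, ∀ j ∈ J, j * a ∈ J
  smul_mem : ∀ a, l • a ∈ J
  commutator : ∀ a b : B, ∃ c, a * b - b * a = l • c

/-- The filtration of `B` in which the elements of `J` have weight one and the parameter `l` has
weight two: `weightFilt l J k` is spanned by the products `l ^ i • (j₁ * ⋯ * j_d * b)` with
`j₁, …, j_d ∈ J` and `k ≤ 2 * i + d`. -/
def weightFilt (l : R) (J : Submodule R B) : ℕ → Submodule R B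
  | 0 => ⊤
  | 1 => J
  | k + 2 => J * weightFilt l J (k + 1) ⊔ (weightFilt l J k).map (LinearMap.lsmul R B l)

variable {l : R} {J : Submodule R B}

theorem IsClassicalIdeal.mul_weightFilt_mem (h : IsClassicalIdeal l J) {k : ℕ} {a b : B}
    (ha : a ∈ J) (hb : b ∈ weightFilt l J k) : a * b ∈ weightFilt l J (k + 1) := by
  cases k with
  | zero => exact h.mul_right_mem b a ha
  | succ k => exact Submodule.mem_sup_left (Submodule.mul_mem_mul ha hb)

theorem smul_mem_weightFilt {k : ℕ} {b : B} (hb : b ∈ weightFilt l J k) :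
    l • b ∈ weightFilt l J (k + 2) :=
  Submodule.mem_sup_right ⟨b, hb, rfl⟩

theorem weightFilt_succ_le (h : IsClassicalIdeal l J) (k : ℕ) :
    weightFilt l J (k + 1) ≤ weightFilt l J k := by
  induction k using Nat.strong_induction_on with
  | _ k ih =>
    match k with
    | 0 => exact le_top
    | 1 =>
      refine sup_le (Submodule.mul_le.2 fun a _ b hb => h.mul_left_mem a b hb) ?_
      rintro _ ⟨b, -, rfl⟩
      exact h.smul_mem b
    | k + 2 =>
      exact sup_le_sup (mul_le_mul' le_rfl (ih (k + 1) (by omega)))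
        (Submodule.map_mono (ih k (by omega)))

theorem weightFilt_antitone (h : IsClassicalIdeal l J) : Antitone (weightFilt l J) :=
  antitone_nat_of_succ_le (weightFilt_succ_le h)

theorem IsClassicalIdeal.mul_left_mem_weightFilt (h : IsClassicalIdeal l J) (a : B) {k : ℕ} :
    weightFilt l J k ≤ (weightFilt l J k).comap (LinearMap.mulLeft R a) := by
  induction k using Nat.strong_induction_on with
  | _ k ih =>
    match k with
    | 0 => exact le_top
    | 1 => exact h.mul_left_mem a
    | k + 2 =>
      refine sup_le (Submodule.mul_le.2 fun c hc d hd => ?_) ?_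
      · rw [Submodule.mem_comap, LinearMap.mulLeft_apply, ← mul_assoc]
        exact h.mul_weightFilt_mem (h.mul_left_mem a c hc) hd
      · rintro _ ⟨v, hv, rfl⟩
        rw [Submodule.mem_comap, LinearMap.mulLeft_apply, LinearMap.lsmul_apply, mul_smul_comm]
        exact smul_mem_weightFilt (ih k (by omega) hv)

theorem mul_mem_weightFilt (h : IsClassicalIdeal l J) {j k : ℕ} {a b : B}
    (ha : a ∈ weightFilt l J j) (hb : b ∈ weightFilt l J k) :
    a * b ∈ weightFilt l J (j + k) := by
  suffices weightFilt l J j ≤ (weightFilt l J (j + k)).comap (LinearMap.mulRight R b) from this ha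
  clear ha
  induction j using Nat.strong_induction_on with
  | _ j ih =>
    match j with
    | 0 => rw [zero_add]; exact fun a _ => h.mul_left_mem_weightFilt a hb
    | 1 => rw [add_comm]; exact fun a ha => h.mul_weightFilt_mem ha hb
    | j + 2 =>
      refine sup_le (Submodule.mul_le.2 fun c hc d hd => ?_) ?_
      · rw [Submodule.mem_comap, LinearMap.mulRight_apply, mul_assoc,
          show j + 2 + k = j + 1 + k + 1 by omega]
        exact h.mul_weightFilt_mem hc (ih (j + 1) (by omega) hd)
      · rintro _ ⟨v, hv, rfl⟩
        rw [Submodule.mem_comap, LinearMap.mulRight_apply, LinearMap.lsmul_apply, smul_mul_assoc,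
          show j + 2 + k = j + k + 2 by omega]
        exact smul_mem_weightFilt (ih j (by omega) hv)

theorem list_prod_mem_weightFilt (h : IsClassicalIdeal l J) (u : List B) (hu : ∀ b ∈ u, b ∈ J) :
    u.prod ∈ weightFilt l J u.length := by
  induction u with
  | nil => exact Submodule.mem_top
  | cons b u ih =>
    rw [List.prod_cons, List.length_cons]
    exact h.mul_weightFilt_mem (hu b (by simp)) (ih fun c hc => hu c (by simp [hc]))

/-- Reordering a product of `k` elements of `J` costs a factor `l` and two factors of `J`. -/
theorem prod_sub_prod_of_perm (h : IsClassicalIdeal l J) {u v : List B} (huv : u.Perm v)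
    (hu : ∀ b ∈ u, b ∈ J) :
    ∃ c ∈ weightFilt l J (u.length - 2), u.prod - v.prod = l • c := by
  induction huv with
  | nil => exact ⟨0, zero_mem _, by simp⟩
  | @cons b u v huv ih =>
    obtain ⟨c, hc, e⟩ := ih fun d hd => hu d (by simp [hd])
    refine ⟨b * c, weightFilt_antitone h (by simp; omega)
      (h.mul_weightFilt_mem (hu b (by simp)) hc), ?_⟩
    rw [List.prod_cons, List.prod_cons, ← mul_sub, e, mul_smul_comm]
  | swap a b u =>
    obtain ⟨c, hc⟩ := h.commutator b a
    refine ⟨c * u.prod, ?_, ?_⟩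
    · have := mul_mem_weightFilt h (j := 0) (a := c) Submodule.mem_top
        (list_prod_mem_weightFilt h u fun d hd => hu d (by simp [hd]))
      simpa using this
    · rw [← smul_mul_assoc, ← hc]; simp [sub_mul, mul_assoc]
  | trans huv _ ih ih' =>
    obtain ⟨c, hc, e⟩ := ih hu
    obtain ⟨d, hd, e'⟩ := ih' fun b hb => hu b (huv.mem_iff.2 hb)
    rw [← huv.length_eq] at hd
    exact ⟨c + d, add_mem hc hd, by rw [smul_add, ← e, ← e']; abel⟩

variable {n : ℕ}

/-- The monomial with exponent `I` in (noncommuting) elements `x₁, …, x_n`, the factors being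
multiplied in an arbitrary but fixed order. -/
def orderedMonomial {B : Type*} [Monoid B] (x : Fin n → B) (I : Fin n →₀ ℕ) : B :=
  (I.toMultiset.toList.map x).prod

/-- The span of the ordered monomials of degree `k`. -/
def monomialSpan (R : Type*) {B : Type*} [CommRing R] [Ring B] [Algebra R B] (x : Fin n → B)
    (k : ℕ) : Submodule R B :=
  Submodule.span R (orderedMonomial x '' {I | I.degree = k})

theorem length_toMultiset_toList (I : Fin n →₀ ℕ) : I.toMultiset.toList.length = I.degree := by
  rw [Multiset.length_toList, Finsupp.card_toMultiset]
  rfl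

theorem orderedMonomial_mem_weightFilt (h : IsClassicalIdeal l J) {x : Fin n → B}
    (hx : ∀ i, x i ∈ J) (I : Fin n →₀ ℕ) : orderedMonomial x I ∈ weightFilt l J I.degree := by
  have := list_prod_mem_weightFilt h (I.toMultiset.toList.map x) (by simp [hx])
  rwa [List.length_map, length_toMultiset_toList] at this

/-- The coordinates `x i` generate `J` modulo products of two elements of `J` and modulo `l`. -/
structure IsCoordinates (l : R) (J : Submodule R B) (x : Fin n → B) : Prop where
  mem : ∀ i, x i ∈ J
  top_le : ⊤ ≤ Submodule.span R {1} ⊔ J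
  le : J ≤ Submodule.span R (Set.range x) ⊔ weightFilt l J 2

theorem mul_monomialSpan_le (h : IsClassicalIdeal l J) {x : Fin n → B} (hx : ∀ i, x i ∈ J)
    (k : ℕ) : Submodule.span R (Set.range x) * monomialSpan R x k ≤
      monomialSpan R x (k + 1) ⊔ (weightFilt l J (k + 1 - 2)).map (LinearMap.lsmul R B l) := by
  rw [monomialSpan, Submodule.span_mul_span, Submodule.span_le]
  rintro _ ⟨_, ⟨i, rfl⟩, _, ⟨I, hI, rfl⟩, rfl⟩
  have hp : (i :: I.toMultiset.toList).Perm (I + Finsupp.single i 1).toMultiset.toList := by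
    rw [← Multiset.coe_eq_coe]
    rw [← Multiset.cons_coe, Multiset.coe_toList, Multiset.coe_toList]
    simp [add_comm, Finsupp.toMultiset_single]
  obtain ⟨c, hc, e⟩ := prod_sub_prod_of_perm h (hp.map x) (by simp [hx])
  rw [List.length_map, List.length_cons, length_toMultiset_toList, Set.mem_ofPred.1 hI] at hc
  have e' : x i * orderedMonomial x I = orderedMonomial x (I + Finsupp.single i 1) + l • c := by
    rw [← e]; simp [orderedMonomial]
  simp only [e']
  refine Submodule.add_mem_sup (Submodule.subset_span ⟨_, ?_, rfl⟩) ⟨c, hc, rfl⟩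
  simp [Set.mem_ofPred.1 hI]

/-- Modulo higher weight and multiples of `l`, the elements of weight `k` are spanned by the ordered
monomials of degree `k`. -/
theorem weightFilt_le (h : IsClassicalIdeal l J) {x : Fin n → B} (hx : IsCoordinates l J x)
    (k : ℕ) : weightFilt l J k ≤ monomialSpan R x k ⊔ weightFilt l J (k + 1) ⊔
      (weightFilt l J (k - 2)).map (LinearMap.lsmul R B l) := by
  induction k with
  | zero =>
    refine hx.top_le.trans (le_trans (sup_le_sup ?_ le_rfl) le_sup_left)
    refine Submodule.span_mono ?_
    rintro _ rfl
    exact ⟨0, by simp, by simp [orderedMonomial]⟩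
  | succ k ih =>
    match k with
    | 0 =>
      refine hx.le.trans (le_trans (sup_le_sup (Submodule.span_mono ?_) le_rfl) le_sup_left)
      rintro _ ⟨i, rfl⟩
      exact ⟨Finsupp.single i 1, by simp, by simp [orderedMonomial, Finsupp.toMultiset_single]⟩
    | k + 1 =>
      refine sup_le ?_ le_sup_right
      refine Submodule.mul_le.2 fun a ha b hb => ?_
      obtain ⟨a₁, ha₁, a₂, ha₂, rfl⟩ := Submodule.mem_sup.1 (hx.le ha)
      obtain ⟨b', hb', _, ⟨b₃, hb₃, rfl⟩, rfl⟩ := Submodule.mem_sup.1 (ih hb)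
      obtain ⟨b₁, hb₁, b₂, hb₂, rfl⟩ := Submodule.mem_sup.1 hb'
      have ha₁' : a₁ ∈ J := Submodule.span_le.2 (by rintro _ ⟨i, rfl⟩; exact hx.mem i) ha₁
      have hb₁' : b₁ ∈ weightFilt l J (k + 1) := by
        refine Submodule.span_le.2 ?_ hb₁
        rintro _ ⟨I, hI, rfl⟩
        have := orderedMonomial_mem_weightFilt h hx.mem I
        rwa [Set.mem_ofPred.1 hI] at this
      have e : (a₁ + a₂) * (b₁ + b₂ + LinearMap.lsmul R B l b₃) =
          (a₁ * b₁ + (a₁ * b₂ + a₂ * (b₁ + b₂))) + LinearMap.lsmul R B l ((a₁ + a₂) * b₃) := by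
        simp only [LinearMap.lsmul_apply, mul_smul_comm, mul_add, add_mul, smul_add]
        abel
      rw [e]
      refine add_mem (add_mem ?_ (Submodule.mem_sup_left (Submodule.mem_sup_right (add_mem ?_ ?_))))
        (Submodule.mem_sup_right ⟨_, ?_, rfl⟩)
      · have hle := sup_le_sup (le_sup_left (a := monomialSpan R x (k + 1 + 1))
          (b := weightFilt l J (k + 1 + 1 + 1)))
          (le_refl ((weightFilt l J (k + 1 + 1 - 2)).map (LinearMap.lsmul R B l)))
        exact hle (mul_monomialSpan_le h hx.mem (k + 1) (Submodule.mul_mem_mul ha₁ hb₁))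
      · have := h.mul_weightFilt_mem ha₁' hb₂
        exact weightFilt_antitone h (by omega) this
      · have := mul_mem_weightFilt h ha₂ (add_mem hb₁' (weightFilt_antitone h (by omega) hb₂))
        exact weightFilt_antitone h (by omega) this
      · have := h.mul_weightFilt_mem (add_mem ha₁' (weightFilt_antitone h one_le_two ha₂)) hb₃
        exact weightFilt_antitone h (by omega) this

/-- A linear functional that takes each ordered monomial of degree `d` to a multiple of
`l ^ ⌈d / 2⌉`, and is continuous for the weight filtration, takes all elements of weight `k` to
multiples of `l ^ ⌈k / 2⌉`. -/
theorem map_weightFilt_dvd (h : IsClassicalIdeal l J) {x : Fin n → B} (hx : IsCoordinates l J x)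
    (φ : B →ₗ[R] R) (hcont : ∀ r, ∃ K, ∀ k ≥ K, ∀ b ∈ weightFilt l J k, l ^ r ∣ φ b)
    (hmon : ∀ r I, 2 * r ≤ I.degree + 1 → l ^ r ∣ φ (orderedMonomial x I))
    (r k : ℕ) (hk : 2 * r ≤ k + 1) (b : B) (hb : b ∈ weightFilt l J k) : l ^ r ∣ φ b := by
  induction r generalizing k b with
  | zero => simp
  | succ r ihr =>
    obtain ⟨K, hK⟩ := hcont (r + 1)
    obtain hk' | hk' := le_or_gt K k
    · exact hK k hk' b hb
    -- Downward induction on the weight, starting from the weight `K` given by continuity.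
    obtain ⟨d, rfl⟩ : ∃ d, K = k + d := ⟨K - k, by omega⟩
    clear hk'
    induction d generalizing k b with
    | zero => exact hK k le_rfl b hb
    | succ d ihd =>
      obtain ⟨b', hb', _, ⟨b₃, hb₃, rfl⟩, rfl⟩ := Submodule.mem_sup.1 (weightFilt_le h hx k hb)
      obtain ⟨b₁, hb₁, b₂, hb₂, rfl⟩ := Submodule.mem_sup.1 hb'
      rw [map_add, map_add]
      refine dvd_add (dvd_add ?_ ?_) ?_
      · have : monomialSpan R x k ≤ Submodule.comap φ (Ideal.span {l ^ (r + 1)}) := by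
          refine Submodule.span_le.2 ?_
          rintro _ ⟨I, hI, rfl⟩
          exact Ideal.mem_span_singleton.2 (hmon _ _ (by rw [Set.mem_ofPred.1 hI]; omega))
        exact Ideal.mem_span_singleton.1 (this hb₁)
      · exact ihd (k + 1) (by omega) b₂ hb₂ (fun j hj => hK j (by omega))
      · rw [LinearMap.lsmul_apply, map_smul, smul_eq_mul, pow_succ']
        exact mul_dvd_mul_left l (ihr (k - 2) (by omega) b₃ hb₃)

end WeightFiltration

/-! ### Leading coefficients for the weight filtration -/

/-- The exponents whose degree is at most `s` and has the same parity as `s`. -/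
def parityIndices (n s : ℕ) : Finset (Fin n →₀ ℕ) :=
  ((Finset.range (s + 1)).filter fun d => d % 2 = s % 2).biUnion fun d =>
    (Finset.univ : Finset (Fin n)).finsuppAntidiag d

theorem mem_parityIndices {n s : ℕ} {I : Fin n →₀ ℕ} :
    I ∈ parityIndices n s ↔ I.degree ≤ s ∧ I.degree % 2 = s % 2 := by
  simp only [parityIndices, Finset.mem_biUnion, Finset.mem_filter, Finset.mem_range,
    Finset.mem_finsuppAntidiag, Finset.subset_univ, and_true]
  rw [Finsupp.degree_eq_sum]
  constructor
  · rintro ⟨d, ⟨h, h'⟩, rfl⟩; exact ⟨Nat.lt_succ_iff.1 h, h'⟩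
  · rintro ⟨h, h'⟩; exact ⟨_, ⟨Nat.lt_succ_iff.2 h, h'⟩, rfl⟩

section WeightedSum

variable {B : Type*} [Ring B] [Algebra ℂ⟦X⟧ B] {J : Submodule ℂ⟦X⟧ B} {n : ℕ}

/-- The element of weight `s` with leading coefficients `a`. -/
def weightedSum (x : Fin n → B) (s : ℕ) (a : (Fin n →₀ ℕ) → ℂ) : B :=
  ∑ I ∈ parityIndices n s,
    (PowerSeries.C (a I) * PowerSeries.X ^ ((s - I.degree) / 2) : ℂ⟦X⟧) • orderedMonomial x I

theorem weightedSum_add (x : Fin n → B) (s : ℕ) (a b : (Fin n →₀ ℕ) → ℂ) :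
    weightedSum x s (a + b) = weightedSum x s a + weightedSum x s b := by
  simp [weightedSum, add_mul, add_smul, Finset.sum_add_distrib]

theorem weightedSum_smul (x : Fin n → B) (s : ℕ) (z : ℂ) (a : (Fin n →₀ ℕ) → ℂ) :
    weightedSum x s (z • a) = (PowerSeries.C z : ℂ⟦X⟧) • weightedSum x s a := by
  simp [weightedSum, Finset.smul_sum, smul_smul, mul_assoc]

theorem pow_smul_mem_weightFilt {R B : Type*} [CommRing R] [Ring B] [Algebra R B] {l : R}
    {J : Submodule R B} {k : ℕ} {b : B} (hb : b ∈ weightFilt l J k) (i : ℕ) :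
    l ^ i • b ∈ weightFilt l J (k + 2 * i) := by
  induction i with
  | zero => simpa using hb
  | succ i ih => rw [pow_succ', mul_smul]; exact smul_mem_weightFilt ih

theorem weightedSum_mem (h : IsClassicalIdeal PowerSeries.X J) {x : Fin n → B}
    (hx : ∀ i, x i ∈ J) (s : ℕ) (a : (Fin n →₀ ℕ) → ℂ) :
    weightedSum x s a ∈ weightFilt PowerSeries.X J s := by
  refine sum_mem fun I hI => ?_
  rw [mem_parityIndices] at hI
  rw [mul_smul]
  refine Submodule.smul_mem _ _ ?_
  have := pow_smul_mem_weightFilt (orderedMonomial_mem_weightFilt h hx I) ((s - I.degree) / 2)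
  rwa [show I.degree + 2 * ((s - I.degree) / 2) = s by omega] at this

/-- The elements of weight `s` that have leading coefficients. -/
def leadingSubmodule (h : IsClassicalIdeal PowerSeries.X J) {x : Fin n → B} (hx : ∀ i, x i ∈ J)
    (s : ℕ) : Submodule ℂ⟦X⟧ B where
  carrier := {f | f ∈ weightFilt PowerSeries.X J s ∧
    ∃ a, f - weightedSum x s a ∈ weightFilt PowerSeries.X J (s + 1)}
  zero_mem' := ⟨zero_mem _, 0, by simp [weightedSum]⟩
  add_mem' := by
    rintro f g ⟨hf, a, ha⟩ ⟨hg, b, hb⟩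
    refine ⟨add_mem hf hg, a + b, ?_⟩
    rw [weightedSum_add, add_sub_add_comm]
    exact add_mem ha hb
  smul_mem' := by
    rintro z f ⟨hf, a, ha⟩
    refine ⟨Submodule.smul_mem _ _ hf, PowerSeries.constantCoeff z • a, ?_⟩
    obtain ⟨w, hw⟩ : ∃ w : ℂ⟦X⟧, z = PowerSeries.X * w + PowerSeries.C (PowerSeries.constantCoeff z) :=
      ⟨_, PowerSeries.eq_X_mul_shift_add_const z⟩
    have e : z • f - weightedSum x s (PowerSeries.constantCoeff z • a) =
        z • (f - weightedSum x s a) + (PowerSeries.X : ℂ⟦X⟧) • w • weightedSum x s a := by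
      have hw' := congrArg (· • weightedSum x s a) hw
      simp only [add_smul, mul_smul] at hw'
      rw [weightedSum_smul, smul_sub, hw']
      abel
    rw [e]
    exact add_mem (Submodule.smul_mem _ _ ha) (weightFilt_antitone h (by omega)
      (smul_mem_weightFilt (Submodule.smul_mem _ w (weightedSum_mem h hx s a))))

theorem weightFilt_le_leadingSubmodule (h : IsClassicalIdeal PowerSeries.X J) {x : Fin n → B}
    (hx : IsCoordinates PowerSeries.X J x) (s : ℕ) :
    weightFilt PowerSeries.X J s ≤ leadingSubmodule h hx.mem s := by
  induction s using Nat.strong_induction_on with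
  | _ s ih =>
    refine (weightFilt_le h hx s).trans (sup_le (sup_le ?_ ?_) ?_)
    · refine Submodule.span_le.2 ?_
      rintro _ ⟨I, rfl, rfl⟩
      refine ⟨orderedMonomial_mem_weightFilt h hx.mem I, Pi.single I 1, ?_⟩
      rw [weightedSum, Finset.sum_eq_single I]
      · simp
      · intro K _ hK; simp [hK]
      · intro hI; exact absurd (mem_parityIndices.2 ⟨le_rfl, rfl⟩) hI
    · exact fun f hf => ⟨weightFilt_succ_le h s hf, 0, by simpa [weightedSum] using hf⟩
    · rintro _ ⟨f, hf, rfl⟩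
      rw [LinearMap.lsmul_apply]
      have hs := smul_mem_weightFilt hf
      obtain hs' | hs' := lt_or_ge s 2
      · have hs := weightFilt_antitone h (show s + 1 ≤ s - 2 + 2 by omega) hs
        exact ⟨weightFilt_succ_le h s hs, 0, by simpa [weightedSum] using hs⟩
      obtain ⟨s, rfl⟩ : ∃ t, s = t + 2 := ⟨s - 2, by omega⟩
      obtain ⟨-, a, ha⟩ := ih s (by omega) hf
      refine ⟨hs, fun I => if I.degree ≤ s then a I else 0, ?_⟩
      -- Multiplication by `λ` does not change the leading coefficients.
      have e : weightedSum x (s + 2) (fun I => if I.degree ≤ s then a I else 0) =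
          (PowerSeries.X : ℂ⟦X⟧) • weightedSum x s a := by
        rw [weightedSum, weightedSum, Finset.smul_sum]
        symm
        refine Finset.sum_subset_zero_on_sdiff ?_ ?_ ?_
        · intro I hI
          rw [mem_parityIndices] at hI ⊢
          omega
        · intro I hI
          rw [Finset.mem_sdiff, mem_parityIndices, mem_parityIndices] at hI
          rw [if_neg (by omega)]
          simp
        · intro I hI
          rw [mem_parityIndices] at hI
          rw [if_pos hI.1, smul_smul, show (s + 2 - I.degree) / 2 = (s - I.degree) / 2 + 1 by omega]
          congr 1
          ring
      rw [e, ← smul_sub]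
      exact weightFilt_antitone h (by omega) (smul_mem_weightFilt ha)

/-- An element of weight `s` is a combination of the elements `λ ^ i • x ^ I` with
`2 * i + |I| = s`, up to elements of weight `s + 1`. -/
theorem exists_sub_weightedSum_mem (h : IsClassicalIdeal PowerSeries.X J) {x : Fin n → B}
    (hx : IsCoordinates PowerSeries.X J x) {s : ℕ} {f : B}
    (hf : f ∈ weightFilt PowerSeries.X J s) :
    ∃ a, f - weightedSum x s a ∈ weightFilt PowerSeries.X J (s + 1) :=
  (weightFilt_le_leadingSubmodule h hx s hf).2

end WeightedSum

/-! ### The coefficients of a deformed product -/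

namespace FormalSeries

variable {A : Type*} [AddCommGroup A]

theorem const_add (a b : A) : const (a + b) = const a + const b := by
  ext r; by_cases hr : r = 0 <;> simp [const, hr]

variable [Module ℂ A]

theorem const_smul (z : ℂ) (a : A) : const (z • a) = (PowerSeries.C z : ℂ⟦X⟧) • const a := by
  ext r
  rw [coeff_smul, Finset.sum_eq_single (0, r)]
  · by_cases hr : r = 0 <;> simp [const, hr]
  · rintro ⟨i, j⟩ h hne
    have hi : i ≠ 0 := by
      rintro rfl
      exact hne (by simpa using h)
    simp [PowerSeries.coeff_C, hi]
  · simp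

theorem coeff_C_smul (z : ℂ) (a : FormalSeries A) (r : ℕ) :
    ((PowerSeries.C z : ℂ⟦X⟧) • a).coeff r = z • a.coeff r := by
  rw [coeff_smul, Finset.sum_eq_single (0, r)]
  · simp
  · rintro ⟨i, j⟩ h hne
    have hi : i ≠ 0 := by
      rintro rfl
      exact hne (by simpa using h)
    simp [PowerSeries.coeff_C, hi]
  · simp

theorem coeff_X_smul_zero (a : FormalSeries A) :
    ((PowerSeries.X : ℂ⟦X⟧) • a).coeff 0 = 0 := by
  simp [coeff_smul]

theorem coeff_X_smul_succ (a : FormalSeries A) (r : ℕ) :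
    ((PowerSeries.X : ℂ⟦X⟧) • a).coeff (r + 1) = a.coeff r := by
  rw [coeff_smul, Finset.Nat.antidiagonal_succ, Finset.sum_cons, Finset.sum_map]
  rw [Finset.sum_eq_single (0, r)]
  · simp [PowerSeries.coeff_X]
  · rintro ⟨i, j⟩ h hne
    have hi : i ≠ 0 := by
      rintro rfl
      exact hne (by simpa using h)
    simp [PowerSeries.coeff_X, hi]
  · simp

/-- The series `∑ λ ^ r a_{r+1}`. -/
def shift (a : FormalSeries A) : FormalSeries A := ⟨fun r => a.coeff (r + 1)⟩

theorem eq_const_add_X_smul (a : FormalSeries A) :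
    a = const (a.coeff 0) + (PowerSeries.X : ℂ⟦X⟧) • a.shift := by
  ext r
  cases r with
  | zero => simp [const, coeff_X_smul_zero]
  | succ r => simp [const, coeff_X_smul_succ, shift]

end FormalSeries

namespace HermitianDeformation

variable {A : Type*} [Ring A] [StarRing A] [Algebra ℂ A]
  (D : HermitianDeformation A)

/-- The coefficient `C_r` as a bilinear map. -/
def coeffLin (r : ℕ) : A →ₗ[ℂ] A →ₗ[ℂ] A :=
  LinearMap.mk₂ ℂ (D.coeff r)
    (fun a a' b => by simp [coeff, FormalSeries.const_add])
    (fun z a b => by simp [coeff, FormalSeries.const_smul, FormalSeries.coeff_C_smul])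
    (fun a b b' => by simp [coeff, FormalSeries.const_add])
    (fun z a b => by simp [coeff, FormalSeries.const_smul, FormalSeries.coeff_C_smul])

theorem coeffLin_zero (a b : A) : D.coeffLin 0 a b = a * b := D.mul_coeff_zero a b

theorem coeff_mul_eq_sum_const_left (f g : FormalSeries A) (r : ℕ) :
    (D.mul f g).coeff r = ∑ p ∈ antidiagonal r, (D.mul (.const (f.coeff p.1)) g).coeff p.2 := by
  induction r generalizing f with
  | zero =>
    conv_lhs => rw [f.eq_const_add_X_smul]
    simp [FormalSeries.coeff_X_smul_zero]
  | succ r ih =>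
    conv_lhs => rw [f.eq_const_add_X_smul]
    rw [map_add, map_smul, LinearMap.add_apply, LinearMap.smul_apply, FormalSeries.coeff_add,
      FormalSeries.coeff_X_smul_succ, ih, Finset.Nat.antidiagonal_succ, Finset.sum_cons,
      Finset.sum_map]
    rfl

theorem coeff_mul_const_left (a : A) (g : FormalSeries A) (r : ℕ) :
    (D.mul (.const a) g).coeff r = ∑ p ∈ antidiagonal r, D.coeffLin p.2 a (g.coeff p.1) := by
  induction r generalizing g with
  | zero =>
    conv_lhs => rw [g.eq_const_add_X_smul]
    simp [FormalSeries.coeff_X_smul_zero]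
    rfl
  | succ r ih =>
    conv_lhs => rw [g.eq_const_add_X_smul]
    rw [map_add, map_smul, FormalSeries.coeff_add,
      FormalSeries.coeff_X_smul_succ, ih, Finset.Nat.antidiagonal_succ, Finset.sum_cons,
      Finset.sum_map]
    rfl

theorem coeff_mul (f g : FormalSeries A) (r : ℕ) :
    (D.mul f g).coeff r = ∑ p ∈ antidiagonal r, ∑ q ∈ antidiagonal p.2,
      D.coeffLin q.2 (f.coeff p.1) (g.coeff q.1) := by
  simp only [D.coeff_mul_eq_sum_const_left f g, coeff_mul_const_left]

theorem coeff_zero_mul (f g : FormalSeries A) :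
    (D.mul f g).coeff 0 = f.coeff 0 * g.coeff 0 := by
  simp [coeff_mul, coeffLin_zero]

end HermitianDeformation

/-! ### The algebra of formal series with a star product -/

section StarAlg

variable {n : ℕ} {M : Type*} [TopologicalSpace M] [ChartedSpace (EuclideanSpace ℝ (Fin n)) M]
  {P : PoissonBracket n M}

/-- The space `C^∞(M)[[λ]]`, regarded as an algebra with the star product as multiplication. -/
def StarAlg (_ : HermitianStarProduct P) : Type _ := FormalSeries (SmoothFn n M)

namespace StarAlg

variable (S : HermitianStarProduct P)

instance : AddCommGroup (StarAlg S) := inferInstanceAs (AddCommGroup (FormalSeries (SmoothFn n M)))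

instance : Module ℂ⟦X⟧ (StarAlg S) := inferInstanceAs (Module ℂ⟦X⟧ (FormalSeries (SmoothFn n M)))

instance : Ring (StarAlg S) :=
  { (inferInstance : AddCommGroup (StarAlg S)) with
    mul := fun f g => S.mul f g
    one := FormalSeries.const 1
    left_distrib := fun f g h => map_add (S.mul f) g h
    right_distrib := fun f g h => LinearMap.map_add₂ S.mul f g h
    zero_mul := fun f => LinearMap.map_zero₂ S.mul f
    mul_zero := fun f => map_zero (S.mul f)
    mul_assoc := S.mul_assoc
    one_mul := S.one_mul
    mul_one := S.mul_one }

instance : Algebra ℂ⟦X⟧ (StarAlg S) :=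
  Algebra.ofModule
    (fun z f g => LinearMap.map_smul₂ S.mul z f g)
    (fun z f g => map_smul (S.mul f) z g)

instance : StarRing (StarAlg S) where
  star f := (⟨fun r => star (f.coeff r)⟩ : FormalSeries (SmoothFn n M))
  star_involutive f := FormalSeries.ext (funext fun r => star_star (f.coeff r))
  star_mul f g := S.star_mul f g
  star_add f g := FormalSeries.ext (funext fun r => star_add (f.coeff r) (g.coeff r))

variable {S}

/-- The coefficient of `λ ^ r`. -/
def cf (f : StarAlg S) (r : ℕ) : SmoothFn n M := f.coeff r

@[ext] theorem ext {f g : StarAlg S} (h : ∀ r, f.cf r = g.cf r) : f = g :=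
  FormalSeries.ext (funext h)

variable (S) in
/-- A smooth function as a constant formal series. -/
def ofFn (a : SmoothFn n M) : StarAlg S := FormalSeries.const a

@[simp] theorem cf_ofFn (a : SmoothFn n M) (r : ℕ) : (ofFn S a).cf r = if r = 0 then a else 0 := rfl
@[simp] theorem cf_one (r : ℕ) : (1 : StarAlg S).cf r = if r = 0 then 1 else 0 := rfl
@[simp] theorem cf_add (f g : StarAlg S) (r : ℕ) : (f + g).cf r = f.cf r + g.cf r := rfl
@[simp] theorem cf_neg (f : StarAlg S) (r : ℕ) : (-f).cf r = -f.cf r := rfl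
@[simp] theorem cf_sub (f g : StarAlg S) (r : ℕ) : (f - g).cf r = f.cf r - g.cf r := by
  rw [sub_eq_add_neg, cf_add, cf_neg, sub_eq_add_neg]
@[simp] theorem cf_star (f : StarAlg S) (r : ℕ) : (star f).cf r = star (f.cf r) := rfl

theorem cf_smul (z : ℂ⟦X⟧) (f : StarAlg S) (r : ℕ) :
    (z • f).cf r = ∑ p ∈ antidiagonal r, PowerSeries.coeff p.1 z • f.cf p.2 := rfl

theorem cf_sum {ι : Type*} (s : Finset ι) (f : ι → StarAlg S) (r : ℕ) :
    (∑ k ∈ s, f k).cf r = ∑ k ∈ s, (f k).cf r :=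
  FormalSeries.coeff_sum s f r

@[simp] theorem cf_X_smul_zero (f : StarAlg S) : ((PowerSeries.X : ℂ⟦X⟧) • f).cf 0 = 0 :=
  FormalSeries.coeff_X_smul_zero f

@[simp] theorem cf_X_smul_succ (f : StarAlg S) (r : ℕ) :
    ((PowerSeries.X : ℂ⟦X⟧) • f).cf (r + 1) = f.cf r :=
  FormalSeries.coeff_X_smul_succ f r

@[simp] theorem cf_C_smul (z : ℂ) (f : StarAlg S) (r : ℕ) :
    ((PowerSeries.C z : ℂ⟦X⟧) • f).cf r = z • f.cf r :=
  FormalSeries.coeff_C_smul z f r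

theorem cf_mul (f g : StarAlg S) (r : ℕ) :
    (f * g).cf r = ∑ p ∈ antidiagonal r, ∑ q ∈ antidiagonal p.2,
      S.coeffLin q.2 (f.cf p.1) (g.cf q.1) :=
  S.coeff_mul f g r

theorem cf_zero_mul (f g : StarAlg S) : (f * g).cf 0 = f.cf 0 * g.cf 0 :=
  S.coeff_zero_mul f g

/-- The series `∑ λ ^ r f_{r+1}`. -/
def shift (f : StarAlg S) : StarAlg S := FormalSeries.shift f

@[simp] theorem cf_shift (f : StarAlg S) (r : ℕ) : f.shift.cf r = f.cf (r + 1) := rfl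

theorem eq_ofFn_add_X_smul (f : StarAlg S) :
    f = ofFn S (f.cf 0) + (PowerSeries.X : ℂ⟦X⟧) • f.shift :=
  FormalSeries.eq_const_add_X_smul f

theorem eq_X_smul_shift {f : StarAlg S} (hf : f.cf 0 = 0) :
    f = (PowerSeries.X : ℂ⟦X⟧) • f.shift := by
  ext1 r
  cases r <;> simp [hf]

theorem star_X_smul (f : StarAlg S) :
    star ((PowerSeries.X : ℂ⟦X⟧) • f) = (PowerSeries.X : ℂ⟦X⟧) • star f := by
  ext1 r
  cases r <;> simp

theorem star_C_smul (z : ℂ) (f : StarAlg S) :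
    star ((PowerSeries.C z : ℂ⟦X⟧) • f) = (PowerSeries.C (star z) : ℂ⟦X⟧) • star f := by
  ext1 r
  simp

end StarAlg

end StarAlg

/-! ### Hadamard's lemma -/

section Hadamard

variable {E F : Type*} [NormedAddCommGroup E] [NormedSpace ℝ E] [FiniteDimensional ℝ E]
  [NormedAddCommGroup F] [NormedSpace ℝ F]

theorem hasFDerivAt_integral_of_contDiff {G : E × ℝ → F} (hG : ContDiff ℝ ∞ G) (z : E) :
    HasFDerivAt (fun z => ∫ t in (0 : ℝ)..1, G (z, t))
      (∫ t in (0 : ℝ)..1, (fderiv ℝ G (z, t)).comp (ContinuousLinearMap.inl ℝ E ℝ)) z := by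
  have hG' : Continuous fun p : E × ℝ => (fderiv ℝ G p).comp (ContinuousLinearMap.inl ℝ E ℝ) :=
    (hG.continuous_fderiv (by simp)).clm_comp continuous_const
  obtain ⟨C, hC⟩ := ((isCompact_closedBall z 1).prod
    (isCompact_Icc (a := (0 : ℝ)) (b := 1))).exists_bound_of_continuousOn hG'.continuousOn
  refine intervalIntegral.hasFDerivAt_integral_of_dominated_of_fderiv_le
    (F := fun z t => G (z, t)) (μ := MeasureTheory.volume)
    (F' := fun z t => (fderiv ℝ G (z, t)).comp (ContinuousLinearMap.inl ℝ E ℝ))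
    (bound := fun _ => C) (Metric.closedBall_mem_nhds z one_pos) ?_ ?_ ?_ ?_ ?_ ?_
  · exact Filter.Eventually.of_forall fun w =>
      (hG.continuous.comp (Continuous.prodMk_right w)).aestronglyMeasurable
  · exact (hG.continuous.comp (Continuous.prodMk_right z)).intervalIntegrable _ _
  · exact (hG'.comp (Continuous.prodMk_right z)).aestronglyMeasurable
  · refine Filter.Eventually.of_forall fun t ht w hw => hC (w, t) ⟨hw, ?_⟩
    rw [Set.uIoc_of_le zero_le_one] at ht
    exact Set.Ioc_subset_Icc_self ht
  · exact intervalIntegrable_const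
  · refine Filter.Eventually.of_forall fun t _ w _ => ?_
    exact ((hG.differentiable (by simp)) (w, t)).hasFDerivAt.comp w (hasFDerivAt_prodMk_left w t)

theorem contDiff_integral {G : E × ℝ → F} (hG : ContDiff ℝ ∞ G) :
    ContDiff ℝ ∞ fun z => ∫ t in (0 : ℝ)..1, G (z, t) := by
  rw [contDiff_infty]
  intro k
  induction k generalizing G with
  | zero =>
    exact contDiff_zero.2 (continuous_iff_continuousAt.2 fun z =>
      (hasFDerivAt_integral_of_contDiff hG z).continuousAt)
  | succ k ih =>
    rw [Nat.cast_add, Nat.cast_one, contDiff_succ_iff_fderiv_apply]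
    refine ⟨fun z => (hasFDerivAt_integral_of_contDiff hG z).differentiableAt, by simp, fun v => ?_⟩
    have hG' : ContDiff ℝ ∞ fun p : E × ℝ => fderiv ℝ G p (v, 0) :=
      (hG.fderiv_right (m := ∞) (by simp)).clm_apply contDiff_const
    convert ih hG' using 2 with z
    rw [(hasFDerivAt_integral_of_contDiff hG z).fderiv]
    rw [ContinuousLinearMap.intervalIntegral_apply]
    · rfl
    · refine Continuous.intervalIntegrable ?_ _ _
      exact (((hG.continuous_fderiv (by simp)).clm_comp continuous_const)).comp
        (Continuous.prodMk_right z)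

variable [CompleteSpace F]

/-- Hadamard's lemma, with the function written as an integral of its derivative along segments. -/
theorem exists_contDiff_sub_eq (G : E → F) (hG : ContDiff ℝ ∞ G) (a : E) :
    ∃ g : E → E →L[ℝ] F, (∀ v, ContDiff ℝ ∞ fun z => g z v) ∧ g a = fderiv ℝ G a ∧
      ∀ z, G z = G a + g z (z - a) := by
  have hcont : Continuous (fderiv ℝ G) := hG.continuous_fderiv (by simp)
  have hint (z : E) : IntervalIntegrable (fun t : ℝ => fderiv ℝ G (a + t • (z - a)))
      MeasureTheory.volume 0 1 := (hcont.comp (by fun_prop)).intervalIntegrable _ _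
  refine ⟨fun z => ∫ t in (0 : ℝ)..1, fderiv ℝ G (a + t • (z - a)), fun v => ?_, ?_, fun z => ?_⟩
  · have h : ContDiff ℝ ∞ fun p : E × ℝ => fderiv ℝ G (a + p.2 • (p.1 - a)) v :=
      ((hG.fderiv_right (m := ∞) (by simp)).comp (by fun_prop)).clm_apply contDiff_const
    convert contDiff_integral h using 2 with z
    rw [ContinuousLinearMap.intervalIntegral_apply (hint z)]
  · simp
  · have h (t : ℝ) : HasDerivAt (fun t : ℝ => G (a + t • (z - a)))
        (fderiv ℝ G (a + t • (z - a)) (z - a)) t := by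
      have := ((hG.differentiable (by simp)) (a + t • (z - a))).hasFDerivAt.comp_hasDerivAt t
        (((hasDerivAt_id t).smul_const (z - a)).const_add a)
      simpa [Function.comp_def] using this
    rw [ContinuousLinearMap.intervalIntegral_apply (hint z),
      intervalIntegral.integral_eq_sub_of_hasDerivAt (fun t _ => h t)
        (((hcont.comp (by fun_prop)).clm_apply continuous_const).intervalIntegrable _ _)]
    simp

end Hadamard

/-! ### Smooth functions and their orders of vanishing -/

section SmoothFunctions

variable {n : ℕ} {M : Type*} [TopologicalSpace M] [ChartedSpace (EuclideanSpace ℝ (Fin n)) M]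

theorem SmoothFn.contMDiff (f : SmoothFn n M) : ContMDiff (𝓡 n) 𝓘(ℝ, ℂ) ∞ (f : M → ℂ) := f.2

/-- A smooth function as an element of `SmoothFn n M`. -/
def SmoothFn.mk (f : M → ℂ) (hf : ContMDiff (𝓡 n) 𝓘(ℝ, ℂ) ∞ f) : SmoothFn n M := ⟨f, hf⟩

variable (n) in
/-- Evaluation at a point. -/
def evalAt (y : M) : SmoothFn n M →ₐ[ℂ] ℂ :=
  (Pi.evalAlgHom ℂ (fun _ : M => ℂ) y).comp (SmoothFn n M).toSubalgebra.val

theorem evalAt_apply (y : M) (f : SmoothFn n M) : evalAt n y f = (f : M → ℂ) y := rfl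

@[simp] theorem evalAt_star (y : M) (f : SmoothFn n M) : evalAt n y (star f) = star (evalAt n y f) :=
  rfl

theorem SmoothFn.ext {f g : SmoothFn n M} (h : ∀ y, evalAt n y f = evalAt n y g) : f = g :=
  Subtype.ext (funext h)

variable (n) in
/-- The ideal of functions that vanish at `y`; its powers measure the order of vanishing. -/
def vanishIdeal (y : M) : Ideal (SmoothFn n M) := RingHom.ker (evalAt n y)

theorem mem_vanishIdeal {y : M} {f : SmoothFn n M} : f ∈ vanishIdeal n y ↔ evalAt n y f = 0 :=
  Iff.rfl

theorem sub_evalAt_mem_vanishIdeal (y : M) (f : SmoothFn n M) :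
    f - algebraMap ℂ _ (evalAt n y f) ∈ vanishIdeal n y := by
  rw [mem_vanishIdeal, map_sub, AlgHom.commutes]
  exact sub_self _

variable [IsManifold (𝓡 n) ∞ M]

/-- The expression of a smooth function in a chart. -/
theorem contDiffOn_comp_chart_symm (c : M) (f : SmoothFn n M) :
    ContDiffOn ℝ ∞ ((f : M → ℂ) ∘ (chartAt (EuclideanSpace ℝ (Fin n)) c).symm)
      (chartAt (EuclideanSpace ℝ (Fin n)) c).target :=
  contMDiffOn_iff_contDiffOn.1
    ((SmoothFn.contMDiff f).comp_contMDiffOn (contMDiffOn_chart_symm (I := 𝓡 n)))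

/-- The derivatives of order less than `N` of an element of `vanishIdeal n y ^ N` vanish at `y`. -/
theorem iteratedFDeriv_eq_zero {c y : M} (hy : y ∈ (chartAt (EuclideanSpace ℝ (Fin n)) c).source)
    {N : ℕ} {f : SmoothFn n M} (hf : f ∈ vanishIdeal n y ^ N) {k : ℕ} (hk : k < N) :
    iteratedFDeriv ℝ k ((f : M → ℂ) ∘ (chartAt (EuclideanSpace ℝ (Fin n)) c).symm)
      (chartAt (EuclideanSpace ℝ (Fin n)) c y) = 0 := by
  set φ := chartAt (EuclideanSpace ℝ (Fin n)) c
  have hφy := φ.map_source hy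
  rw [← iteratedFDerivWithin_of_isOpen k φ.open_target hφy]
  induction N generalizing f k with
  | zero => omega
  | succ N ih =>
    rw [pow_succ'] at hf
    induction hf using Submodule.mul_induction_on' with
    | add f _ g _ hf hg =>
      have hadd := iteratedFDerivWithin_add_apply (i := k)
        (((contDiffOn_comp_chart_symm c f) _ hφy).of_le (by exact_mod_cast le_top))
        (((contDiffOn_comp_chart_symm c g) _ hφy).of_le (by exact_mod_cast le_top))
        φ.open_target.uniqueDiffOn hφy
      rw [hf, hg, add_zero] at hadd
      exact hadd
    | mem_mul_mem u hu f hf =>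
      have hmul := norm_iteratedFDerivWithin_mul_le (N := ∞) (contDiffOn_comp_chart_symm c u)
        (contDiffOn_comp_chart_symm c f) φ.open_target.uniqueDiffOn hφy (n := k)
        (by exact_mod_cast le_top)
      refine norm_le_zero_iff.1 (hmul.trans (le_of_eq (Finset.sum_eq_zero fun i hi => ?_)))
      rw [Finset.mem_range] at hi
      cases i with
      | zero =>
        rw [norm_iteratedFDerivWithin_zero, Function.comp_apply, φ.left_inv hy,
          show (u : M → ℂ) y = 0 from hu]
        simp
      | succ i => rw [ih (k := k - (i + 1)) hf (by omega)]; simp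

variable [T2Space M]

theorem exists_bump (y : M) {V : Set M} (hV : V ∈ nhds y) :
    ∃ ψ : SmoothFn n M, evalAt n y ψ = 1 ∧ ∀ z ∉ V, evalAt n z ψ = 0 := by
  obtain ⟨ρ, -, hρ⟩ := (SmoothBumpFunction.nhds_basis_support (I := 𝓡 n) hV).mem_iff.1 hV
  refine ⟨.mk (fun z => (ρ z : ℂ)) (Complex.ofRealCLM.contMDiff.comp ρ.contMDiff), ?_, ?_⟩
  · simp [evalAt_apply]
  · intro z hz
    have : ρ z = 0 := by
      by_contra h
      exact hz (hρ h)
    simp [evalAt_apply, this]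

/-- A function that vanishes near `y` vanishes to infinite order. -/
theorem mem_vanishIdeal_pow_of_eventuallyEq {y : M} {f : SmoothFn n M}
    (hf : ∀ᶠ z in nhds y, evalAt n z f = 0) (k : ℕ) : f ∈ vanishIdeal n y ^ k := by
  obtain ⟨ψ, h1, h0⟩ := exists_bump (n := n) y hf
  have e : f * ψ = 0 := SmoothFn.ext fun z => by
    rw [map_mul, map_zero]
    by_cases hz : evalAt n z f = 0
    · rw [hz, zero_mul]
    · rw [h0 z hz, mul_zero]
  have e' : f = f * (1 - ψ) ^ k := by
    induction k with
    | zero => simp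
    | succ k ih => rw [pow_succ, ← mul_assoc, ← ih, mul_sub, e, mul_one, sub_zero]
  rw [e']
  refine Ideal.mul_mem_left _ _ (Ideal.pow_mem_pow ?_ k)
  rw [mem_vanishIdeal, map_sub, map_one, h1, sub_self]

/-- An operator of order less than `N` near `y` lowers the order of vanishing at `y` by at most
`N`. The proof is an induction over the commutators of the operator with functions, whose orders
are smaller. -/
theorem map_vanishIdeal_pow {V : Set M} (hV : IsOpen V) (N : ℕ)
    (D : SmoothFn n M →ₗ[ℂ] SmoothFn n M)
    (hD : ∀ z ∈ V, ∀ f ∈ vanishIdeal n z ^ N, evalAt n z (D f) = 0) {y : M} (hy : y ∈ V) (k : ℕ)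
    {f : SmoothFn n M} (hf : f ∈ vanishIdeal n y ^ (k + N)) : D f ∈ vanishIdeal n y ^ k := by
  induction N generalizing D k f with
  | zero =>
    refine mem_vanishIdeal_pow_of_eventuallyEq ?_ k
    filter_upwards [hV.mem_nhds hy] with z hz
    exact hD z hz f (by simp)
  | succ N ihN =>
    induction k generalizing f with
    | zero => simp
    | succ k ihk =>
      rw [show k + 1 + (N + 1) = k + (N + 1) + 1 by ring, pow_succ'] at hf
      induction hf using Submodule.mul_induction_on' with
      | add f _ g _ hf hg => rw [map_add]; exact add_mem hf hg
      | mem_mul_mem u hu f hf =>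
        have e : D (u * f) = u * D f + (D (u * f) - u * D f) := by ring
        rw [e]
        refine add_mem ?_ ?_
        · rw [pow_succ']
          exact Ideal.mul_mem_mul hu (ihk hf)
        · refine ihN (D ∘ₗ LinearMap.mulLeft ℂ u - LinearMap.mulLeft ℂ u ∘ₗ D) ?_ (k + 1)
            (by rwa [show k + 1 + N = k + (N + 1) by ring])
          intro z hz g hg
          have e : (D ∘ₗ LinearMap.mulLeft ℂ u - LinearMap.mulLeft ℂ u ∘ₗ D) g =
              D ((u - algebraMap ℂ _ (evalAt n z u)) * g) -
                (u - algebraMap ℂ _ (evalAt n z u)) * D g := by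
            simp only [LinearMap.sub_apply, LinearMap.comp_apply, LinearMap.mulLeft_apply, sub_mul,
              map_sub, ← Algebra.smul_def, map_smul]
            abel
          have hu' := sub_evalAt_mem_vanishIdeal z u
          rw [e, map_sub (evalAt n z), map_mul (evalAt n z) (u - _), mem_vanishIdeal.1 hu',
            zero_mul, sub_zero]
          refine hD z hz _ ?_
          rw [pow_succ']
          exact Ideal.mul_mem_mul hu' hg

end SmoothFunctions

/-! ### Bidifferential operators and local coordinates -/

section Coordinates

variable {n : ℕ} {M : Type*} [TopologicalSpace M] [ChartedSpace (EuclideanSpace ℝ (Fin n)) M]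
  [IsManifold (𝓡 n) ∞ M]

/-- On a compact set the order of a bidifferential operator in its second argument is bounded. -/
theorem IsBidifferential.exists_order {B : SmoothFn n M → SmoothFn n M → SmoothFn n M}
    (hB : IsBidifferential B) {K : Set M} (hK : IsCompact K) :
    ∃ N, ∀ y ∈ K, ∀ g, ∀ f ∈ vanishIdeal n y ^ N, evalAt n y (B g f) = 0 := by
  refine hK.induction_on (p := fun K => ∃ N, ∀ y ∈ K, ∀ g, ∀ f ∈ vanishIdeal n y ^ N,
    evalAt n y (B g f) = 0) ⟨0, by simp⟩ ?_ ?_ ?_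
  · rintro s t hst ⟨N, hN⟩
    exact ⟨N, fun y hy => hN y (hst hy)⟩
  · rintro s t ⟨N, hN⟩ ⟨N', hN'⟩
    refine ⟨max N N', ?_⟩
    rintro y (hy | hy) g f hf
    · exact hN y hy g f (Ideal.pow_le_pow_right (le_max_left _ _) hf)
    · exact hN' y hy g f (Ideal.pow_le_pow_right (le_max_right _ _) hf)
  · intro x _
    obtain ⟨U, hU, hxU, hUc, N, a, -, ha⟩ := hB x
    refine ⟨U, mem_nhdsWithin_of_mem_nhds (hU.mem_nhds hxU), N + 1, fun y hy g f hf => ?_⟩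
    rw [evalAt_apply, ha g f y hy]
    refine Finset.sum_eq_zero fun k _ => Finset.sum_eq_zero fun l hl =>
      Finset.sum_eq_zero fun i _ => Finset.sum_eq_zero fun j _ => ?_
    have : partialDeriv x j (f : M → ℂ) y = 0 := by
      simp only [partialDeriv]
      rw [iteratedFDeriv_eq_zero (hUc hy) hf (Finset.mem_range.1 hl)]
      rfl
    rw [this, mul_zero]

/-- Functions `x i` on `M` that are coordinates on the open set `V`, with globally defined
derivations `d i` that are the partial derivatives on `V`. The last field is the Taylor formula of
order one. -/
structure LocalCoordinates (n : ℕ) {M : Type*} [TopologicalSpace M]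
    [ChartedSpace (EuclideanSpace ℝ (Fin n)) M] (V : Set M) where
  /-- the coordinate functions -/
  x : Fin n → SmoothFn n M
  /-- the partial derivatives -/
  d : Fin n → SmoothFn n M →ₗ[ℂ] SmoothFn n M
  isOpen : IsOpen V
  star_x : ∀ i, star (x i) = x i
  d_mul : ∀ i f g, d i (f * g) = d i f * g + f * d i g
  d_x : ∀ y ∈ V, ∀ i j, evalAt n y (d i (x j)) = if i = j then 1 else 0
  sub_mem : ∀ y ∈ V, ∀ f ∈ vanishIdeal n y,
    f - ∑ i, evalAt n y (d i f) • (x i - algebraMap ℂ _ (evalAt n y (x i))) ∈ vanishIdeal n y ^ 2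

variable {c : M}

/-- A function that is smooth in a chart domain, multiplied by a bump function supported there. -/
def cutoff [T2Space M] (ρ : SmoothBumpFunction (𝓡 n) c) (g : M → ℂ)
    (hg : ContMDiffOn (𝓡 n) 𝓘(ℝ, ℂ) ∞ g (chartAt (EuclideanSpace ℝ (Fin n)) c).source) :
    SmoothFn n M :=
  .mk (fun x => ρ x • g x) (ρ.contMDiff_smul hg)

theorem contMDiffOn_comp_chart {G : EuclideanSpace ℝ (Fin n) → ℂ}
    (hG : ContDiffOn ℝ ∞ G (chartAt (EuclideanSpace ℝ (Fin n)) c).target) :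
    ContMDiffOn (𝓡 n) 𝓘(ℝ, ℂ) ∞ (fun z => G (chartAt (EuclideanSpace ℝ (Fin n)) c z))
      (chartAt (EuclideanSpace ℝ (Fin n)) c).source :=
  hG.contMDiffOn.comp (contMDiffOn_chart (I := 𝓡 n))
    (chartAt (EuclideanSpace ℝ (Fin n)) c).mapsTo

/-- A partial derivative in a chart. -/
def chartDeriv (c : M) (i : Fin n) (f : SmoothFn n M) (z : M) : ℂ :=
  fderiv ℝ ((f : M → ℂ) ∘ (chartAt (EuclideanSpace ℝ (Fin n)) c).symm)
    (chartAt (EuclideanSpace ℝ (Fin n)) c z) (EuclideanSpace.single i 1)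

theorem contMDiffOn_chartDeriv (i : Fin n) (f : SmoothFn n M) :
    ContMDiffOn (𝓡 n) 𝓘(ℝ, ℂ) ∞ (chartDeriv c i f)
      (chartAt (EuclideanSpace ℝ (Fin n)) c).source :=
  contMDiffOn_comp_chart (((contDiffOn_comp_chart_symm c f).fderiv_of_isOpen
    (chartAt (EuclideanSpace ℝ (Fin n)) c).open_target (by simp)).clm_apply contDiffOn_const)

theorem differentiableAt_comp_chart_symm (f : SmoothFn n M) {z : M}
    (hz : z ∈ (chartAt (EuclideanSpace ℝ (Fin n)) c).source) :
    DifferentiableAt ℝ ((f : M → ℂ) ∘ (chartAt (EuclideanSpace ℝ (Fin n)) c).symm)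
      (chartAt (EuclideanSpace ℝ (Fin n)) c z) :=
  ((contDiffOn_comp_chart_symm c f).contDiffAt ((chartAt _ c).open_target.mem_nhds
    ((chartAt _ c).map_source hz))).differentiableAt (by simp)

/-- The function `f`, expressed in the chart at `c`, agrees near a given point with a smooth
function on Euclidean space. -/
theorem exists_contDiff_eventuallyEq (f : SmoothFn n M) {a : EuclideanSpace ℝ (Fin n)}
    (ha : a ∈ (chartAt (EuclideanSpace ℝ (Fin n)) c).target) :
    ∃ G : EuclideanSpace ℝ (Fin n) → ℂ, ContDiff ℝ ∞ G ∧
      G =ᶠ[nhds a] (f : M → ℂ) ∘ (chartAt (EuclideanSpace ℝ (Fin n)) c).symm := by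
  set φ := chartAt (EuclideanSpace ℝ (Fin n)) c
  obtain ⟨r, hr, hrt⟩ := Metric.nhds_basis_closedBall.mem_iff.1 (φ.open_target.mem_nhds ha)
  let b : ContDiffBump a := ⟨r / 2, r, by positivity, by linarith⟩
  refine ⟨fun z => b z • ((f : M → ℂ) ∘ φ.symm) z, ?_, ?_⟩
  · refine contDiff_iff_contDiffAt.2 fun z => ?_
    by_cases hz : z ∈ Metric.closedBall a r
    · exact b.contDiffAt.smul ((contDiffOn_comp_chart_symm c f).contDiffAt
        (φ.open_target.mem_nhds (hrt hz)))
    · have : (fun z => b z • ((f : M → ℂ) ∘ φ.symm) z) =ᶠ[nhds z] fun _ => 0 := by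
        filter_upwards [Metric.isClosed_closedBall.isOpen_compl.mem_nhds hz] with w hw
        rw [b.zero_of_le_dist (not_le.1 (fun h => hw h)).le, zero_smul]
      exact contDiffAt_const.congr_of_eventuallyEq this
  · filter_upwards [b.eventuallyEq_one] with z hz
    rw [hz]
    simp

variable [T2Space M]

/-- Hadamard's lemma in a chart. -/
theorem exists_eventuallyEq_sum (ρ : SmoothBumpFunction (𝓡 n) c) {y : M}
    (hy : y ∈ (chartAt (EuclideanSpace ℝ (Fin n)) c).source) (f : SmoothFn n M) :
    ∃ u : Fin n → SmoothFn n M, (∀ i, evalAt n y (u i) = ρ y • chartDeriv c i f y) ∧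
      ({z | ρ z = 1} ∈ nhds y → ∀ᶠ z in nhds y, evalAt n z f = evalAt n y f +
        ∑ i, (((chartAt (EuclideanSpace ℝ (Fin n)) c z i -
          chartAt (EuclideanSpace ℝ (Fin n)) c y i : ℝ)) : ℂ) * evalAt n z (u i)) := by
  obtain ⟨G, hG, hGf⟩ := exists_contDiff_eventuallyEq (c := c) f
    ((chartAt (EuclideanSpace ℝ (Fin n)) c).map_source hy)
  obtain ⟨g, hg, hga, hgG⟩ := exists_contDiff_sub_eq G hG (chartAt (EuclideanSpace ℝ (Fin n)) c y)
  let u (i : Fin n) : SmoothFn n M :=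
    cutoff ρ _ (contMDiffOn_comp_chart (hg (EuclideanSpace.single i 1)).contDiffOn)
  have hu (i : Fin n) (z : M) : evalAt n z (u i) =
    ρ z • g (chartAt (EuclideanSpace ℝ (Fin n)) c z) (EuclideanSpace.single i 1) := rfl
  refine ⟨u, fun i => ?_, fun hρ => ?_⟩
  · rw [hu, hga, hGf.fderiv_eq]
    rfl
  · have hy0 := hGf.eq_of_nhds
    filter_upwards [hρ, ((chartAt (EuclideanSpace ℝ (Fin n)) c).continuousAt hy).eventually hGf,
      (chartAt (EuclideanSpace ℝ (Fin n)) c).open_source.mem_nhds hy] with z hz hzG hzs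
    rw [hgG, hy0, Function.comp_apply, Function.comp_apply,
      (chartAt (EuclideanSpace ℝ (Fin n)) c).left_inv hy,
      (chartAt (EuclideanSpace ℝ (Fin n)) c).left_inv hzs] at hzG
    rw [evalAt_apply, evalAt_apply, ← hzG]
    congr 1
    have hsum (v : EuclideanSpace ℝ (Fin n)) : v = ∑ i, v i • EuclideanSpace.single i (1 : ℝ) := by
      ext j
      simp [Finset.sum_apply, Pi.single_apply]
    rw [hsum (_ - _), map_sum]
    refine Finset.sum_congr rfl fun i _ => ?_
    rw [map_smul, hu, show ρ z = 1 from hz, one_smul, Complex.real_smul]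
    rfl

theorem exists_localCoordinates (c : M) : ∃ V, c ∈ V ∧ Nonempty (LocalCoordinates n V) := by
  set φ := chartAt (EuclideanSpace ℝ (Fin n)) c with hφ
  obtain ⟨ρ⟩ : Nonempty (SmoothBumpFunction (𝓡 n) c) := inferInstance
  have hcoord (j : Fin n) : ContDiff ℝ ∞ fun v : EuclideanSpace ℝ (Fin n) => ((v j : ℝ) : ℂ) :=
    Complex.ofRealCLM.contDiff.comp (EuclideanSpace.proj j : _ →L[ℝ] ℝ).contDiff
  let x (j : Fin n) : SmoothFn n M := cutoff ρ _ (contMDiffOn_comp_chart (hcoord j).contDiffOn)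
  have hx (j : Fin n) (z : M) : evalAt n z (x j) = ρ z • (((φ z) j : ℝ) : ℂ) := rfl
  let d (i : Fin n) (f : SmoothFn n M) : SmoothFn n M :=
    cutoff ρ (chartDeriv c i f) (contMDiffOn_chartDeriv i f)
  have hd (i : Fin n) (f : SmoothFn n M) (z : M) : evalAt n z (d i f) = ρ z • chartDeriv c i f z :=
    rfl
  have hsource (z : M) (hz : z ∉ φ.source) : ρ z = 0 := by
    by_contra h
    exact hz (ρ.support_subset_source h)
  have hV1 (z : M) (hz : z ∈ interior {z | ρ z = 1}) : ρ z = 1 :=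
    interior_subset (s := {z | ρ z = 1}) hz
  have hVs (z : M) (hz : z ∈ interior {z | ρ z = 1}) : z ∈ φ.source := by
    by_contra h
    simpa [hsource z h] using hV1 z hz
  refine ⟨interior {z | ρ z = 1}, mem_interior_iff_mem_nhds.2 ρ.eventuallyEq_one, ⟨{
    x := x
    d := fun i => ⟨⟨d i, fun f g => ?_⟩, fun z f => ?_⟩
    isOpen := isOpen_interior
    star_x := fun i => ?_
    d_mul := fun i f g => ?_
    d_x := fun y hy i j => ?_
    sub_mem := fun y hy f hf => ?_ }⟩⟩
  · refine SmoothFn.ext fun z => ?_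
    rw [map_add, hd, hd, hd]
    by_cases hz : z ∈ φ.source
    · have : chartDeriv c i (f + g) z = chartDeriv c i f z + chartDeriv c i g z :=
        DFunLike.congr_fun (fderiv_add (differentiableAt_comp_chart_symm f hz)
          (differentiableAt_comp_chart_symm g hz)) _
      rw [this, smul_add]
    · simp [hsource z hz]
  · refine SmoothFn.ext fun w => ?_
    rw [RingHom.id_apply, map_smul, hd, hd]
    by_cases hw : w ∈ φ.source
    · have : chartDeriv c i (z • f) w = z • chartDeriv c i f w :=
        DFunLike.congr_fun (fderiv_const_smul (differentiableAt_comp_chart_symm f hw) z) _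
      rw [this, smul_comm]
    · simp [hsource w hw]
  · refine SmoothFn.ext fun z => ?_
    rw [evalAt_star, hx]
    simp
  · refine SmoothFn.ext fun z => ?_
    change evalAt n z (d i (f * g)) = evalAt n z (d i f * g + f * d i g)
    rw [map_add, map_mul, map_mul, hd, hd, hd]
    by_cases hz : z ∈ φ.source
    · have : chartDeriv c i (f * g) z =
          evalAt n z f * chartDeriv c i g z + evalAt n z g * chartDeriv c i f z := by
        have := DFunLike.congr_fun (fderiv_mul (differentiableAt_comp_chart_symm f hz)
          (differentiableAt_comp_chart_symm g hz)) (EuclideanSpace.single i 1)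
        simp only [Function.comp_apply, (chartAt (EuclideanSpace ℝ (Fin n)) c).left_inv hz,
          add_apply, smul_apply, smul_eq_mul] at this
        exact this
      rw [this]
      simp only [Complex.real_smul]
      ring
    · simp [hsource z hz]
  · change evalAt n y (d i (x j)) = _
    rw [hd, hV1 y hy, one_smul]
    have hys := hVs y hy
    have hev : (x j : M → ℂ) ∘ φ.symm =ᶠ[nhds (φ y)]
        (Complex.ofRealCLM ∘L (EuclideanSpace.proj j : EuclideanSpace ℝ (Fin n) →L[ℝ] ℝ)) := by
      have h1 := φ.continuousAt_symm (φ.map_source hys)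
      rw [ContinuousAt, φ.left_inv hys] at h1
      filter_upwards [h1 (isOpen_interior.mem_nhds hy), φ.open_target.mem_nhds (φ.map_source hys)]
        with v hv hvt
      have := hx j (φ.symm v)
      rw [hV1 _ hv, one_smul, φ.right_inv hvt] at this
      exact this
    rw [chartDeriv, hev.fderiv_eq, ContinuousLinearMap.fderiv]
    by_cases hij : i = j <;> simp [hij, Ne.symm]
  · have hys := hVs y hy
    obtain ⟨u, huy, huf⟩ := exists_eventuallyEq_sum ρ hys f
    replace huy (i : Fin n) : evalAt n y (u i) = evalAt n y (d i f) := by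
      rw [huy, hd, hV1 y hy, one_smul]
    have hu' : f - ∑ i, (x i - algebraMap ℂ _ (evalAt n y (x i))) * u i ∈ vanishIdeal n y ^ 2 := by
      refine mem_vanishIdeal_pow_of_eventuallyEq ?_ 2
      filter_upwards [isOpen_interior.mem_nhds hy, huf (interior_mem_nhds.1
        (isOpen_interior.mem_nhds hy))] with z hz hzu
      rw [map_sub, map_sum, hzu, mem_vanishIdeal.1 hf, zero_add, sub_eq_zero]
      refine Finset.sum_congr rfl fun i _ => ?_
      rw [map_mul, map_sub, AlgHom.commutes, hx, hx, hV1 y hy, hV1 z hz]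
      simp [hφ]
    have e : f - ∑ i, evalAt n y (d i f) • (x i - algebraMap ℂ _ (evalAt n y (x i))) =
        (f - ∑ i, (x i - algebraMap ℂ _ (evalAt n y (x i))) * u i) +
          ∑ i, (x i - algebraMap ℂ _ (evalAt n y (x i))) *
            (u i - algebraMap ℂ _ (evalAt n y (u i))) := by
      rw [sub_add, sub_right_inj, ← Finset.sum_sub_distrib]
      refine Finset.sum_congr rfl fun i _ => ?_
      rw [huy, Algebra.smul_def]
      ring
    refine (congrArg (· ∈ vanishIdeal n y ^ 2) e).mpr (add_mem hu' (sum_mem fun i _ => ?_))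
    rw [pow_two]
    exact Ideal.mul_mem_mul (sub_evalAt_mem_vanishIdeal y _) (sub_evalAt_mem_vanishIdeal y _)

end Coordinates

/-! ### Taylor coefficients -/

section Taylor

open MvPolynomial

/-- An iterated partial derivative of a polynomial. -/
def pderivList {n : ℕ} : List (Fin n) → MvPolynomial (Fin n) ℂ → MvPolynomial (Fin n) ℂ
  | [], Q => Q
  | i :: l, Q => pderiv i (pderivList l Q)

theorem exists_coeff_pderivList {n : ℕ} (l : List (Fin n)) (m : Fin n →₀ ℕ) :
    ∃ c : ℂ, c ≠ 0 ∧ ∀ Q, coeff m (pderivList l Q) =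
      c * coeff (m + Multiset.toFinsupp (l : Multiset (Fin n))) Q := by
  induction l generalizing m with
  | nil => exact ⟨1, one_ne_zero, fun Q => by simp [pderivList]⟩
  | cons i l ih =>
    obtain ⟨c, hc, h⟩ := ih (m + Finsupp.single i 1)
    refine ⟨c * (m i + 1), mul_ne_zero hc (Nat.cast_add_one_ne_zero _), fun Q => ?_⟩
    rw [pderivList, coeff_pderiv, h, ← Multiset.cons_coe, ← Multiset.singleton_add, map_add,
      Multiset.toFinsupp_singleton, add_assoc]
    ring

variable {n : ℕ} {M : Type*} [TopologicalSpace M] [ChartedSpace (EuclideanSpace ℝ (Fin n)) M]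
  {V : Set M}

namespace LocalCoordinates

variable (L : LocalCoordinates n V)

/-- The coordinates centred at `y`. -/
def centred (y : M) (i : Fin n) : SmoothFn n M := L.x i - algebraMap ℂ _ (evalAt n y (L.x i))

theorem centred_mem (y : M) (i : Fin n) : L.centred y i ∈ vanishIdeal n y :=
  sub_evalAt_mem_vanishIdeal y _

theorem star_centred (y : M) (i : Fin n) : star (L.centred y i) = L.centred y i := by
  rw [centred, star_sub, L.star_x, ← algebraMap_star_comm, ← evalAt_star, L.star_x]

theorem d_one (i : Fin n) : L.d i 1 = 0 := by
  have := L.d_mul i 1 1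
  rw [mul_one, one_mul, mul_one] at this
  simpa using this

theorem d_algebraMap (i : Fin n) (z : ℂ) : L.d i (algebraMap ℂ _ z) = 0 := by
  rw [Algebra.algebraMap_eq_smul_one, map_smul, L.d_one, smul_zero]

theorem d_mem (i : Fin n) {y : M} {k : ℕ} {f : SmoothFn n M} (hf : f ∈ vanishIdeal n y ^ (k + 1)) :
    L.d i f ∈ vanishIdeal n y ^ k := by
  induction k generalizing f with
  | zero => simp
  | succ k ih =>
    rw [pow_succ'] at hf
    induction hf using Submodule.mul_induction_on' with
    | add f _ g _ hf hg => rw [map_add]; exact add_mem hf hg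
    | mem_mul_mem u hu f hf =>
      rw [L.d_mul]
      refine add_mem (Ideal.mul_mem_left _ _ hf) ?_
      rw [pow_succ']
      exact Ideal.mul_mem_mul hu (ih hf)

/-- An iterated partial derivative on `V`. -/
def dList : List (Fin n) → SmoothFn n M →ₗ[ℂ] SmoothFn n M
  | [] => LinearMap.id
  | i :: l => L.d i ∘ₗ dList l

theorem dList_mem (l : List (Fin n)) {y : M} {k : ℕ} {f : SmoothFn n M}
    (hf : f ∈ vanishIdeal n y ^ (k + l.length)) : L.dList l f ∈ vanishIdeal n y ^ k := by
  induction l generalizing k with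
  | nil => exact hf
  | cons i l ih =>
    refine L.d_mem i (ih ?_)
    rwa [List.length_cons, ← add_assoc, add_right_comm] at hf

theorem evalAt_aeval_centred (y : M) (Q : MvPolynomial (Fin n) ℂ) :
    evalAt n y (aeval (L.centred y) Q) = coeff 0 Q := by
  rw [← AlgHom.comp_apply, comp_aeval, ← constantCoeff_eq]
  have h : (fun i => evalAt n y (L.centred y i)) = fun _ => 0 :=
    funext fun i => L.centred_mem y i
  rw [h]
  change aeval (0 : Fin n → ℂ) Q = _
  rw [aeval_zero]
  rfl

theorem evalAt_d_aeval {y z : M} (hz : z ∈ V) (i : Fin n) (Q : MvPolynomial (Fin n) ℂ) :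
    evalAt n z (L.d i (aeval (L.centred y) Q)) = evalAt n z (aeval (L.centred y) (pderiv i Q)) := by
  induction Q using MvPolynomial.induction_on with
  | C a => rw [aeval_C, L.d_algebraMap, pderiv_C, map_zero, map_zero, map_zero]
  | add p q hp hq => simp only [map_add, hp, hq]
  | mul_X p j hp =>
    have hj : evalAt n z (L.d i (L.centred y j)) = if i = j then 1 else 0 := by
      rw [centred, map_sub, L.d_algebraMap, sub_zero, L.d_x z hz]
    simp only [map_mul, aeval_X, L.d_mul, map_add, Derivation.leibniz, smul_eq_mul, hp, hj,
      pderiv_X, Pi.single_apply]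
    by_cases hij : i = j
    · subst hij; simp; ring
    · simp [hij, Ne.symm hij]; ring

variable [IsManifold (𝓡 n) ∞ M] [T2Space M]

theorem evalAt_d_congr {f g : SmoothFn n M} (h : ∀ z ∈ V, evalAt n z f = evalAt n z g)
    (i : Fin n) {z : M} (hz : z ∈ V) : evalAt n z (L.d i f) = evalAt n z (L.d i g) := by
  have h2 : f - g ∈ vanishIdeal n z ^ (1 + 1) := by
    refine mem_vanishIdeal_pow_of_eventuallyEq ?_ _
    filter_upwards [L.isOpen.mem_nhds hz] with w hw
    rw [map_sub, h w hw, sub_self]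
  have := L.d_mem i h2
  rwa [pow_one, mem_vanishIdeal, map_sub, map_sub, sub_eq_zero] at this

theorem evalAt_dList_aeval {y z : M} (hz : z ∈ V) (l : List (Fin n))
    (Q : MvPolynomial (Fin n) ℂ) :
    evalAt n z (L.dList l (aeval (L.centred y) Q)) =
      evalAt n z (aeval (L.centred y) (pderivList l Q)) := by
  induction l generalizing z with
  | nil => rfl
  | cons i l ih =>
    rw [dList, LinearMap.comp_apply, L.evalAt_d_congr (fun w hw => ih hw) i hz,
      L.evalAt_d_aeval hz, pderivList]

/-- Taylor coefficients at points of `V`, depending smoothly on the point. -/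
theorem exists_taylorCoeff : ∃ T : (Fin n →₀ ℕ) → SmoothFn n M →ₗ[ℂ] SmoothFn n M,
    ∀ I, ∀ y ∈ V, (∀ k, I.degree < k → ∀ f ∈ vanishIdeal n y ^ k, evalAt n y (T I f) = 0) ∧
      ∀ Q, evalAt n y (T I (aeval (L.centred y) Q)) = coeff I Q := by
  choose c hc h using fun I : Fin n →₀ ℕ => exists_coeff_pderivList I.toMultiset.toList 0
  refine ⟨fun I => (c I)⁻¹ • L.dList I.toMultiset.toList, fun I y hy => ⟨fun k hk f hf => ?_,
    fun Q => ?_⟩⟩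
  · have := L.dList_mem I.toMultiset.toList (y := y) (k := 1) (f := f)
      (Ideal.pow_le_pow_right (by rw [length_toMultiset_toList]; omega) hf)
    rw [pow_one, mem_vanishIdeal] at this
    rw [LinearMap.smul_apply, map_smul, this, smul_zero]
  · rw [LinearMap.smul_apply, map_smul, L.evalAt_dList_aeval hy, L.evalAt_aeval_centred, h,
      zero_add, Multiset.coe_toList, smul_eq_mul, inv_mul_cancel_left₀ (hc I)]
    simp

end LocalCoordinates

end Taylor

/-! ### Families of functions depending smoothly on a point -/

section Tame

variable {n : ℕ} {M : Type*} [TopologicalSpace M] [ChartedSpace (EuclideanSpace ℝ (Fin n)) M]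

/-- The families `y ↦ ∑ b_l(y) a_l` of smooth functions, the sums being finite and the coefficients
`b_l` smooth. -/
def tameFamilies (n : ℕ) (M : Type*) [TopologicalSpace M]
    [ChartedSpace (EuclideanSpace ℝ (Fin n)) M] : Submodule ℂ (M → SmoothFn n M) :=
  Submodule.span ℂ {u | ∃ b a : SmoothFn n M, u = fun y => evalAt n y b • a}

theorem tameFamilies_const (a : SmoothFn n M) : (fun _ => a) ∈ tameFamilies n M :=
  Submodule.subset_span ⟨1, a, by simp⟩

theorem tameFamilies_algebraMap (b : SmoothFn n M) :
    (fun y => algebraMap ℂ (SmoothFn n M) (evalAt n y b)) ∈ tameFamilies n M :=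
  Submodule.subset_span ⟨b, 1, by simp [Algebra.algebraMap_eq_smul_one]⟩

theorem tameFamilies_star {u : M → SmoothFn n M} (hu : u ∈ tameFamilies n M) :
    (fun y => star (u y)) ∈ tameFamilies n M := by
  induction hu using Submodule.span_induction with
  | mem u hu =>
    obtain ⟨b, a, rfl⟩ := hu
    exact Submodule.subset_span ⟨star b, star a, by simp⟩
  | zero => simp only [Pi.zero_apply, star_zero]; exact zero_mem _
  | add u v _ _ hu hv => simpa [Pi.add_def] using add_mem hu hv
  | smul z u _ hu => simpa [Pi.smul_def] using (tameFamilies n M).smul_mem (star z) hu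

theorem tameFamilies_bilin (β : SmoothFn n M →ₗ[ℂ] SmoothFn n M →ₗ[ℂ] SmoothFn n M)
    {u v : M → SmoothFn n M} (hu : u ∈ tameFamilies n M) (hv : v ∈ tameFamilies n M) :
    (fun y => β (u y) (v y)) ∈ tameFamilies n M := by
  induction hu using Submodule.span_induction with
  | mem u hu =>
    obtain ⟨b, a, rfl⟩ := hu
    induction hv using Submodule.span_induction with
    | mem v hv =>
      obtain ⟨b', a', rfl⟩ := hv
      refine Submodule.subset_span ⟨b * b', β a a', funext fun y => ?_⟩
      simp [smul_smul]
      ring_nf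
    | zero => simp only [Pi.zero_apply, map_zero]; exact zero_mem _
    | add u v _ _ hu hv => simpa [Pi.add_def] using add_mem hu hv
    | smul z u _ hu => simpa [Pi.smul_def] using (tameFamilies n M).smul_mem z hu
  | zero => simp only [Pi.zero_apply, map_zero, LinearMap.zero_apply]; exact zero_mem _
  | add u v _ _ hu hv => simpa [Pi.add_def] using add_mem hu hv
  | smul z u _ hu => simpa [Pi.smul_def] using (tameFamilies n M).smul_mem z hu

/-- A tame family, transformed by a linear operator, has a smooth restriction to the diagonal. -/
theorem exists_evalAt_eq_of_tame (Φ : SmoothFn n M →ₗ[ℂ] SmoothFn n M) {u : M → SmoothFn n M}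
    (hu : u ∈ tameFamilies n M) :
    ∃ w : SmoothFn n M, ∀ y, evalAt n y w = evalAt n y (Φ (u y)) := by
  induction hu using Submodule.span_induction with
  | mem u hu =>
    obtain ⟨b, a, rfl⟩ := hu
    exact ⟨b * Φ a, fun y => by simp⟩
  | zero => exact ⟨0, by simp⟩
  | add u v _ _ hu hv =>
    obtain ⟨w, hw⟩ := hu
    obtain ⟨w', hw'⟩ := hv
    exact ⟨w + w', fun y => by simp [hw, hw']⟩
  | smul z u _ hu =>
    obtain ⟨w, hw⟩ := hu
    exact ⟨z • w, fun y => by simp [hw]⟩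

variable {P : PoissonBracket n M} {S : HermitianStarProduct P}

/-- The families of formal series whose coefficients are tame. -/
def IsTame (f : M → StarAlg S) : Prop := ∀ r, (fun y => (f y).cf r) ∈ tameFamilies n M

theorem IsTame.star {f : M → StarAlg S} (hf : IsTame f) : IsTame fun y => star (f y) :=
  fun r => tameFamilies_star (hf r)

theorem IsTame.mul {f g : M → StarAlg S} (hf : IsTame f) (hg : IsTame g) :
    IsTame fun y => f y * g y := by
  intro r
  have : (fun y => (f y * g y).cf r) = ∑ p ∈ antidiagonal r, ∑ q ∈ antidiagonal p.2,
      fun y => S.coeffLin q.2 ((f y).cf p.1) ((g y).cf q.1) := by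
    ext1 y
    rw [StarAlg.cf_mul]
    simp only [Finset.sum_apply]
  rw [this]
  exact sum_mem fun p _ => sum_mem fun q _ => tameFamilies_bilin _ (hf _) (hg _)

theorem IsTame.ofFn {u : M → SmoothFn n M} (hu : u ∈ tameFamilies n M) :
    IsTame fun y => StarAlg.ofFn S (u y) := by
  intro r
  by_cases hr : r = 0
  · simpa [hr] using hu
  · simp only [StarAlg.cf_ofFn, hr, if_false]; exact zero_mem _

theorem IsTame.list_prod {ι : Type*} (l : List ι) {f : ι → M → StarAlg S}
    (hf : ∀ i, IsTame (f i)) : IsTame fun y => (l.map fun i => f i y).prod := by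
  induction l with
  | nil =>
    have : IsTame fun _ : M => StarAlg.ofFn S 1 := IsTame.ofFn (tameFamilies_const 1)
    exact this
  | cons i l ih => simpa using (hf i).mul ih

end Tame

/-! ### The weight filtration of a star product at a point -/

/-- The `ℂ[[λ]]`-linear functional `∑ λ ^ r ψ_r` on `A[[λ]]`. -/
def seriesFunctional {A : Type*} [AddCommGroup A] [Module ℂ A] (ψ : ℕ → A →ₗ[ℂ] ℂ) :
    FormalSeries A →ₗ[ℂ⟦X⟧] ℂ⟦X⟧ where
  toFun f := PowerSeries.mk fun r => ∑ p ∈ antidiagonal r, ψ p.1 (f.coeff p.2)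
  map_add' f g := by ext r; simp [Finset.sum_add_distrib]
  map_smul' z f := by
    ext r
    simp only [PowerSeries.coeff_mk, FormalSeries.coeff_smul, map_sum, map_smul, RingHom.id_apply,
      smul_eq_mul, PowerSeries.coeff_mul, Finset.mul_sum, Finset.sum_sigma']
    refine Finset.sum_nbij'
      (fun p => ⟨(p.2.1, p.1.1 + p.2.2), (p.1.1, p.2.2)⟩)
      (fun p => ⟨(p.2.1, p.1.1 + p.2.2), (p.1.1, p.2.2)⟩) ?_ ?_ ?_ ?_ ?_
    · rintro ⟨⟨a, b⟩, c, d⟩ h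
      simp at h ⊢; omega
    · rintro ⟨⟨a, b⟩, c, d⟩ h
      simp at h ⊢; omega
    · rintro ⟨⟨a, b⟩, c, d⟩ h
      simp at h ⊢; omega
    · rintro ⟨⟨a, b⟩, c, d⟩ h
      simp at h ⊢; omega
    · rintro ⟨⟨a, b⟩, c, d⟩ h
      simp

theorem coeff_seriesFunctional {A : Type*} [AddCommGroup A] [Module ℂ A] (ψ : ℕ → A →ₗ[ℂ] ℂ)
    (f : FormalSeries A) (r : ℕ) : PowerSeries.coeff r (seriesFunctional ψ f) =
      ∑ p ∈ antidiagonal r, ψ p.1 (f.coeff p.2) := by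
  simp [seriesFunctional]

section AtPoint

variable {n : ℕ} {M : Type*} [TopologicalSpace M] [ChartedSpace (EuclideanSpace ℝ (Fin n)) M]
  {P : PoissonBracket n M}

namespace StarAlg

/-- The reduction modulo `λ`. -/
def cfZero (S : HermitianStarProduct P) : StarAlg S →+* SmoothFn n M where
  toFun f := f.cf 0
  map_one' := by simp
  map_mul' := cf_zero_mul
  map_zero' := rfl
  map_add' _ _ := rfl

theorem cfZero_apply {S : HermitianStarProduct P} (f : StarAlg S) : cfZero S f = f.cf 0 := rfl

/-- The series whose lowest coefficient vanishes at `y`. -/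
def pointIdeal (S : HermitianStarProduct P) (y : M) : Submodule ℂ⟦X⟧ (StarAlg S) where
  carrier := {f | f.cf 0 ∈ vanishIdeal n y}
  zero_mem' := zero_mem (vanishIdeal n y)
  add_mem' := fun {f g} hf hg => by
    change (f + g).cf 0 ∈ vanishIdeal n y
    rw [cf_add]
    exact add_mem hf hg
  smul_mem' := fun z f hf => by
    change (z • f).cf 0 ∈ vanishIdeal n y
    rw [cf_smul]
    simp only [Finset.Nat.antidiagonal_zero, Finset.sum_singleton]
    exact Submodule.smul_of_tower_mem _ _ hf

theorem mem_pointIdeal {S : HermitianStarProduct P} {y : M} {f : StarAlg S} :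
    f ∈ pointIdeal S y ↔ f.cf 0 ∈ vanishIdeal n y := Iff.rfl

theorem isClassicalIdeal_pointIdeal (S : HermitianStarProduct P) (y : M) :
    IsClassicalIdeal (PowerSeries.X : ℂ⟦X⟧) (pointIdeal S y) where
  mul_left_mem a j hj := by
    rw [mem_pointIdeal, cf_zero_mul]
    exact Ideal.mul_mem_left _ _ hj
  mul_right_mem a j hj := by
    rw [mem_pointIdeal, cf_zero_mul]
    exact Ideal.mul_mem_right _ _ hj
  smul_mem a := by
    rw [mem_pointIdeal, cf_X_smul_zero]
    exact zero_mem _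
  commutator a b := ⟨_, eq_X_smul_shift (by
    rw [cf_sub, cf_zero_mul, cf_zero_mul, mul_comm, sub_self])⟩

/-- The weight filtration of the star product algebra at the point `y`. -/
abbrev ptFilt (S : HermitianStarProduct P) (y : M) (k : ℕ) : Submodule ℂ⟦X⟧ (StarAlg S) :=
  weightFilt PowerSeries.X (pointIdeal S y) k

theorem star_mem_ptFilt {S : HermitianStarProduct P} {y : M} {k : ℕ} {f : StarAlg S}
    (hf : f ∈ ptFilt S y k) : star f ∈ ptFilt S y k := by
  have hJ := isClassicalIdeal_pointIdeal S y
  induction k using Nat.strong_induction_on generalizing f with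
  | _ k ih =>
    match k with
    | 0 => exact Submodule.mem_top
    | 1 =>
      change evalAt n y (star (f.cf 0)) = 0
      rw [evalAt_star, show evalAt n y (f.cf 0) = 0 from hf, star_zero]
    | k + 2 =>
      obtain ⟨u, hu, _, ⟨v, hv, rfl⟩, rfl⟩ := Submodule.mem_sup.1 hf
      rw [star_add, LinearMap.lsmul_apply, star_X_smul]
      refine add_mem ?_ (smul_mem_weightFilt (ih k (by omega) hv))
      clear hf
      induction hu using Submodule.mul_induction_on' with
      | mem_mul_mem a ha b hb =>
        rw [star_mul]
        exact mul_mem_weightFilt hJ (j := k + 1) (k := 1) (ih (k + 1) (by omega) hb)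
          (ih 1 (by omega) ha)
      | add a _ b _ ha hb => rw [star_add]; exact add_mem ha hb

theorem ofFn_mem_ptFilt_two (S : HermitianStarProduct P) {y : M} {f : SmoothFn n M}
    (hf : f ∈ vanishIdeal n y ^ 2) : ofFn S f ∈ ptFilt S y 2 := by
  rw [pow_two] at hf
  induction hf using Submodule.mul_induction_on' with
  | mem_mul_mem u hu v hv =>
    have h1 : ofFn S u * ofFn S v ∈ ptFilt S y 2 :=
      Submodule.mem_sup_left (Submodule.mul_mem_mul hu hv)
    have h2 : ofFn S (u * v) - ofFn S u * ofFn S v ∈ ptFilt S y 2 := by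
      rw [eq_X_smul_shift (f := ofFn S (u * v) - ofFn S u * ofFn S v) (by
        rw [cf_sub, cf_zero_mul]; simp)]
      exact smul_mem_weightFilt (k := 0) Submodule.mem_top
    simpa using add_mem h2 h1
  | add u _ v _ hu hv =>
    have : ofFn S (u + v) = ofFn S u + ofFn S v := FormalSeries.const_add u v
    rw [this]
    exact add_mem hu hv

end StarAlg

open StarAlg

variable {V : Set M}

namespace LocalCoordinates

variable (L : LocalCoordinates n V) (S : HermitianStarProduct P)

/-- The coordinates centred at `y` as elements of the star product algebra. -/
def coord (y : M) (i : Fin n) : StarAlg S := ofFn S (L.centred y i)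

theorem isCoordinates_coord {y : M} (hy : y ∈ V) :
    IsCoordinates (PowerSeries.X : ℂ⟦X⟧) (pointIdeal S y) (L.coord S y) where
  mem i := L.centred_mem y i
  top_le := by
    intro f _
    have e : f = (PowerSeries.C (evalAt n y (f.cf 0)) : ℂ⟦X⟧) • (1 : StarAlg S) +
        (f - (PowerSeries.C (evalAt n y (f.cf 0)) : ℂ⟦X⟧) • (1 : StarAlg S)) := by abel
    rw [e]
    refine Submodule.add_mem_sup (Submodule.smul_mem _ _ (Submodule.mem_span_singleton_self _)) ?_
    rw [mem_pointIdeal, cf_sub, cf_C_smul, cf_one, if_pos rfl,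
      ← Algebra.algebraMap_eq_smul_one]
    exact sub_evalAt_mem_vanishIdeal y _
  le := by
    intro f hf
    have hsum : ofFn S (∑ i, evalAt n y (L.d i (f.cf 0)) • L.centred y i) =
        ∑ i, (PowerSeries.C (evalAt n y (L.d i (f.cf 0))) : ℂ⟦X⟧) • L.coord S y i := by
      ext1 r
      rw [cf_sum]
      by_cases hr : r = 0 <;> simp [hr, coord]
    have e : f = ofFn S (∑ i, evalAt n y (L.d i (f.cf 0)) • L.centred y i) +
        (ofFn S (f.cf 0 - ∑ i, evalAt n y (L.d i (f.cf 0)) • L.centred y i) +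
          (PowerSeries.X : ℂ⟦X⟧) • f.shift) := by
      conv_lhs => rw [f.eq_ofFn_add_X_smul]
      rw [← add_assoc]
      congr 1
      ext1 r
      by_cases hr : r = 0 <;> simp [hr]
    rw [e]
    refine Submodule.add_mem_sup ?_ (add_mem (ofFn_mem_ptFilt_two S (L.sub_mem y hy _ hf))
      (smul_mem_weightFilt (k := 0) Submodule.mem_top))
    rw [hsum]
    exact sum_mem fun i _ => Submodule.smul_mem _ _ (Submodule.subset_span ⟨i, rfl⟩)

theorem isTame_coord (i : Fin n) : IsTame fun y => L.coord S y i :=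
  IsTame.ofFn (Submodule.sub_mem _ (tameFamilies_const _) (tameFamilies_algebraMap _))

theorem isTame_orderedMonomial (I : Fin n →₀ ℕ) :
    IsTame fun y => orderedMonomial (L.coord S y) I :=
  IsTame.list_prod _ fun i => L.isTame_coord S i

theorem cf_zero_orderedMonomial (y : M) (I : Fin n →₀ ℕ) :
    (orderedMonomial (L.coord S y) I).cf 0 =
      MvPolynomial.aeval (L.centred y) (MvPolynomial.monomial I (1 : ℂ)) := by
  rw [← cfZero_apply, orderedMonomial, map_list_prod, List.map_map, MvPolynomial.aeval_monomial,
    map_one, one_mul]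
  have : (⇑(cfZero S) ∘ L.coord S y) = L.centred y := by
    ext1 i
    simp [cfZero_apply, coord]
  rw [this, ← Multiset.prod_coe, ← Multiset.map_coe, Multiset.coe_toList, Finsupp.toMultiset_map,
    Finsupp.prod_toMultiset,
    Finsupp.prod_mapDomain_index (fun _ => pow_zero _) (fun _ _ _ => pow_add _ _ _)]

end LocalCoordinates

/-- A shift of the order of vanishing that dominates the orders `N s` of the coefficients of the
star product. -/
def orderShift (N : ℕ → ℕ) : ℕ → ℕ
  | 0 => 0
  | r + 1 => orderShift N r + ∑ s ∈ Finset.range (r + 2), N s + 2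

theorem orderShift_mono (N : ℕ → ℕ) : Monotone (orderShift N) :=
  monotone_nat_of_le_succ fun r => by rw [orderShift]; omega

theorem add_two_le_orderShift (N : ℕ → ℕ) {j s r : ℕ} (hj : j < r) (hs : s ≤ r) :
    orderShift N j + N s + 2 ≤ orderShift N r := by
  cases r with
  | zero => omega
  | succ r =>
    have h1 := orderShift_mono N (show j ≤ r by omega)
    have h2 := Finset.single_le_sum (f := N) (fun _ _ => Nat.zero_le _)
      (Finset.mem_range.2 (show s < r + 2 by omega))
    rw [orderShift]
    omega

/-- The series whose coefficient of `λ ^ j` vanishes at `y` to order `k - orderShift N j`. -/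
def orderFilt (S : HermitianStarProduct P) (N : ℕ → ℕ) (y : M) (k : ℕ) :
    Submodule ℂ⟦X⟧ (StarAlg S) where
  carrier := {f | ∀ j, f.cf j ∈ vanishIdeal n y ^ (k - orderShift N j)}
  zero_mem' _ := zero_mem _
  add_mem' hf hg j := add_mem (hf j) (hg j)
  smul_mem' z f hf j := by
    rw [cf_smul]
    refine sum_mem fun p hp => Submodule.smul_of_tower_mem _ _
      (Ideal.pow_le_pow_right ?_ (hf p.2))
    have := orderShift_mono N (show p.2 ≤ j by
      rw [Finset.HasAntidiagonal.mem_antidiagonal] at hp; omega)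
    omega

/-- `N s` bounds the order of the coefficient `C_s` of the star product on `V`. -/
def OrderBound (S : HermitianStarProduct P) (V : Set M) (N : ℕ → ℕ) : Prop :=
  ∀ s, ∀ y ∈ V, ∀ g, ∀ f ∈ vanishIdeal n y ^ N s, evalAt n y (S.coeffLin s g f) = 0

/-- The functional `f ↦ ∑ λ ^ r Φ_r(f)(y)`. -/
def ptFunctional (S : HermitianStarProduct P) (Φ : ℕ → SmoothFn n M →ₗ[ℂ] SmoothFn n M) (y : M) :
    StarAlg S →ₗ[ℂ⟦X⟧] ℂ⟦X⟧ :=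
  seriesFunctional fun r => (evalAt n y).toLinearMap ∘ₗ Φ r

theorem coeff_ptFunctional (S : HermitianStarProduct P)
    (Φ : ℕ → SmoothFn n M →ₗ[ℂ] SmoothFn n M) (y : M) (f : StarAlg S) (r : ℕ) :
    PowerSeries.coeff r (ptFunctional S Φ y f) =
      ∑ p ∈ antidiagonal r, evalAt n y (Φ p.1 (f.cf p.2)) :=
  coeff_seriesFunctional _ _ _

variable [IsManifold (𝓡 n) ∞ M] [T2Space M]

/-- Elements of large weight have coefficients that vanish to high order: multiplication by an element
of `m_y` raises the order of vanishing, except for the loss `N s` in the terms with a factor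
`λ ^ s`. -/
theorem ptFilt_le_orderFilt {S : HermitianStarProduct P} (hV : IsOpen V) {N : ℕ → ℕ}
    (hN : OrderBound S V N) {y : M} (hy : y ∈ V) (k : ℕ) :
    ptFilt S y k ≤ orderFilt S N y k := by
  induction k using Nat.strong_induction_on with
  | _ k ih =>
    match k with
    | 0 => intro f _ j; simp
    | 1 =>
      intro f hf j
      cases j with
      | zero =>
        have := mem_pointIdeal.1 hf
        simpa [orderShift] using this
      | succ j =>
        rw [show 1 - orderShift N (j + 1) = 0 by rw [orderShift]; omega, pow_zero, Ideal.one_eq_top]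
        exact Submodule.mem_top
    | k + 2 =>
      refine sup_le (Submodule.mul_le.2 fun a ha b hb => ?_) ?_
      · replace hb := ih (k + 1) (by omega) hb
        intro r
        rw [cf_mul]
        refine sum_mem fun p hp => sum_mem fun q hq => ?_
        rw [Finset.HasAntidiagonal.mem_antidiagonal] at hp hq
        by_cases hqr : q.1 = r
        · have h1 : p.1 = 0 := by omega
          have h2 : q.2 = 0 := by omega
          rw [h1, h2, hqr, HermitianDeformation.coeffLin_zero]
          refine Ideal.pow_le_pow_right (show _ ≤ k + 1 - orderShift N r + 1 by omega) ?_
          rw [pow_succ']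
          exact Ideal.mul_mem_mul ha (hb r)
        · have hle := add_two_le_orderShift N (show q.1 < r by omega) (show q.2 ≤ r by omega)
          by_cases hk : k + 2 ≤ orderShift N r
          · rw [Nat.sub_eq_zero_of_le hk, pow_zero, Ideal.one_eq_top]
            exact Submodule.mem_top
          · refine map_vanishIdeal_pow hV (N q.2) (S.coeffLin q.2 (a.cf p.1))
              (fun z hz f hf => hN q.2 z hz _ f hf) hy _ (Ideal.pow_le_pow_right ?_ (hb q.1))
            omega
      · rintro _ ⟨f, hf, rfl⟩ j
        rw [LinearMap.lsmul_apply]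
        cases j with
        | zero => rw [cf_X_smul_zero]; exact zero_mem _
        | succ j =>
          rw [cf_X_smul_succ]
          refine Ideal.pow_le_pow_right ?_ (ih k (by omega) hf j)
          have := add_two_le_orderShift N (lt_add_one j) (Nat.zero_le (j + 1))
          omega

/-- A functional all of whose coefficients have finite order is continuous for the weight
filtration. -/
theorem exists_dvd_ptFunctional {S : HermitianStarProduct P} (hV : IsOpen V) {N : ℕ → ℕ}
    (hN : OrderBound S V N) {y : M} (hy : y ∈ V) {Φ : ℕ → SmoothFn n M →ₗ[ℂ] SmoothFn n M}
    {K : ℕ → ℕ} (hK : ∀ r, ∀ f ∈ vanishIdeal n y ^ K r, evalAt n y (Φ r f) = 0) (r : ℕ) :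
    ∃ k₀, ∀ k ≥ k₀, ∀ f ∈ ptFilt S y k, PowerSeries.X ^ r ∣ ptFunctional S Φ y f := by
  refine ⟨orderShift N r + ∑ s ∈ Finset.range r, K s, fun k hk f hf => ?_⟩
  rw [PowerSeries.X_pow_dvd_iff]
  intro q hq
  rw [coeff_ptFunctional]
  refine Finset.sum_eq_zero fun p hp => hK _ _ ?_
  rw [Finset.HasAntidiagonal.mem_antidiagonal] at hp
  refine Ideal.pow_le_pow_right ?_ (ptFilt_le_orderFilt hV hN hy k hf p.2)
  have h1 := orderShift_mono N (show p.2 ≤ r by omega)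
  have h2 := Finset.single_le_sum (f := K) (fun _ _ => Nat.zero_le _)
    (Finset.mem_range.2 (show p.1 < r by omega))
  omega

end AtPoint

/-! ### Positive definite forms depending on a parameter -/

/-- A sequence can be constructed term by term if the condition on each term involves only the
terms up to it. -/
theorem exists_seq_of_forall_exists_update {α : Type*} [Inhabited α] (P : ℕ → (ℕ → α) → Prop)
    (hdep : ∀ r φ ψ, (∀ s ≤ r, φ s = ψ s) → P r φ → P r ψ)
    (hstep : ∀ r φ, (∀ s < r, P s φ) → ∃ a, P r (Function.update φ r a)) :
    ∃ φ, ∀ r, P r φ := by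
  let G (r : ℕ) : {φ : ℕ → α // ∀ s < r, P s φ} :=
    Nat.rec ⟨fun _ => default, by simp⟩ (fun r φ =>
      ⟨Function.update φ.1 r (hstep r φ.1 φ.2).choose, fun s hs => by
        obtain hs | rfl := Nat.lt_succ_iff_lt_or_eq.1 hs
        · refine hdep s _ _ (fun q hq => ?_) (φ.2 s hs)
          rw [Function.update_of_ne (by omega)]
        · exact (hstep s φ.1 φ.2).choose_spec⟩) r
  have hG (r s : ℕ) (hs : s < r) : (G r).1 s = (G (s + 1)).1 s := by
    induction r with
    | zero => omega
    | succ r ih =>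
      obtain hs | rfl := Nat.lt_succ_iff_lt_or_eq.1 hs
      · rw [← ih hs]
        exact Function.update_of_ne (by omega) _ _
      · rfl
  exact ⟨fun s => (G (s + 1)).1 s, fun r => hdep r _ _ (fun s hs => hG (r + 1) s (by omega))
    ((G (r + 1)).2 r (by omega))⟩

/-- A continuous function on a compact set that is positive on the zeros of a nonnegative one becomes
positive after adding a large multiple of the latter. -/
theorem exists_forall_pos_add_mul {X : Type*} [TopologicalSpace X] {K : Set X} (hK : IsCompact K)
    {q h : X → ℝ} (hq : ContinuousOn q K) (hh : ContinuousOn h K) (h0 : ∀ x ∈ K, 0 ≤ h x)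
    (hpos : ∀ x ∈ K, h x = 0 → 0 < q x) : ∃ t : ℝ, ∀ x ∈ K, 0 < q x + t * h x := by
  have hC : IsCompact (K ∩ q ⁻¹' Set.Iic 0) := by
    obtain ⟨u, hu, e⟩ := continuousOn_iff_isClosed.1 hq _ (isClosed_Iic (a := (0 : ℝ)))
    rw [Set.inter_comm, e, Set.inter_comm]
    exact hK.inter_right hu
  obtain hemp | hne := (K ∩ q ⁻¹' Set.Iic 0).eq_empty_or_nonempty
  · refine ⟨0, fun x hx => ?_⟩
    rw [zero_mul, add_zero]
    by_contra hqx
    exact (Set.eq_empty_iff_forall_notMem.1 hemp) x ⟨hx, not_lt.1 hqx⟩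
  -- The function `h` has a positive minimum `h x₀` on the set where `q` is not positive.
  · obtain ⟨x₀, ⟨hx₀, hqx₀⟩, hmin⟩ := hC.exists_isMinOn hne (hh.mono Set.inter_subset_left)
    obtain ⟨B, hB⟩ := hK.exists_bound_of_continuousOn hq
    have hm : 0 < h x₀ := (h0 x₀ hx₀).lt_of_ne fun e =>
      absurd (hpos x₀ hx₀ e.symm) (not_lt.2 hqx₀)
    have hB0 : 0 ≤ B := (norm_nonneg _).trans (hB x₀ hx₀)
    refine ⟨(B + 1) / h x₀, fun x hx => ?_⟩
    obtain hqx | hqx := lt_or_ge 0 (q x)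
    · exact add_pos_of_pos_of_nonneg hqx (mul_nonneg (by positivity) (h0 x hx))
    · have h1 : h x₀ ≤ h x := hmin ⟨hx, hqx⟩
      have h2 : B + 1 ≤ (B + 1) / h x₀ * h x := by
        rw [div_mul_eq_mul_div, le_div_iff₀ hm]
        exact mul_le_mul_of_nonneg_left h1 (by positivity)
      have h3 := (abs_le.1 (hB x hx)).1
      linarith

section HermForm

variable {ι : Type*}

/-- The real part of the sesquilinear form with matrix `G`, on vectors indexed by `s`. -/
def hermForm (s : Finset ι) (G : ι → ι → ℂ) (a : ι → ℂ) : ℝ :=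
  (∑ I ∈ s, ∑ J ∈ s, star (a I) * a J * G I J).re

theorem hermForm_congr {s : Finset ι} {G G' : ι → ι → ℂ} {a a' : ι → ℂ}
    (hG : ∀ I ∈ s, ∀ J ∈ s, G I J = G' I J) (ha : ∀ I ∈ s, a I = a' I) :
    hermForm s G a = hermForm s G' a' := by
  rw [hermForm, hermForm]
  congr 1
  refine Finset.sum_congr rfl fun I hI => Finset.sum_congr rfl fun J hJ => ?_
  rw [hG I hI J hJ, ha I hI, ha J hJ]

theorem hermForm_smul (s : Finset ι) (G : ι → ι → ℂ) (c : ℝ) (a : ι → ℂ) :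
    hermForm s G (fun I => c * a I) = c ^ 2 * hermForm s G a := by
  rw [hermForm, hermForm, ← Complex.re_ofReal_mul, Finset.mul_sum]
  congr 1
  refine Finset.sum_congr rfl fun I _ => ?_
  rw [Finset.mul_sum]
  refine Finset.sum_congr rfl fun J _ => ?_
  simp only [star_mul', Complex.star_def, Complex.conj_ofReal, Complex.ofReal_pow]
  ring

theorem hermForm_add_mul (s : Finset ι) (G H : ι → ι → ℂ) (t : ℝ) (a : ι → ℂ) :
    hermForm s (fun I J => G I J + t * H I J) a = hermForm s G a + t * hermForm s H a := by
  rw [hermForm, hermForm, hermForm, ← Complex.re_ofReal_mul, ← Complex.add_re, Finset.mul_sum,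
    ← Finset.sum_add_distrib]
  congr 1
  refine Finset.sum_congr rfl fun I _ => ?_
  rw [Finset.mul_sum, ← Finset.sum_add_distrib]
  refine Finset.sum_congr rfl fun J _ => ?_
  ring

/-- A sesquilinear form that is positive on the null vectors of a nonnegative form becomes positive
after adding a large multiple of the latter, uniformly on compact sets of parameters. -/
theorem exists_hermForm_add_mul_pos {Y : Type*} [TopologicalSpace Y] {K : Set Y}
    (hK : IsCompact K) (s : Finset ι) (R : Y → ι → ι → ℂ) (H : ι → ι → ℂ)
    (hR : ∀ I J, Continuous fun y => R y I J) (hH : ∀ a, 0 ≤ hermForm s H a)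
    (hpos : ∀ y ∈ K, ∀ a, (∃ I ∈ s, a I ≠ 0) → hermForm s H a = 0 → 0 < hermForm s (R y) a) :
    ∃ t : ℝ, ∀ y ∈ K, ∀ a, (∃ I ∈ s, a I ≠ 0) →
      0 < hermForm s (fun I J => R y I J + t * H I J) a := by
  classical
  -- By homogeneity it is enough to consider the vectors of norm one.
  let ext (a : s → ℂ) (I : ι) : ℂ := if h : I ∈ s then a ⟨I, h⟩ else 0
  have hext (I : ι) : Continuous fun a : s → ℂ => ext a I := by
    by_cases h : I ∈ s
    · simpa only [ext, h, dif_pos] using continuous_apply _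
    · simpa only [ext, h, dif_neg, not_false_eq_true] using continuous_const
  have hcont (G : Y → ι → ι → ℂ) (hG : ∀ I J, Continuous fun y => G y I J) :
      Continuous fun p : Y × (s → ℂ) => hermForm s (G p.1) (ext p.2) := by
    refine Complex.continuous_re.comp (continuous_finsetSum _ fun I _ =>
      continuous_finsetSum _ fun J _ => ?_)
    exact ((continuous_star.comp ((hext I).comp continuous_snd)).mul
      ((hext J).comp continuous_snd)).mul ((hG I J).comp continuous_fst)
  obtain ⟨t, ht⟩ := exists_forall_pos_add_mul (hK.prod (isCompact_sphere (0 : s → ℂ) 1))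
    (hcont R hR).continuousOn (hcont (fun _ => H) fun _ _ => continuous_const).continuousOn
    (fun p _ => hH _) (fun p hp h => by
      refine hpos p.1 hp.1 _ ?_ h
      have hne : p.2 ≠ 0 := by
        intro h0
        have := hp.2
        simp [h0] at this
      obtain ⟨I, hI⟩ := Function.ne_iff.1 hne
      exact ⟨I, I.2, by simpa [ext] using hI⟩)
  refine ⟨t, fun y hy a ha => ?_⟩
  obtain ⟨I, hI, haI⟩ := ha
  let u : s → ℂ := fun I => a I
  have hu : u ≠ 0 := Function.ne_iff.2 ⟨⟨I, hI⟩, haI⟩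
  have hmem : ((‖u‖⁻¹ : ℝ) : ℂ) • u ∈ Metric.sphere (0 : s → ℂ) 1 := by
    rw [mem_sphere_zero_iff_norm, norm_smul, Complex.norm_real, norm_inv, norm_norm,
      inv_mul_cancel₀ (norm_ne_zero_iff.2 hu)]
  have := ht (y, _) ⟨hy, hmem⟩
  rw [← hermForm_add_mul] at this
  have e : hermForm s (fun I J => R y I J + t * H I J) (ext (((‖u‖⁻¹ : ℝ) : ℂ) • u)) =
      (‖u‖⁻¹) ^ 2 * hermForm s (fun I J => R y I J + t * H I J) a := by
    rw [← hermForm_smul]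
    refine hermForm_congr (fun _ _ _ _ => rfl) fun I hI => ?_
    simp [ext, hI, u]
  rw [e] at this
  exact pos_of_mul_pos_right this (by positivity)

end HermForm

section Hankel

variable {n : ℕ}

/-- The monomial with exponent `I` evaluated at a lattice point. -/
def latticePow (p : Fin n → ℕ) (I : Fin n →₀ ℕ) : ℂ := ∏ i, (p i : ℂ) ^ I i

theorem latticePow_add (p : Fin n → ℕ) (I J : Fin n →₀ ℕ) :
    latticePow p (I + J) = latticePow p I * latticePow p J := by
  simp [latticePow, pow_add, Finset.prod_mul_distrib]

theorem star_latticePow (p : Fin n → ℕ) (I : Fin n →₀ ℕ) :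
    star (latticePow p I) = latticePow p I := by
  simp [latticePow]

/-- The moments of the counting measure of the grid `{0, …, r}^n`. -/
def gridMoment (r : ℕ) (I : Fin n →₀ ℕ) : ℂ :=
  ∑ p ∈ Fintype.piFinset fun _ : Fin n => Finset.range (r + 1), latticePow p I

/-- The matrix of moments of degree `2 * r`. -/
def hankel (r : ℕ) (I J : Fin n →₀ ℕ) : ℂ :=
  if I.degree = r ∧ J.degree = r then gridMoment r (I + J) else 0

/-- The Hankel form is the integral of `|∑ a_I p ^ I| ^ 2` over the grid. -/
theorem hermForm_hankel (r : ℕ) (s : Finset (Fin n →₀ ℕ)) (a : (Fin n →₀ ℕ) → ℂ) :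
    hermForm s (hankel r) a = ∑ p ∈ Fintype.piFinset fun _ : Fin n => Finset.range (r + 1),
      Complex.normSq (∑ I ∈ s with I.degree = r, a I * latticePow p I) := by
  have hz (p : Fin n → ℕ) : (Complex.normSq (∑ I ∈ s with I.degree = r,
      a I * latticePow p I) : ℂ) =
      ∑ I ∈ s, ∑ J ∈ s, if I.degree = r ∧ J.degree = r then
        star (a I) * a J * latticePow p (I + J) else 0 := by
    rw [← Complex.mul_conj, mul_comm, map_sum, Finset.sum_mul_sum, Finset.sum_filter]
    refine Finset.sum_congr rfl fun I _ => ?_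
    rw [Finset.sum_filter]
    by_cases hI : I.degree = r
    · rw [if_pos hI]
      refine Finset.sum_congr rfl fun J _ => ?_
      by_cases hJ : J.degree = r
      · rw [if_pos hJ, if_pos ⟨hI, hJ⟩, latticePow_add, map_mul]
        rw [← Complex.star_def, star_latticePow]
        ring
      · rw [if_neg hJ, if_neg fun h => hJ h.2]
    · rw [if_neg hI]
      exact (Finset.sum_eq_zero fun J _ => if_neg fun h => hI h.1).symm
  rw [hermForm, ← Complex.ofReal_re (∑ p ∈ _, _)]
  congr 1
  push_cast
  simp only [hz]
  conv_rhs => rw [Finset.sum_comm]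
  refine Finset.sum_congr rfl fun I _ => ?_
  conv_rhs => rw [Finset.sum_comm]
  refine Finset.sum_congr rfl fun J _ => ?_
  rw [hankel, gridMoment]
  split_ifs
  · rw [Finset.mul_sum]
  · simp

/-- The Hankel form is definite on the homogeneous polynomials of degree `r`, since a polynomial of
degree at most `r` in each variable is determined by its values on the grid. -/
theorem eq_zero_of_hermForm_hankel_eq_zero {r : ℕ} {s : Finset (Fin n →₀ ℕ)}
    {a : (Fin n →₀ ℕ) → ℂ} (h : hermForm s (hankel r) a = 0) {I : Fin n →₀ ℕ} (hI : I ∈ s)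
    (hIr : I.degree = r) : a I = 0 := by
  classical
  rw [hermForm_hankel, Finset.sum_eq_zero_iff_of_nonneg fun _ _ => Complex.normSq_nonneg _] at h
  let Q : MvPolynomial (Fin n) ℂ := ∑ I ∈ s with I.degree = r, MvPolynomial.monomial I (a I)
  have hQ : Q = 0 := by
    refine MvPolynomial.eq_zero_of_eval_zero_at_prod_finset Q
      (fun _ => (Finset.range (r + 1)).image (fun k : ℕ => (k : ℂ))) (fun i => ?_) fun x hx => ?_
    · rw [Finset.card_image_of_injective _ Nat.cast_injective, Finset.card_range, Nat.lt_succ_iff]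
      refine (MvPolynomial.degreeOf_le_totalDegree Q i).trans
        (MvPolynomial.totalDegree_finsetSum_le fun J hJ => ?_)
      refine (MvPolynomial.totalDegree_monomial_le _ _).trans (le_of_eq ?_)
      exact (Finset.mem_filter.1 hJ).2
    · choose p hp hpx using fun i => Finset.mem_image.1 (hx i)
      have := Complex.normSq_eq_zero.1 (h p (Fintype.mem_piFinset.2 hp))
      rw [map_sum, ← this]
      refine Finset.sum_congr rfl fun J _ => ?_
      rw [MvPolynomial.eval_monomial, latticePow, Finsupp.prod_fintype _ _ (fun _ => pow_zero _)]
      simp [hpx]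
  have := congrArg (MvPolynomial.coeff I) hQ
  rw [MvPolynomial.coeff_sum, MvPolynomial.coeff_zero, Finset.sum_eq_single I] at this
  · simpa using this
  · intro J _ hJ
    simp [hJ]
  · intro hI'
    exact absurd (Finset.mem_filter.2 ⟨hI, hIr⟩) hI'

end Hankel

/-! ### Local deformations of the evaluation functionals -/

section Recursion

open StarAlg

variable {n : ℕ} {M : Type*} [TopologicalSpace M] [ChartedSpace (EuclideanSpace ℝ (Fin n)) M]
  {P : PoissonBracket n M} {V : Set M} {S : HermitianStarProduct P}

theorem coeff_ptFunctional_congr {Φ Φ' : ℕ → SmoothFn n M →ₗ[ℂ] SmoothFn n M} {r : ℕ}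
    (h : ∀ s ≤ r, Φ s = Φ' s) (y : M) (f : StarAlg S) :
    PowerSeries.coeff r (ptFunctional S Φ y f) = PowerSeries.coeff r (ptFunctional S Φ' y f) := by
  rw [coeff_ptFunctional, coeff_ptFunctional]
  refine Finset.sum_congr rfl fun p hp => ?_
  rw [Finset.HasAntidiagonal.mem_antidiagonal] at hp
  rw [h p.1 (by omega)]

theorem coeff_ptFunctional_update (Φ : ℕ → SmoothFn n M →ₗ[ℂ] SmoothFn n M) (r : ℕ)
    (Ψ : SmoothFn n M →ₗ[ℂ] SmoothFn n M) (y : M) (f : StarAlg S) :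
    PowerSeries.coeff r (ptFunctional S (Function.update Φ r Ψ) y f) =
      evalAt n y (Ψ (f.cf 0)) +
        PowerSeries.coeff r (ptFunctional S (Function.update Φ r 0) y f) := by
  have hmem : (r, 0) ∈ antidiagonal r := by simp
  rw [coeff_ptFunctional, coeff_ptFunctional, ← Finset.add_sum_erase _ _ hmem,
    ← Finset.add_sum_erase _ _ hmem]
  simp only [Function.update_self, LinearMap.zero_apply, map_zero, zero_add]
  congr 1
  refine Finset.sum_congr rfl fun p hp => ?_
  rw [Finset.mem_erase, Finset.HasAntidiagonal.mem_antidiagonal] at hp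
  have hne : p.1 ≠ r := fun h => hp.1 (Prod.ext h (by omega))
  rw [Function.update_of_ne hne, Function.update_of_ne hne]

theorem coeff_ptFunctional_zero (Φ : ℕ → SmoothFn n M →ₗ[ℂ] SmoothFn n M) (y : M)
    (f : StarAlg S) :
    PowerSeries.coeff 0 (ptFunctional S Φ y f) = evalAt n y (Φ 0 (f.cf 0)) := by
  simp [coeff_ptFunctional]

theorem IsTame.exists_evalAt_eq_coeff {f : M → StarAlg S} (hf : IsTame f)
    (Φ : ℕ → SmoothFn n M →ₗ[ℂ] SmoothFn n M) (r : ℕ) : ∃ w : SmoothFn n M,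
      ∀ y, evalAt n y w = PowerSeries.coeff r (ptFunctional S Φ y (f y)) := by
  choose w hw using fun p : ℕ × ℕ => exists_evalAt_eq_of_tame (Φ p.1) (hf p.2)
  refine ⟨∑ p ∈ antidiagonal r, w p, fun y => ?_⟩
  rw [map_sum, coeff_ptFunctional]
  exact Finset.sum_congr rfl fun p _ => hw p y

variable (L : LocalCoordinates n V)

/-- The entries of the Gram matrix of the monomials of weight `r` at the point `y`, with respect to
the deformed functional. -/
def LocalCoordinates.gram (S : HermitianStarProduct P)
    (Φ : ℕ → SmoothFn n M →ₗ[ℂ] SmoothFn n M) (y : M) (I J : Fin n →₀ ℕ) : ℂ :=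
  PowerSeries.coeff ((I.degree + J.degree) / 2) (ptFunctional S Φ y
    (star (orderedMonomial (L.coord S y) I) * orderedMonomial (L.coord S y) J))

/-- The conditions imposed on the coefficients `Φ_0, …, Φ_r` at step `r` of the construction: `Φ_r` is
of finite order on `V`, the deformed functional has a term `λ ^ r` only on the monomials of degree
`2 * r`, its Gram matrix of weight `r` is positive definite at the points of `K`, and `Φ_0` is the
identity on `V`. -/
structure LocalCoordinates.IsStage (S : HermitianStarProduct P) (K : Set M) (r : ℕ)
    (Φ : ℕ → SmoothFn n M →ₗ[ℂ] SmoothFn n M) : Prop where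
  order : ∃ k, ∀ y ∈ V, ∀ f ∈ vanishIdeal n y ^ k, evalAt n y (Φ r f) = 0
  coeff_eq_zero : ∀ y ∈ V, ∀ I : Fin n →₀ ℕ, I.degree ≠ 2 * r →
    PowerSeries.coeff r (ptFunctional S Φ y (orderedMonomial (L.coord S y) I)) = 0
  pos : ∀ y ∈ K, ∀ a : (Fin n →₀ ℕ) → ℂ, (∃ I ∈ parityIndices n r, a I ≠ 0) →
    0 < hermForm (parityIndices n r) (L.gram S Φ y) a
  eval_zero : r = 0 → ∀ y ∈ V, ∀ f, evalAt n y (Φ r f) = evalAt n y f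

theorem LocalCoordinates.gram_congr {Φ Φ' : ℕ → SmoothFn n M →ₗ[ℂ] SmoothFn n M} {r : ℕ}
    (h : ∀ s ≤ r, Φ s = Φ' s) (y : M) {I J : Fin n →₀ ℕ} (hI : I ∈ parityIndices n r)
    (hJ : J ∈ parityIndices n r) : L.gram S Φ y I J = L.gram S Φ' y I J := by
  rw [mem_parityIndices] at hI hJ
  exact coeff_ptFunctional_congr (fun s hs => h s (by omega)) y _

theorem LocalCoordinates.IsStage.congr {K : Set M} {r : ℕ}
    {Φ Φ' : ℕ → SmoothFn n M →ₗ[ℂ] SmoothFn n M} (h : ∀ s ≤ r, Φ s = Φ' s)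
    (hΦ : L.IsStage S K r Φ) : L.IsStage S K r Φ' where
  order := by rw [← h r le_rfl]; exact hΦ.order
  coeff_eq_zero y hy I hI := by
    rw [← coeff_ptFunctional_congr h]
    exact hΦ.coeff_eq_zero y hy I hI
  pos y hy a ha := by
    rw [← hermForm_congr (fun I hI J hJ => L.gram_congr h y hI hJ) fun _ _ => rfl]
    exact hΦ.pos y hy a ha
  eval_zero := by rw [← h r le_rfl]; exact hΦ.eval_zero

theorem LocalCoordinates.isStage_zero {K : Set M} (Φ : ℕ → SmoothFn n M →ₗ[ℂ] SmoothFn n M) :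
    L.IsStage S K 0 (Function.update Φ 0 LinearMap.id) where
  order := ⟨1, fun y _ f hf => by simpa [mem_vanishIdeal] using hf⟩
  coeff_eq_zero y hy I hI := by
    have hI0 : I ≠ 0 := by rintro rfl; simp at hI
    rw [coeff_ptFunctional_zero, Function.update_self, LinearMap.id_apply,
      L.cf_zero_orderedMonomial, L.evalAt_aeval_centred, MvPolynomial.coeff_monomial, if_neg hI0]
  pos y hy a ha := by
    obtain ⟨I, hI, haI⟩ := ha
    have hs : parityIndices n 0 = {0} := by
      ext J
      rw [mem_parityIndices, Finset.mem_singleton, Nat.le_zero, Finsupp.degree_eq_zero_iff]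
      constructor
      · exact fun h => h.1
      · rintro rfl; simp
    rw [hs, Finset.mem_singleton] at hI
    subst hI
    have hg : L.gram S (Function.update Φ 0 LinearMap.id) y 0 0 = 1 := by
      have : orderedMonomial (L.coord S y) 0 = 1 := by simp [orderedMonomial]
      rw [gram, this, star_one, mul_one]
      simp [coeff_ptFunctional_zero]
    rw [hs, hermForm, Finset.sum_singleton, Finset.sum_singleton, hg, mul_one, mul_comm,
      Complex.star_def, Complex.mul_conj, Complex.ofReal_re]
    exact Complex.normSq_pos.2 haI
  eval_zero _ y _ f := by rw [Function.update_self, LinearMap.id_apply]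

variable [IsManifold (𝓡 n) ∞ M] [T2Space M]

/-- The coefficient `Φ_r` can be chosen so that the coefficient of `λ ^ r` of the deformed functional
takes prescribed values on the monomials, because the Taylor coefficients at `y` of the lowest
order of a series can be prescribed freely. -/
theorem LocalCoordinates.exists_update {N : ℕ → ℕ} (hN : OrderBound S V N) {r : ℕ}
    {Φ : ℕ → SmoothFn n M →ₗ[ℂ] SmoothFn n M}
    (hΦ : ∀ s < r, ∃ k, ∀ y ∈ V, ∀ f ∈ vanishIdeal n y ^ k, evalAt n y (Φ s f) = 0)
    (ν : (Fin n →₀ ℕ) → ℂ) {D : ℕ} (hν : ∀ I, D ≤ I.degree → ν I = 0) :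
    ∃ Ψ : SmoothFn n M →ₗ[ℂ] SmoothFn n M,
      (∃ k, ∀ y ∈ V, ∀ f ∈ vanishIdeal n y ^ k, evalAt n y (Ψ f) = 0) ∧
      ∀ y ∈ V, ∀ I, PowerSeries.coeff r (ptFunctional S (Function.update Φ r Ψ) y
        (orderedMonomial (L.coord S y) I)) = ν I := by
  classical
  obtain ⟨T, hT⟩ := L.exists_taylorCoeff
  choose k hk using hΦ
  choose E hE using fun I =>
    (L.isTame_orderedMonomial S I).exists_evalAt_eq_coeff (Function.update Φ r 0) r
  let κ (I : Fin n →₀ ℕ) : SmoothFn n M := algebraMap ℂ _ (ν I) - E I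
  have hκ (I : Fin n →₀ ℕ) (y : M) : evalAt n y (κ I) = ν I - evalAt n y (E I) := by
    rw [map_sub, AlgHom.commutes]
    rfl
  -- The monomials of degree at least `K` are annihilated by all the coefficients.
  let K := D + orderShift N r + ∑ s ∈ (Finset.range r).attach, k s (Finset.mem_range.1 s.2)
  have hκ0 (I : Fin n →₀ ℕ) (hI : K ≤ I.degree) (y : M) (hy : y ∈ V) : evalAt n y (κ I) = 0 := by
    rw [hκ, hν I (by omega), hE, zero_sub, neg_eq_zero, coeff_ptFunctional]
    refine Finset.sum_eq_zero fun p hp => ?_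
    rw [Finset.HasAntidiagonal.mem_antidiagonal] at hp
    by_cases hpr : p.1 = r
    · rw [hpr, Function.update_self, LinearMap.zero_apply, map_zero]
    have hlt : p.1 < r := by omega
    rw [Function.update_of_ne hpr]
    refine hk p.1 hlt y hy _ (Ideal.pow_le_pow_right ?_ (ptFilt_le_orderFilt L.isOpen hN hy _
      (orderedMonomial_mem_weightFilt (isClassicalIdeal_pointIdeal S y)
        (L.isCoordinates_coord S hy).mem I) p.2))
    have h1 := orderShift_mono N (show p.2 ≤ r by omega)
    have h2 := Finset.single_le_sum (f := fun s : Finset.range r => k s (Finset.mem_range.1 s.2))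
      (fun _ _ => Nat.zero_le _) (Finset.mem_attach _ ⟨p.1, Finset.mem_range.2 hlt⟩)
    dsimp only at h2
    omega
  let s := parityIndices n K ∪ parityIndices n (K + 1)
  have hs (I : Fin n →₀ ℕ) : I ∈ s ↔ I.degree ≤ K + 1 := by
    rw [Finset.mem_union, mem_parityIndices, mem_parityIndices]
    omega
  refine ⟨∑ I ∈ s, LinearMap.mulRight ℂ (κ I) ∘ₗ T I, ⟨K + 2, fun y hy f hf => ?_⟩,
    fun y hy I => ?_⟩
  · rw [LinearMap.sum_apply, map_sum]
    refine Finset.sum_eq_zero fun I hI => ?_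
    rw [hs] at hI
    rw [LinearMap.comp_apply, LinearMap.mulRight_apply, map_mul,
      (hT I y hy).1 (K + 2) (by omega) f hf, zero_mul]
  · rw [coeff_ptFunctional_update, L.cf_zero_orderedMonomial, LinearMap.sum_apply, map_sum,
      Finset.sum_eq_single I]
    · rw [LinearMap.comp_apply, LinearMap.mulRight_apply, map_mul, (hT I y hy).2,
        MvPolynomial.coeff_monomial, if_pos rfl, one_mul, hκ, hE, sub_add_cancel]
    · intro J _ hJ
      rw [LinearMap.comp_apply, LinearMap.mulRight_apply, map_mul, (hT J y hy).2,
        MvPolynomial.coeff_monomial, if_neg hJ.symm, zero_mul]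
    · intro hI
      rw [hs] at hI
      rw [LinearMap.comp_apply, LinearMap.mulRight_apply, map_mul, hκ0 I (by omega) y hy, mul_zero]


/-- The recursive step. The values of the new coefficient `Φ_r` on the monomials of degree `2 * r` are
`t` times the moments of a grid; they add `t` times a Hankel matrix to the Gram matrix of weight
`r`, which is thereby made positive definite for large `t`. -/
theorem LocalCoordinates.exists_isStage_update {N : ℕ → ℕ} (hN : OrderBound S V N) {K : Set M}
    (hK : IsCompact K) (hKV : K ⊆ V) {r : ℕ} (hr : r ≠ 0)
    {Φ : ℕ → SmoothFn n M →ₗ[ℂ] SmoothFn n M} (hΦ : ∀ s < r, L.IsStage S K s Φ) :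
    ∃ Ψ, L.IsStage S K r (Function.update Φ r Ψ) := by
  classical
  set Φ₀ := Function.update Φ r 0 with hΦ₀
  -- The part of the Gram matrix of weight `r` that does not depend on the choice of `t`.
  let R (y : M) (I J : Fin n →₀ ℕ) : ℂ := L.gram S Φ₀ y I J -
    if I.degree = r ∧ J.degree = r then
      PowerSeries.coeff r (ptFunctional S Φ₀ y (orderedMonomial (L.coord S y) (I + J))) else 0
  have hcont {f : M → StarAlg S} (hf : IsTame f) (q : ℕ) :
      Continuous fun y => PowerSeries.coeff q (ptFunctional S Φ₀ y (f y)) := by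
    obtain ⟨w, hw⟩ := hf.exists_evalAt_eq_coeff Φ₀ q
    simp only [← hw]
    exact (SmoothFn.contMDiff w).continuous
  have hR (I J : Fin n →₀ ℕ) : Continuous fun y => R y I J := by
    refine (hcont ((L.isTame_orderedMonomial S I).star.mul (L.isTame_orderedMonomial S J)) _).sub ?_
    split_ifs
    · exact hcont (L.isTame_orderedMonomial S _) r
    · exact continuous_const
  obtain ⟨t, ht⟩ := exists_hermForm_add_mul_pos hK (parityIndices n r) R (hankel r) hR
    (fun a => by
      rw [hermForm_hankel]
      exact Finset.sum_nonneg fun _ _ => Complex.normSq_nonneg _)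
    (fun y hy a ha h => by
      have h0 (I : Fin n →₀ ℕ) (hI : I ∈ parityIndices n r) (hd : I.degree = r) : a I = 0 :=
        eq_zero_of_hermForm_hankel_eq_zero h hI hd
      obtain ⟨I, hI, haI⟩ := ha
      -- In particular `r ≥ 2`, as for `r = 1` all exponents have degree `r`.
      have hlt : I.degree ≠ r := fun hd => haI (h0 I hI hd)
      have hI' := mem_parityIndices.1 hI
      have hsub : parityIndices n (r - 2) ⊆ parityIndices n r := fun J hJ => by
        rw [mem_parityIndices] at hJ ⊢
        omega
      have hz (J : Fin n →₀ ℕ) (hJ : J ∈ parityIndices n r) (hJ' : J ∉ parityIndices n (r - 2)) :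
          a J = 0 := by
        refine h0 J hJ ?_
        rw [mem_parityIndices] at hJ hJ'
        omega
      -- On null vectors of the Hankel form, `R` is the Gram matrix of weight `r - 2`.
      have e : hermForm (parityIndices n r) (R y) a =
          hermForm (parityIndices n (r - 2)) (L.gram S Φ y) a := by
        rw [hermForm, hermForm]
        congr 1
        rw [← Finset.sum_subset hsub fun J hJ hJ' => Finset.sum_eq_zero fun J' _ => by
          rw [hz J hJ hJ']; simp]
        refine Finset.sum_congr rfl fun J hJ => ?_
        rw [← Finset.sum_subset hsub fun J' hJ hJ' => by rw [hz J' hJ hJ']; simp]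
        refine Finset.sum_congr rfl fun J' hJ' => ?_
        have hd := (mem_parityIndices.1 hJ).1
        dsimp only [R]
        rw [if_neg fun h => by omega, sub_zero, L.gram_congr (Φ := Φ₀) (Φ' := Φ)
          (fun s hs => ?_) y hJ hJ']
        exact Function.update_of_ne (by omega) _ _
      rw [e]
      exact (hΦ (r - 2) (by omega)).pos y hy a ⟨I, mem_parityIndices.2 (by omega), haI⟩)
  obtain ⟨Ψ, hΨ, hν⟩ := L.exists_update hN (fun s hs => (hΦ s hs).order)
    (fun I => if I.degree = 2 * r then t * gridMoment r I else 0) (D := 2 * r + 1)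
    (fun I hI => if_neg (by omega))
  refine ⟨Ψ, by rwa [Function.update_self], fun y hy I hI => ?_, fun y hy a ha => ?_,
    fun h => absurd h hr⟩
  · rw [hν y hy, if_neg hI]
  · refine (ht y hy a ha).trans_eq (hermForm_congr (fun I hI J hJ => ?_) fun _ _ => rfl)
    have hI := mem_parityIndices.1 hI
    have hJ := mem_parityIndices.1 hJ
    by_cases h : I.degree = r ∧ J.degree = r
    · have hq : (I.degree + J.degree) / 2 = r := by omega
      -- Modulo `λ` the product of two monomials is the monomial with the sum of the exponents.
      have hcf : (star (orderedMonomial (L.coord S y) I) * orderedMonomial (L.coord S y) J).cf 0 =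
          (orderedMonomial (L.coord S y) (I + J)).cf 0 := by
        have hst : star (MvPolynomial.aeval (L.centred y) (MvPolynomial.monomial I (1 : ℂ))) =
            MvPolynomial.aeval (L.centred y) (MvPolynomial.monomial I (1 : ℂ)) := by
          simp [MvPolynomial.aeval_monomial, Finsupp.prod, star_prod, L.star_centred]
        rw [cf_zero_mul, cf_star, L.cf_zero_orderedMonomial, L.cf_zero_orderedMonomial,
          L.cf_zero_orderedMonomial, hst, ← map_mul, MvPolynomial.monomial_mul, mul_one]
      have h1 := hν y (hKV hy) (I + J)
      rw [coeff_ptFunctional_update, map_add, if_pos (by omega)] at h1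
      dsimp only [R]
      rw [if_pos h, gram, gram, hq, coeff_ptFunctional_update Φ r Ψ, hcf, hankel, if_pos h, ← h1]
      ring
    · dsimp only [R]
      rw [if_neg h, hankel, if_neg h, mul_zero, add_zero, sub_zero, gram, gram]
      refine coeff_ptFunctional_congr (fun s hs => ?_) y _
      rw [hΦ₀, Function.update_of_ne (by omega), Function.update_of_ne (by omega)]

theorem LocalCoordinates.exists_isStage {N : ℕ → ℕ} (hN : OrderBound S V N) {K : Set M}
    (hK : IsCompact K) (hKV : K ⊆ V) : ∃ Φ, ∀ r, L.IsStage S K r Φ := by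
  refine exists_seq_of_forall_exists_update (L.IsStage S K) (fun r Φ Φ' h hΦ => hΦ.congr L h)
    fun r Φ hΦ => ?_
  obtain rfl | hr := eq_or_ne r 0
  · exact ⟨_, L.isStage_zero Φ⟩
  · exact L.exists_isStage_update hN hK hKV hr hΦ

end Recursion

/-! ### Positivity at a point -/

/-- The lowest nonvanishing term of the sequence, if there is one, is positive. -/
def LexNonneg (h : ℕ → ℝ) : Prop := ∀ k, (∀ i < k, h i = 0) → 0 ≤ h k

theorem LexNonneg.add {h h' : ℕ → ℝ} (hh : LexNonneg h) (hh' : LexNonneg h') :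
    LexNonneg fun k => h k + h' k := by
  intro k hk
  have hz (i : ℕ) (hi : i < k) : h i = 0 ∧ h' i = 0 := by
    induction i using Nat.strong_induction_on with
    | _ i ih =>
      have h1 := hh i fun j hj => (ih j hj (hj.trans hi)).1
      have h2 := hh' i fun j hj => (ih j hj (hj.trans hi)).2
      have := hk i hi
      dsimp only at this
      constructor <;> linarith
  exact add_nonneg (hh k fun i hi => (hz i hi).1) (hh' k fun i hi => (hz i hi).2)

theorem LexNonneg.const_mul {h : ℕ → ℝ} (hh : LexNonneg h) {c : ℝ} (hc : 0 ≤ c) :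
    LexNonneg fun k => c * h k := by
  intro k hk
  obtain rfl | hc' := hc.eq_or_lt
  · simp
  · exact mul_nonneg hc (hh k fun i hi => (mul_eq_zero.1 (hk i hi)).resolve_left hc'.ne')

theorem LexNonneg.sum {ι : Type*} (s : Finset ι) {h : ι → ℕ → ℝ}
    (hh : ∀ i ∈ s, LexNonneg (h i)) : LexNonneg fun k => ∑ i ∈ s, h i k := by
  classical
  induction s using Finset.induction_on with
  | empty => intro k _; simp
  | insert i s hi ih =>
    simp only [Finset.sum_insert hi]
    exact (hh i (Finset.mem_insert_self i s)).add
      (ih fun j hj => hh j (Finset.mem_insert_of_mem hj))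

section Pointwise

open StarAlg

variable {n : ℕ} {M : Type*} [TopologicalSpace M] [ChartedSpace (EuclideanSpace ℝ (Fin n)) M]
  {P : PoissonBracket n M} {V : Set M} {S : HermitianStarProduct P} (L : LocalCoordinates n V)

theorem StarAlg.star_C_mul_X_pow_smul (z : ℂ) (i : ℕ) (f : StarAlg S) :
    star ((PowerSeries.C z * PowerSeries.X ^ i : ℂ⟦X⟧) • f) =
      (PowerSeries.C (star z) * PowerSeries.X ^ i : ℂ⟦X⟧) • star f := by
  rw [mul_smul, mul_smul, star_C_smul]
  congr 1
  induction i with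
  | zero => simp
  | succ i ih => rw [pow_succ', mul_smul, mul_smul, star_X_smul, ih]

theorem LocalCoordinates.coeff_ptFunctional_weightedSum
    (Φ : ℕ → SmoothFn n M →ₗ[ℂ] SmoothFn n M) (y : M) (s : ℕ) (a : (Fin n →₀ ℕ) → ℂ) :
    (PowerSeries.coeff s (ptFunctional S Φ y
      (star (weightedSum (L.coord S y) s a) * weightedSum (L.coord S y) s a))).re =
      hermForm (parityIndices n s) (L.gram S Φ y) a := by
  rw [weightedSum, star_sum, Finset.sum_mul_sum, map_sum, map_sum, hermForm]
  congr 1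
  refine Finset.sum_congr rfl fun I hI => ?_
  rw [map_sum, map_sum]
  refine Finset.sum_congr rfl fun J hJ => ?_
  rw [mem_parityIndices] at hI hJ
  have e' (u v w : ℂ⟦X⟧) (i j : ℕ) : u * PowerSeries.X ^ i * (v * PowerSeries.X ^ j * w) =
      PowerSeries.X ^ (i + j) * (u * (v * w)) := by ring
  rw [star_C_mul_X_pow_smul, smul_mul_smul_comm, mul_smul, map_smul (ptFunctional S Φ y),
    map_smul (ptFunctional S Φ y), smul_eq_mul,
    smul_eq_mul, e']
  rw [PowerSeries.coeff_X_pow_mul', if_pos (by omega), PowerSeries.coeff_C_mul,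
    PowerSeries.coeff_C_mul, gram, mul_assoc,
    show s - ((s - I.degree) / 2 + (s - J.degree) / 2) = (I.degree + J.degree) / 2 by omega]

variable [IsManifold (𝓡 n) ∞ M] [T2Space M]

/-- If the Gram matrices of the monomials of each weight are positive definite, then the deformed
functional is positive: the lowest term of its value on `f* ⋆ f` is the value of such a Gram matrix
on the leading coefficients of `f` for the weight filtration. -/
theorem LocalCoordinates.lexNonneg_ptFunctional {N : ℕ → ℕ} (hN : OrderBound S V N) {K : Set M}
    (hKV : K ⊆ V) {Φ : ℕ → SmoothFn n M →ₗ[ℂ] SmoothFn n M} (hΦ : ∀ r, L.IsStage S K r Φ)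
    {y : M} (hy : y ∈ K) (f : StarAlg S) :
    LexNonneg fun k => (PowerSeries.coeff k (ptFunctional S Φ y (star f * f))).re := by
  have hJ := isClassicalIdeal_pointIdeal S y
  have hx := L.isCoordinates_coord S (hKV hy)
  choose k hk using fun r => (hΦ r).order
  have hcont := exists_dvd_ptFunctional L.isOpen hN (hKV hy) fun r => hk r y (hKV hy)
  have hmon (r : ℕ) (I : Fin n →₀ ℕ) (hr : 2 * r ≤ I.degree + 1) :
      PowerSeries.X ^ r ∣ ptFunctional S Φ y (orderedMonomial (L.coord S y) I) := by
    rw [PowerSeries.X_pow_dvd_iff]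
    intro q hq
    exact (hΦ q).coeff_eq_zero y (hKV hy) I (by omega)
  have hzero {k q : ℕ} (hq : 2 * q + 1 ≤ k) {g : StarAlg S} (hg : g ∈ ptFilt S y k) :
      PowerSeries.coeff q (ptFunctional S Φ y g) = 0 :=
    PowerSeries.X_pow_dvd_iff.1 (map_weightFilt_dvd hJ hx (ptFunctional S Φ y) hcont hmon (q + 1) k
      (by omega) g hg) q (lt_add_one q)
  -- On elements of infinite weight the functional vanishes.
  by_cases hall : ∀ s, f ∈ ptFilt S y s
  · intro q _
    dsimp only
    rw [hzero (k := 0 + (2 * q + 1)) (by omega)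
      (mul_mem_weightFilt hJ (j := 0) Submodule.mem_top (hall (2 * q + 1)))]
    simp
  · push Not at hall
    obtain ⟨s, hs, hs'⟩ : ∃ s, f ∈ ptFilt S y s ∧ f ∉ ptFilt S y (s + 1) := by
      by_contra! hcon
      obtain ⟨s, hs⟩ := hall
      exact hs (Nat.rec Submodule.mem_top (fun s ih => hcon s ih) s)
    obtain ⟨a, ha⟩ := exists_sub_weightedSum_mem hJ hx hs
    set w := weightedSum (L.coord S y) s a
    have hw : w ∈ ptFilt S y s := weightedSum_mem hJ hx.mem s a
    have ha0 : ∃ I ∈ parityIndices n s, a I ≠ 0 := by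
      by_contra! hcon
      have : w = 0 := Finset.sum_eq_zero fun I hI => by rw [hcon I hI]; simp
      rw [this, sub_zero] at ha
      exact hs' ha
    have hlow (q : ℕ) (hq : q < s) : PowerSeries.coeff q (ptFunctional S Φ y (star f * f)) = 0 :=
      hzero (by omega) (mul_mem_weightFilt hJ (star_mem_ptFilt hs) hs)
    have htop : 0 < (PowerSeries.coeff s (ptFunctional S Φ y (star f * f))).re := by
      have e : star f * f = star w * w + (star w * (f - w) + star (f - w) * f) := by
        rw [star_sub]
        noncomm_ring
      have h1 : PowerSeries.coeff s (ptFunctional S Φ y (star w * (f - w) + star (f - w) * f)) = 0 :=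
        hzero (k := 2 * s + 1) le_rfl (add_mem
          (weightFilt_antitone hJ (by omega) (mul_mem_weightFilt hJ (star_mem_ptFilt hw) ha))
          (weightFilt_antitone hJ (by omega) (mul_mem_weightFilt hJ (star_mem_ptFilt ha) hs)))
      rw [e, map_add, map_add, h1, add_zero, L.coeff_ptFunctional_weightedSum]
      exact (hΦ s).pos y hy a ha0
    intro q hq
    obtain hqs | rfl | hqs := lt_trichotomy q s
    · dsimp only
      rw [hlow q hqs, Complex.zero_re]
    · exact htop.le
    · exact absurd (hq s hqs) htop.ne'

/-- The restriction of local coordinates to a smaller open set. -/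
def LocalCoordinates.restrict {W : Set M} (hW : IsOpen W) (hWV : W ⊆ V) :
    LocalCoordinates n W where
  x := L.x
  d := L.d
  isOpen := hW
  star_x := L.star_x
  d_mul := L.d_mul
  d_x y hy := L.d_x y (hWV hy)
  sub_mem y hy := L.sub_mem y (hWV hy)

/-- Near any point, all the evaluation functionals have positive deformations that depend smoothly on
the point. -/
theorem exists_local_lexNonneg (S : HermitianStarProduct P) (c : M) :
    ∃ U : Set M, IsOpen U ∧ c ∈ U ∧ ∃ Φ : ℕ → SmoothFn n M →ₗ[ℂ] SmoothFn n M, ∀ y ∈ U,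
      (∀ f, evalAt n y (Φ 0 f) = evalAt n y f) ∧ ∀ f : StarAlg S,
        LexNonneg fun k => (PowerSeries.coeff k (ptFunctional S Φ y (star f * f))).re := by
  have : LocallyCompactSpace M := Manifold.locallyCompact_of_finiteDimensional (𝓡 n)
  obtain ⟨W, hcW, ⟨L⟩⟩ := exists_localCoordinates (n := n) c
  obtain ⟨K₁, hK₁, hKW, hK₁c⟩ := local_compact_nhds (L.isOpen.mem_nhds hcW)
  obtain ⟨K, hK, hKK₁, hKc⟩ := local_compact_nhds (interior_mem_nhds.2 hK₁)
  choose N hN using fun s => IsBidifferential.exists_order (S.bidifferential s) hK₁c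
  have hN' : OrderBound S (interior K₁) N := fun s y hy g f hf =>
    hN s y (interior_subset hy) g f hf
  obtain ⟨Φ, hΦ⟩ := (L.restrict isOpen_interior (interior_subset.trans hKW)).exists_isStage hN'
    hKc hKK₁
  refine ⟨interior K, isOpen_interior, mem_interior_iff_mem_nhds.2 hK, Φ, fun y hy => ⟨?_, ?_⟩⟩
  · exact (hΦ 0).eval_zero rfl y (hKK₁ (interior_subset hy))
  · exact (L.restrict isOpen_interior (interior_subset.trans hKW)).lexNonneg_ptFunctional hN' hKK₁
      hΦ (interior_subset hy)

end Pointwise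

/-! ### Global deformations of the evaluation functionals -/

section Global

open StarAlg

variable {n : ℕ} {M : Type*} [TopologicalSpace M] [ChartedSpace (EuclideanSpace ℝ (Fin n)) M]

/-- The sum of a family of linear maps weighted by a partition of unity. -/
def glue {ι : Type*} (χ : SmoothPartitionOfUnity ι (𝓡 n) M)
    (Ψ : ι → SmoothFn n M →ₗ[ℂ] SmoothFn n M) : SmoothFn n M →ₗ[ℂ] SmoothFn n M where
  toFun f := .mk (fun y => ∑ᶠ i, χ i y • (Ψ i f : M → ℂ) y)
    (χ.contMDiff_finsum_smul fun i y _ => (SmoothFn.contMDiff (Ψ i f)).contMDiffAt)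
  map_add' f g := SmoothFn.ext fun y => by
    simp only [map_add, evalAt_apply]
    rw [← χ.sum_finsupport_smul_eq_finsum y fun i => (Ψ i f : M → ℂ),
      ← χ.sum_finsupport_smul_eq_finsum y fun i => (Ψ i g : M → ℂ),
      ← χ.sum_finsupport_smul_eq_finsum y fun i => ((Ψ i f + Ψ i g : SmoothFn n M) : M → ℂ),
      ← Finset.sum_add_distrib]
    exact Finset.sum_congr rfl fun i _ => smul_add _ _ _
  map_smul' z f := SmoothFn.ext fun y => by
    simp only [map_smul, evalAt_apply, RingHom.id_apply]
    rw [← χ.sum_finsupport_smul_eq_finsum y fun i => (Ψ i f : M → ℂ),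
      ← χ.sum_finsupport_smul_eq_finsum y fun i => ((z • Ψ i f : SmoothFn n M) : M → ℂ),
      Finset.smul_sum]
    exact Finset.sum_congr rfl fun i _ => smul_comm (χ i y) z ((Ψ i f : M → ℂ) y)

theorem evalAt_glue {ι : Type*} (χ : SmoothPartitionOfUnity ι (𝓡 n) M)
    (Ψ : ι → SmoothFn n M →ₗ[ℂ] SmoothFn n M) (f : SmoothFn n M) (y : M) :
    evalAt n y (glue χ Ψ f) = ∑ i ∈ χ.finsupport y, (χ i y : ℂ) * evalAt n y (Ψ i f) :=
  (χ.sum_finsupport_smul_eq_finsum y fun i => (Ψ i f : M → ℂ)).symm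

/-- The Hermitian part of a linear map. -/
def hermitize (Ψ : SmoothFn n M →ₗ[ℂ] SmoothFn n M) : SmoothFn n M →ₗ[ℂ] SmoothFn n M where
  toFun f := (2⁻¹ : ℂ) • (Ψ f + star (Ψ (star f)))
  map_add' f g := by
    simp only [star_add, map_add, ← smul_add]
    congr 1
    abel
  map_smul' z f := by
    simp only [star_smul, map_smul, star_star, ← smul_add, RingHom.id_apply]
    rw [smul_comm]

theorem hermitize_apply (Ψ : SmoothFn n M →ₗ[ℂ] SmoothFn n M) (f : SmoothFn n M) :
    hermitize Ψ f = (2⁻¹ : ℂ) • (Ψ f + star (Ψ (star f))) := rfl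

theorem hermitize_star (Ψ : SmoothFn n M →ₗ[ℂ] SmoothFn n M) (f : SmoothFn n M) :
    hermitize Ψ (star f) = star (hermitize Ψ f) := by
  rw [hermitize_apply, hermitize_apply, star_smul, star_add, star_star, star_star, add_comm]
  simp

theorem evalAt_hermitize {Ψ : SmoothFn n M →ₗ[ℂ] SmoothFn n M} {f : SmoothFn n M}
    (hf : star f = f) (y : M) : evalAt n y (hermitize Ψ f) = (evalAt n y (Ψ f)).re := by
  rw [hermitize_apply, hf, map_smul, map_add, evalAt_star, Complex.star_def, Complex.add_conj]
  simp

variable {P : PoissonBracket n M} [IsManifold (𝓡 n) ∞ M] [T2Space M] [SecondCountableTopology M]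

/-- All the evaluation functionals are deformed to positive functionals at once, smoothly in the
point. -/
theorem exists_lexNonneg_ptFunctional (S : HermitianStarProduct P) :
    ∃ Φ : ℕ → SmoothFn n M →ₗ[ℂ] SmoothFn n M, Φ 0 = LinearMap.id ∧
      (∀ r f, Φ r (star f) = star (Φ r f)) ∧ ∀ y (f : StarAlg S),
        LexNonneg fun k => (PowerSeries.coeff k (ptFunctional S Φ y (star f * f))).re := by
  have : LocallyCompactSpace M := Manifold.locallyCompact_of_finiteDimensional (𝓡 n)
  choose U hU hcU Ψ hΨ using exists_local_lexNonneg S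
  obtain ⟨χ, hχ⟩ := SmoothPartitionOfUnity.exists_isSubordinate (𝓡 n) isClosed_univ U hU
    fun c _ => Set.mem_iUnion.2 ⟨c, hcU c⟩
  have hmem {y c : M} (hc : c ∈ χ.finsupport y) : y ∈ U c := by
    rw [χ.mem_finsupport] at hc
    exact hχ c (subset_tsupport _ hc)
  have hΦ (r : ℕ) (f : SmoothFn n M) (hf : star f = f) (y : M) :
      evalAt n y (hermitize (glue χ fun c => Ψ c r) f) =
        ((∑ c ∈ χ.finsupport y, χ c y * (evalAt n y (Ψ c r f)).re : ℝ) : ℂ) := by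
    rw [evalAt_hermitize hf, evalAt_glue, Complex.re_sum]
    simp only [Complex.re_ofReal_mul]
  have hid : glue χ (fun c => Ψ c 0) = LinearMap.id := by
    refine LinearMap.ext fun f => SmoothFn.ext fun y => ?_
    rw [evalAt_glue, LinearMap.id_apply, Finset.sum_congr rfl fun c hc => by
      rw [(hΨ c y (hmem hc)).1 f], ← Finset.sum_mul]
    have h1 := χ.sum_finsupport y (Set.mem_univ y)
    rw [← Complex.ofReal_sum, h1, Complex.ofReal_one, one_mul]
  refine ⟨fun r => hermitize (glue χ fun c => Ψ c r), ?_, fun r f => hermitize_star _ f,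
    fun y f => ?_⟩
  · refine LinearMap.ext fun f => ?_
    dsimp only
    rw [hid, hermitize_apply, LinearMap.id_apply, LinearMap.id_apply, star_star, ← two_smul ℂ,
      smul_smul]
    simp
  · have hstar (j : ℕ) : star ((star f * f).cf j) = (star f * f).cf j := by
      rw [← cf_star, star_mul, star_star]
    have e : (fun k => (PowerSeries.coeff k (ptFunctional S
        (fun r => hermitize (glue χ fun c => Ψ c r)) y (star f * f))).re) = fun k =>
        ∑ c ∈ χ.finsupport y, χ c y *
          (PowerSeries.coeff k (ptFunctional S (Ψ c) y (star f * f))).re := by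
      funext k
      rw [coeff_ptFunctional, Finset.sum_congr rfl fun p _ => hΦ p.1 _ (hstar p.2) y,
        ← Complex.ofReal_sum, Complex.ofReal_re, Finset.sum_comm]
      refine Finset.sum_congr rfl fun c _ => ?_
      rw [coeff_ptFunctional, Complex.re_sum, Finset.mul_sum]
    rw [e]
    exact LexNonneg.sum _ fun c hc => ((hΨ c y (hmem hc)).2 f).const_mul (χ.nonneg c y)

end Global

/-! ### Positive functionals -/

section PositiveFunctional

variable {A : Type*} [Ring A] [StarRing A] [Algebra ℂ A]

theorem IsPositiveFunctional.im_eq_zero {φ : A →ₗ[ℂ] ℂ} (hφ : IsPositiveFunctional φ) {a : A}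
    (ha : star a = a) : (φ a).im = 0 := by
  have h1 := (Complex.nonneg_iff.1 (hφ (a + 1))).2
  have h2 := (Complex.nonneg_iff.1 (hφ (a - 1))).2
  have e : star (a + 1) * (a + 1) - star (a - 1) * (a - 1) = (4 : ℂ) • a := by
    rw [star_add, star_sub, ha, star_one, show (4 : ℂ) = ((4 : ℕ) : ℂ) by norm_num,
      Nat.cast_smul_eq_nsmul]
    noncomm_ring
  have h3 := congrArg (fun b => (φ b).im) e
  simp only [map_sub, map_smul, Complex.sub_im, ← h1, ← h2, smul_eq_mul, Complex.mul_im] at h3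
  norm_num at h3
  exact h3

variable [StarModule ℂ A]

/-- A positive functional that vanishes at the unit is zero, by the Cauchy–Schwarz inequality. -/
theorem IsPositiveFunctional.eq_zero {φ : A →ₗ[ℂ] ℂ} (hφ : IsPositiveFunctional φ) (h1 : φ 1 = 0) :
    φ = 0 := by
  have hlin {p w : ℝ} (h : ∀ t : ℝ, 0 ≤ p + t * w) : w = 0 := by
    by_contra hw
    have := h (-(p + 1) / w)
    rw [div_mul_cancel₀ _ hw] at this
    linarith
  have hcs (a : A) (z : ℂ) : z * φ (star a) + star z * φ a = 0 := by
    have key (t : ℝ) : 0 ≤ φ (star a * a) + t * (z * φ (star a) + star z * φ a) := by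
      have := hφ (a + (t * z : ℂ) • (1 : A))
      have e : star (a + (t * z : ℂ) • (1 : A)) * (a + (t * z : ℂ) • (1 : A)) =
          star a * a + (t : ℂ) • (z • star a + star z • a) +
            ((t * star z) * (t * z) : ℂ) • (1 : A) := by
        rw [star_add, star_smul, star_one, star_mul', show star (t : ℂ) = t from Complex.conj_ofReal t,
          add_mul, mul_add, mul_add, smul_mul_assoc, smul_mul_assoc, mul_smul_comm, mul_smul_comm,
          one_mul, one_mul, mul_one, smul_add, smul_smul, smul_smul, smul_smul]
        abel
      rw [e] at this
      simpa [h1, mul_add] using this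
    refine Complex.ext (hlin (p := (φ (star a * a)).re) fun t => ?_)
      (hlin (p := (φ (star a * a)).im) fun t => ?_)
    · have := (Complex.nonneg_iff.1 (key t)).1
      rwa [Complex.add_re, Complex.re_ofReal_mul] at this
    · have := (Complex.nonneg_iff.1 (key t)).2
      rw [Complex.add_im, Complex.im_ofReal_mul] at this
      exact this.le
  refine LinearMap.ext fun a => ?_
  have e1 := hcs a 1
  have e2 := hcs a Complex.I
  have hI : Complex.I * (φ (star a) - φ a) = 0 := by
    rw [Complex.star_def, Complex.conj_I] at e2
    linear_combination e2
  rw [star_one, one_mul, one_mul] at e1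
  have h2 := (mul_eq_zero.1 hI).resolve_left Complex.I_ne_zero
  rw [LinearMap.zero_apply]
  linear_combination (e1 - h2) / 2

end PositiveFunctional

/-! ### Positive definite matrices of smooth functions -/

/-- If the lowest nonvanishing one of `h 0, …, h (k - 1)` is positive, and `q` is positive where they
all vanish, then a combination of `q` with large multiples of `h 0, …, h (k - 1)` is positive. -/
theorem exists_forall_pos_add_sum {X : Type*} [TopologicalSpace X] {K : Set X} (hK : IsCompact K)
    {h : ℕ → X → ℝ} (hh : ∀ i, Continuous (h i)) (hlex : ∀ x ∈ K, LexNonneg fun i => h i x)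
    (k : ℕ) {q : X → ℝ} (hq : Continuous q) (hpos : ∀ x ∈ K, (∀ i < k, h i x = 0) → 0 < q x) :
    ∃ c : ℕ → ℝ, ∀ x ∈ K, 0 < q x + ∑ i ∈ Finset.range k, c i * h i x := by
  induction k generalizing q with
  | zero => exact ⟨0, fun x hx => by simpa using hpos x hx (by simp)⟩
  | succ k ih =>
    -- First make `q` positive on the common zeros of `h 0, …, h (k - 1)`.
    have hZ : IsCompact (K ∩ ⋂ i ∈ Finset.range k, {x | h i x = 0}) :=
      hK.inter_right (isClosed_biInter fun i _ => isClosed_eq (hh i) continuous_const)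
    have hZ' {x : X} (hx : x ∈ K ∩ ⋂ i ∈ Finset.range k, {x | h i x = 0}) :
        ∀ i < k, h i x = 0 := fun i hi => by
      have := Set.mem_iInter₂.1 hx.2 i (Finset.mem_range.2 hi)
      exact this
    obtain ⟨t, ht⟩ := exists_forall_pos_add_mul hZ hq.continuousOn (hh k).continuousOn
      (fun x hx => hlex x hx.1 k (hZ' hx)) (fun x hx h0 => hpos x hx.1 fun i hi => by
        obtain hi | rfl := Nat.lt_succ_iff_lt_or_eq.1 hi
        · exact hZ' hx i hi
        · exact h0)
    obtain ⟨c, hc⟩ := ih (q := fun x => q x + t * h k x) (hq.add (continuous_const.mul (hh k)))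
      fun x hx h0 => ht x ⟨hx, Set.mem_iInter₂.2 fun i hi => h0 i (Finset.mem_range.1 hi)⟩
    refine ⟨Function.update c k t, fun x hx => ?_⟩
    rw [Finset.sum_range_succ, Function.update_self]
    refine (hc x hx).trans_eq ?_
    have : ∑ i ∈ Finset.range k, Function.update c k t i * h i x =
        ∑ i ∈ Finset.range k, c i * h i x := Finset.sum_congr rfl fun i hi => by
      rw [Function.update_of_ne (Finset.mem_range.1 hi).ne]
    rw [this]
    ring

section Cholesky

variable {n : ℕ} {M : Type*} [TopologicalSpace M] [ChartedSpace (EuclideanSpace ℝ (Fin n)) M]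

/-- A positive function has a smooth inverse square root. -/
theorem SmoothFn.exists_mul_self_mul_eq_one {f : SmoothFn n M} (hf : star f = f)
    (hpos : ∀ y, 0 < (evalAt n y f).re) : ∃ g : SmoothFn n M, star g = g ∧ g * g * f = 1 := by
  have hs : ContMDiff (𝓡 n) 𝓘(ℝ, ℂ) ∞ fun y => (((√((evalAt n y f).re))⁻¹ : ℝ) : ℂ) := by
    intro y
    have h1 : ContDiffAt ℝ ∞ (fun z : ℂ => (((√z.re)⁻¹ : ℝ) : ℂ)) ((f : M → ℂ) y) := by
      refine Complex.ofRealCLM.contDiff.contDiffAt.comp _ ?_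
      have h2 : ContDiffAt ℝ ∞ (fun z : ℂ => z.re) ((f : M → ℂ) y) :=
        Complex.reCLM.contDiff.contDiffAt
      exact (h2.sqrt (hpos y).ne').inv (Real.sqrt_pos.2 (hpos y)).ne'
    exact h1.contMDiffAt.comp y (SmoothFn.contMDiff f y)
  refine ⟨.mk _ hs, SmoothFn.ext fun y => ?_, SmoothFn.ext fun y => ?_⟩
  · simp [evalAt_apply]
  · have him : (evalAt n y f).im = 0 := by
      have := congrArg (fun g => (evalAt n y g).im) hf
      simp only [evalAt_star, Complex.star_def, Complex.conj_im] at this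
      linarith
    have hre : evalAt n y f = ((evalAt n y f).re : ℂ) := Complex.ext (by simp) (by simp [him])
    have hsq := Real.mul_self_sqrt (hpos y).le
    have hne := (Real.sqrt_pos.2 (hpos y)).ne'
    rw [map_mul, map_mul, map_one]
    change (((√((evalAt n y f).re))⁻¹ : ℝ) : ℂ) * (((√((evalAt n y f).re))⁻¹ : ℝ) : ℂ) * _ = 1
    conv_lhs => rw [hre, ← Complex.ofReal_mul, ← Complex.ofReal_mul, Complex.ofReal_re]
    rw [← Complex.ofReal_one]
    congr 1
    generalize √((evalAt n y f).re) = q at hsq hne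
    rw [← hsq]
    field_simp

variable {m : ℕ}

/-- The form at `y` of a matrix of functions. -/
def formAt (s : Finset (Fin m)) (H : Matrix (Fin m) (Fin m) (SmoothFn n M)) (y : M)
    (v : Fin m → ℂ) : ℝ := hermForm s (fun i j => evalAt n y (H i j)) v

/-- A Hermitian matrix of functions which is everywhere positive definite is a sum of squares; this
is the Cholesky decomposition, obtained by eliminating one index after the other. -/
theorem exists_eq_sum_star_mul_self (s : Finset (Fin m))
    {H : Matrix (Fin m) (Fin m) (SmoothFn n M)} (hH : star H = H)
    (hs : ∀ i j, i ∉ s ∨ j ∉ s → H i j = 0)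
    (hpos : ∀ y, ∀ v : Fin m → ℂ, (∃ i ∈ s, v i ≠ 0) → 0 < formAt s H y v) :
    ∃ R : Fin m → Matrix (Fin m) (Fin m) (SmoothFn n M), H = ∑ i ∈ s, star (R i) * R i := by
  induction s using Finset.induction_on generalizing H with
  | empty =>
    refine ⟨0, ?_⟩
    ext1 i j
    rw [hs i j (Or.inl (Finset.notMem_empty i))]
    simp
  | insert i s hi ih =>
    have hst (j k : Fin m) : star (H j k) = H k j := congrFun (congrFun hH k) j
    have hne {j : Fin m} (hj : j ∈ s) : j ≠ i := fun h => hi (h ▸ hj)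
    obtain ⟨g, hg, hgH⟩ := SmoothFn.exists_mul_self_mul_eq_one (hst i i) fun y => by
      have := hpos y (Pi.single i 1) ⟨i, Finset.mem_insert_self i s, by simp⟩
      have e : formAt (insert i s) H y (Pi.single i 1) = (evalAt n y (H i i)).re := by
        rw [formAt, hermForm, Finset.sum_eq_single i, Finset.sum_eq_single i]
        · simp
        · intro j _ hj; simp [hj]
        · simp
        · intro j _ hj; simp [hj]
        · simp
      rwa [e] at this
    -- The matrix `R* R` has the same row and column with index `i` as `H`.
    let R : Matrix (Fin m) (Fin m) (SmoothFn n M) :=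
      Matrix.of fun j k => if j = i then g * H i k else 0
    have hR (j k : Fin m) : (star R * R) j k = g * g * (H j i * H i k) := by
      rw [Matrix.mul_apply, Finset.sum_eq_single i]
      · simp only [R, Matrix.star_apply, Matrix.of_apply, if_pos, star_mul, hg, hst]
        ring
      · intro l _ hl
        simp [R, hl]
      · simp
    have hH' : star (H - star R * R) = H - star R * R := by
      rw [star_sub, star_mul, star_star, hH]
    obtain ⟨R', hR'⟩ := ih (H := H - star R * R) hH' (fun j k hjk => by
        rw [Matrix.sub_apply, hR]
        by_cases hj : j = i
        · rw [hj, ← mul_assoc, hgH, one_mul, sub_self]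
        by_cases hk : k = i
        · rw [hk, mul_comm (H j i), ← mul_assoc, hgH, one_mul, sub_self]
        by_cases hjs : j ∈ s
        · rw [hs j k (Or.inr fun h => (hjk.resolve_left (not_not.2 hjs))
            ((Finset.mem_insert.1 h).resolve_left hk)),
            hs i k (Or.inr fun h => (hjk.resolve_left (not_not.2 hjs))
            ((Finset.mem_insert.1 h).resolve_left hk)), mul_zero, mul_zero, sub_zero]
        · rw [hs j k (Or.inl fun h => hjs ((Finset.mem_insert.1 h).resolve_left hj)),
            hs j i (Or.inl fun h => hjs ((Finset.mem_insert.1 h).resolve_left hj)),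
            zero_mul, mul_zero, sub_zero])
      (fun y v hv => by
        obtain ⟨j, hj, hvj⟩ := hv
        -- The component with index `i` is chosen to minimise the form.
        let u := evalAt n y (g * g) * ∑ k ∈ s, evalAt n y (H i k) * v k
        have := hpos y (Function.update v i (-u)) ⟨j, Finset.mem_insert_of_mem hj, by
          rwa [Function.update_of_ne (hne hj)]⟩
        refine this.trans_eq ?_
        rw [formAt, formAt, hermForm, hermForm]
        congr 1
        have hv (k : Fin m) (hk : k ∈ s) : Function.update v i (-u) k = v k :=
          Function.update_of_ne (hne hk) _ _
        have hgy : evalAt n y (g * g) * evalAt n y (H i i) = 1 := by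
          rw [← map_mul, hgH, map_one]
        have hsg : star (evalAt n y (g * g)) = evalAt n y (g * g) := by
          rw [← evalAt_star, star_mul, hg]
        have hsu : star u = evalAt n y (g * g) * ∑ k ∈ s, star (v k) * evalAt n y (H k i) := by
          rw [star_mul', hsg, star_sum]
          congr 1
          refine Finset.sum_congr rfl fun k _ => ?_
          rw [star_mul', ← evalAt_star, hst, mul_comm]
        have e1 : ∑ k ∈ s, star (-u) * v k * evalAt n y (H i k) =
            -(star u * ∑ k ∈ s, evalAt n y (H i k) * v k) := by
          rw [Finset.mul_sum, ← Finset.sum_neg_distrib]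
          refine Finset.sum_congr rfl fun k _ => ?_
          rw [star_neg]
          ring
        have e2 : ∑ j ∈ s, star (v j) * (-u) * evalAt n y (H j i) =
            -(u * ∑ j ∈ s, star (v j) * evalAt n y (H j i)) := by
          rw [Finset.mul_sum, ← Finset.sum_neg_distrib]
          refine Finset.sum_congr rfl fun k _ => ?_
          ring
        have e3 : ∑ j ∈ s, ∑ k ∈ s, star (v j) * v k * evalAt n y ((H - star R * R) j k) =
            ∑ j ∈ s, ∑ k ∈ s, star (v j) * v k * evalAt n y (H j k) -
              evalAt n y (g * g) * ((∑ j ∈ s, star (v j) * evalAt n y (H j i)) *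
                ∑ k ∈ s, evalAt n y (H i k) * v k) := by
          rw [Finset.sum_mul_sum, Finset.mul_sum, ← Finset.sum_sub_distrib]
          refine Finset.sum_congr rfl fun j _ => ?_
          rw [Finset.mul_sum, ← Finset.sum_sub_distrib]
          refine Finset.sum_congr rfl fun k _ => ?_
          rw [Matrix.sub_apply, hR, map_sub, map_mul, map_mul (evalAt n y) (H j i)]
          ring
        have e4 : ∑ j ∈ s, ∑ k ∈ insert i s, star (Function.update v i (-u) j) *
            Function.update v i (-u) k * evalAt n y (H j k) =
            ∑ j ∈ s, star (v j) * (-u) * evalAt n y (H j i) +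
              ∑ j ∈ s, ∑ k ∈ s, star (v j) * v k * evalAt n y (H j k) := by
          rw [← Finset.sum_add_distrib]
          refine Finset.sum_congr rfl fun j hj => ?_
          rw [Finset.sum_insert hi, Function.update_self, hv j hj]
          congr 1
          exact Finset.sum_congr rfl fun k hk => by rw [hv k hk]
        rw [Finset.sum_insert hi, Finset.sum_insert hi, Function.update_self, e4, e3, e2,
          Finset.sum_congr rfl fun k hk => by rw [hv k hk], e1, star_neg, hsu]
        simp only [u]
        generalize evalAt n y (H i i) = δ at hgy ⊢
        generalize evalAt n y (g * g) = γ at hgy ⊢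
        generalize ∑ k ∈ s, evalAt n y (H i k) * v k = w
        linear_combination (γ * (∑ k ∈ s, star (v k) * evalAt n y (H k i)) * w) * hgy)
    refine ⟨Function.update R' i R, ?_⟩
    rw [Finset.sum_insert hi, Function.update_self, Finset.sum_congr rfl fun j hj => by
      rw [Function.update_of_ne (hne hj)], ← hR', add_sub_cancel]

end Cholesky

/-! ### Integration of pointwise positivity -/

section Integration

variable {n : ℕ} {M : Type*} [TopologicalSpace M] [ChartedSpace (EuclideanSpace ℝ (Fin n)) M]
  {m : ℕ}

theorem formAt_add (s : Finset (Fin m)) (H H' : Matrix (Fin m) (Fin m) (SmoothFn n M)) (y : M)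
    (v : Fin m → ℂ) : formAt s (H + H') y v = formAt s H y v + formAt s H' y v := by
  simp only [formAt, hermForm, Matrix.add_apply, map_add, mul_add, Finset.sum_add_distrib,
    Complex.add_re]

theorem formAt_smul (s : Finset (Fin m)) {c : SmoothFn n M} {y : M} {r : ℝ}
    (hc : evalAt n y c = r) (H : Matrix (Fin m) (Fin m) (SmoothFn n M)) (v : Fin m → ℂ) :
    formAt s (c • H) y v = r * formAt s H y v := by
  rw [formAt, formAt, hermForm, hermForm, ← Complex.re_ofReal_mul, Finset.mul_sum]
  congr 1
  refine Finset.sum_congr rfl fun i _ => ?_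
  rw [Finset.mul_sum]
  refine Finset.sum_congr rfl fun j _ => ?_
  rw [Matrix.smul_apply, smul_eq_mul, map_mul, hc]
  ring

theorem formAt_sum {ι : Type*} (s : Finset (Fin m)) (t : Finset ι)
    (H : ι → Matrix (Fin m) (Fin m) (SmoothFn n M)) (y : M) (v : Fin m → ℂ) :
    formAt s (∑ k ∈ t, H k) y v = ∑ k ∈ t, formAt s (H k) y v := by
  classical
  induction t using Finset.induction_on with
  | empty => simp [formAt, hermForm]
  | insert k t hk ih => rw [Finset.sum_insert hk, Finset.sum_insert hk, formAt_add, ih]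

theorem formAt_one_pos (y : M) {v : Fin m → ℂ} (hv : v ≠ 0) :
    0 < formAt Finset.univ (1 : Matrix (Fin m) (Fin m) (SmoothFn n M)) y v := by
  have e : formAt Finset.univ (1 : Matrix (Fin m) (Fin m) (SmoothFn n M)) y v =
      ∑ i, Complex.normSq (v i) := by
    rw [formAt, hermForm, Complex.re_sum]
    refine Finset.sum_congr rfl fun i _ => ?_
    rw [Finset.sum_eq_single i]
    · rw [Matrix.one_apply_eq, map_one, mul_one, mul_comm, Complex.star_def, Complex.mul_conj,
        Complex.ofReal_re]
    · intro j _ hj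
      rw [Matrix.one_apply_ne hj.symm, map_zero, mul_zero]
    · simp
  rw [e]
  obtain ⟨i, hi⟩ := Function.ne_iff.1 hv
  exact Finset.sum_pos' (fun i _ => Complex.normSq_nonneg _)
    ⟨i, Finset.mem_univ i, Complex.normSq_pos.2 hi⟩

theorem continuous_formAt (s : Finset (Fin m)) (H : Matrix (Fin m) (Fin m) (SmoothFn n M)) :
    Continuous fun p : M × (Fin m → ℂ) => formAt s H p.1 p.2 := by
  refine Complex.continuous_re.comp (continuous_finsetSum _ fun i _ =>
    continuous_finsetSum _ fun j _ => ?_)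
  have h (i : Fin m) : Continuous fun p : M × (Fin m → ℂ) => p.2 i :=
    (continuous_apply i).comp continuous_snd
  exact ((continuous_star.comp (h i)).mul (h j)).mul
    ((SmoothFn.contMDiff (H i j)).continuous.comp continuous_fst)

theorem continuous_formAt_right (s : Finset (Fin m))
    (H : Matrix (Fin m) (Fin m) (SmoothFn n M)) (y : M) :
    Continuous fun v => formAt s H y v := by
  refine Complex.continuous_re.comp (continuous_finsetSum _ fun i _ =>
    continuous_finsetSum _ fun j _ => ?_)
  exact ((continuous_star.comp (continuous_apply i)).mul (continuous_apply j)).mul continuous_const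

theorem formAt_pos_of_sphere {s : Finset (Fin m)} {H : Matrix (Fin m) (Fin m) (SmoothFn n M)}
    {y : M} (h : ∀ v ∈ Metric.sphere (0 : Fin m → ℂ) 1, 0 < formAt s H y v) {v : Fin m → ℂ}
    (hv : v ≠ 0) : 0 < formAt s H y v := by
  have hmem : (fun i => ((‖v‖⁻¹ : ℝ) : ℂ) * v i) ∈ Metric.sphere (0 : Fin m → ℂ) 1 := by
    change ((‖v‖⁻¹ : ℝ) : ℂ) • v ∈ _
    rw [mem_sphere_zero_iff_norm, norm_smul, Complex.norm_real, norm_inv, norm_norm,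
      inv_mul_cancel₀ (norm_ne_zero_iff.2 hv)]
  have := h _ hmem
  rw [formAt, hermForm_smul] at this
  exact pos_of_mul_pos_right this (by positivity)

/-- A positive functional is nonnegative on the multiples of a positive definite matrix by squares. -/
theorem IsPositiveFunctional.smul_nonneg {φ : Matrix (Fin m) (Fin m) (SmoothFn n M) →ₗ[ℂ] ℂ}
    (hφ : IsPositiveFunctional φ) {H : Matrix (Fin m) (Fin m) (SmoothFn n M)} (hH : star H = H)
    (hpos : ∀ y v, v ≠ 0 → 0 < formAt Finset.univ H y v) (g : SmoothFn n M) :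
    0 ≤ φ ((star g * g) • H) := by
  obtain ⟨R, hR⟩ := exists_eq_sum_star_mul_self Finset.univ hH (by simp) fun y v hv => by
    obtain ⟨i, -, hi⟩ := hv
    exact hpos y v (Function.ne_iff.2 ⟨i, hi⟩)
  rw [hR, Finset.smul_sum, map_sum]
  refine Finset.sum_nonneg fun i _ => ?_
  have e : (star g * g) • (star (R i) * R i) = star (g • R i) * (g • R i) := by
    rw [star_smul, smul_mul_smul_comm]
  rw [e]
  exact hφ _

variable [IsManifold (𝓡 n) ∞ M] [T2Space M] [SecondCountableTopology M]

/-- If at each point the lowest nonvanishing one of the forms `H 0, H 1, …` is positive, then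
`H k + ε` becomes positive definite after adding multiples of `H 0, …, H (k - 1)` with smooth
coefficients. -/
theorem exists_formAt_add_pos {H : ℕ → Matrix (Fin m) (Fin m) (SmoothFn n M)}
    (hlex : ∀ y v, LexNonneg fun q => formAt Finset.univ (H q) y v) (k : ℕ) {ε : ℝ} (hε : 0 < ε) :
    ∃ c : Fin k → SmoothFn n M, (∀ i, star (c i) = c i) ∧ ∀ y v, v ≠ 0 →
      0 < formAt Finset.univ (H k + (algebraMap ℂ (SmoothFn n M) ε • 1 + ∑ i, c i • H i)) y v := by
  have : LocallyCompactSpace M := Manifold.locallyCompact_of_finiteDimensional (𝓡 n)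
  let F (c : Fin k → ℝ) (y : M) (v : Fin m → ℂ) : ℝ :=
    formAt Finset.univ (H k) y v +
      ε * formAt Finset.univ (1 : Matrix (Fin m) (Fin m) (SmoothFn n M)) y v +
      ∑ i, c i * formAt Finset.univ (H i) y v
  have hF (c : Fin k → ℝ) : Continuous fun p : M × (Fin m → ℂ) => F c p.1 p.2 :=
    ((continuous_formAt _ _).add (continuous_const.mul (continuous_formAt _ _))).add
      (continuous_finsetSum _ fun i _ => continuous_const.mul (continuous_formAt _ _))
  have hS := isCompact_sphere (0 : Fin m → ℂ) 1
  obtain ⟨g, hg⟩ := exists_contMDiffMap_forall_mem_convex_of_local_const (𝓡 n) (n := ⊤)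
    (t := fun y : M => {c : Fin k → ℝ | ∀ v ∈ Metric.sphere (0 : Fin m → ℂ) 1, 0 < F c y v})
    (fun y => by
      intro c hc d hd a b ha hb hab v hv
      have h1 := hc v hv
      have h2 := hd v hv
      have e : F (a • c + b • d) y v = a * F c y v + b * F d y v := by
        simp only [F, Pi.add_apply, Pi.smul_apply, smul_eq_mul, add_mul, Finset.sum_add_distrib,
          mul_assoc, ← Finset.mul_sum]
        linear_combination -(formAt Finset.univ (H k) y v + ε * formAt Finset.univ
          (1 : Matrix (Fin m) (Fin m) (SmoothFn n M)) y v) * hab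
      rw [e]
      obtain rfl | ha' := ha.eq_or_lt
      · have : b = 1 := by linarith
        subst this
        simpa using h2
      · exact add_pos_of_pos_of_nonneg (mul_pos ha' h1) (mul_nonneg hb h2.le))
    (fun x => by
      obtain ⟨c, hc⟩ := exists_forall_pos_add_sum hS (h := fun q v => formAt Finset.univ (H q) x v)
        (fun q => continuous_formAt_right _ (H q) x) (fun v _ => hlex x v) k
        (q := fun v => formAt Finset.univ (H k) x v + ε * formAt Finset.univ 1 x v)
        ((continuous_formAt_right _ (H k) x).add
          (continuous_const.mul (continuous_formAt_right (n := n) _ 1 x))) fun v hv h0 =>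
          add_pos_of_nonneg_of_pos (hlex x v k h0) (mul_pos hε (formAt_one_pos x fun h => by
            rw [h] at hv
            simp at hv))
      refine ⟨fun i => c i, hS.eventually_forall_of_forall_eventually fun v hv =>
        (isOpen_lt continuous_const (hF fun i => c i)).mem_nhds ?_⟩
      have := hc v hv
      rw [Finset.sum_range] at this
      exact this)
  have hsm (i : Fin k) : ContMDiff (𝓡 n) 𝓘(ℝ, ℂ) ∞ fun y => ((g y i : ℝ) : ℂ) :=
    (Complex.ofRealCLM.comp (ContinuousLinearMap.proj i : (Fin k → ℝ) →L[ℝ] ℝ)).contMDiff.comp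
      g.contMDiff
  refine ⟨fun i => .mk _ (hsm i), fun i => SmoothFn.ext fun y => Complex.conj_ofReal _,
    fun y v hv => formAt_pos_of_sphere (fun v hv => ?_) hv⟩
  rw [formAt_add, formAt_add, formAt_sum, formAt_smul _ (AlgHom.commutes (evalAt n y) (ε : ℂ)),
    Finset.sum_congr rfl fun i _ => formAt_smul _ (r := g y i) rfl (H i) v, ← add_assoc]
  exact hg y v hv

/-- A positive functional inherits positivity of the lowest nonvanishing term from the points. -/
theorem IsPositiveFunctional.lexNonneg {φ : Matrix (Fin m) (Fin m) (SmoothFn n M) →ₗ[ℂ] ℂ}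
    (hφ : IsPositiveFunctional φ) {H : ℕ → Matrix (Fin m) (Fin m) (SmoothFn n M)}
    (hH : ∀ q, star (H q) = H q)
    (hlex : ∀ y v, LexNonneg fun q => formAt Finset.univ (H q) y v) :
    LexNonneg fun q => (φ (H q)).re := by
  -- If all multiples of `H 0, …, H (k - 1)` are annihilated, then the functional is nonnegative on the
  -- multiples of `H k` by squares.
  have key (k : ℕ) (h0 : ∀ i < k, ∀ g : SmoothFn n M, φ (g • H i) = 0) (g : SmoothFn n M) :
      0 ≤ φ ((star g * g) • H k) := by
    have hε (ε : ℝ) (hε : 0 < ε) :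
        0 ≤ φ ((star g * g) • H k) +
          ε * φ ((star g * g) • (1 : Matrix (Fin m) (Fin m) (SmoothFn n M))) := by
      obtain ⟨c, hc, hpos⟩ := exists_formAt_add_pos hlex k hε
      have := hφ.smul_nonneg (H := H k + (algebraMap ℂ (SmoothFn n M) ε • 1 + ∑ i, c i • H i))
        (by
          rw [star_add, star_add, star_sum, hH, star_smul, star_one, ← algebraMap_star_comm,
            Complex.star_def, Complex.conj_ofReal]
          simp only [star_smul, hc, hH]) hpos g
      rw [smul_add, smul_add, map_add, map_add, Finset.smul_sum, map_sum,
        Finset.sum_eq_zero fun i _ => by rw [smul_smul]; exact h0 i i.2 _, add_zero,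
        algebraMap_smul, smul_comm, map_smul φ (ε : ℂ), smul_eq_mul] at this
      exact this
    set p := φ ((star g * g) • H k)
    set w := φ ((star g * g) • (1 : Matrix (Fin m) (Fin m) (SmoothFn n M)))
    have h1 := Complex.nonneg_iff.1 (hε 1 one_pos)
    have h2 := Complex.nonneg_iff.1 (hε 2 two_pos)
    have h3 (ε : ℝ) (h : 0 < ε) : 0 ≤ p.re + ε * w.re := by
      have := (Complex.nonneg_iff.1 (hε ε h)).1
      rwa [Complex.add_re, Complex.re_ofReal_mul] at this
    refine Complex.nonneg_iff.2 ⟨?_, ?_⟩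
    · have ht : Filter.Tendsto (fun ε : ℝ => p.re + ε * w.re) (nhdsWithin 0 (Set.Ioi 0))
          (nhds (p.re + 0 * w.re)) :=
        ((continuous_const.add (continuous_id.mul continuous_const)).tendsto 0).mono_left
          nhdsWithin_le_nhds
      rw [zero_mul, add_zero] at ht
      exact ge_of_tendsto ht (by filter_upwards [self_mem_nhdsWithin] with ε h using h3 ε h)
    · have h4 := h1.2
      have h5 := h2.2
      rw [Complex.add_im, Complex.im_ofReal_mul] at h4 h5
      linarith
  have key1 (k : ℕ) (h0 : ∀ i < k, ∀ g : SmoothFn n M, φ (g • H i) = 0) : 0 ≤ φ (H k) := by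
    simpa using key k h0 1
  -- If only `H 0, …, H (k - 1)` are known to be annihilated, then inductively so are their multiples,
  -- because `g ↦ φ (g • H i)` is a positive functional that vanishes at `1`.
  have hvanish (k : ℕ) (hk : ∀ i < k, (φ (H i)).re = 0) (i : ℕ) (hi : i < k) (g : SmoothFn n M) :
      φ (g • H i) = 0 := by
    induction i using Nat.strong_induction_on generalizing g with
    | _ i ih =>
      have h0 (j : ℕ) (hj : j < i) (g : SmoothFn n M) : φ (g • H j) = 0 := ih j hj (hj.trans hi) g
      let ψ : SmoothFn n M →ₗ[ℂ] ℂ := φ ∘ₗ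
        (LinearMap.toSpanSingleton (SmoothFn n M) (Matrix (Fin m) (Fin m) (SmoothFn n M))
          (H i)).restrictScalars ℂ
      have hψ : IsPositiveFunctional ψ := fun g => key i h0 g
      have hψ1 : ψ 1 = 0 := by
        have h1 := Complex.nonneg_iff.1 (key1 i h0)
        have e : ψ 1 = φ (H i) := by simp [ψ]
        rw [e]
        exact Complex.ext (hk i hi) h1.2.symm
      exact LinearMap.congr_fun (hψ.eq_zero hψ1) g
  intro k hk
  exact (Complex.nonneg_iff.1 (key1 k (hvanish k hk))).1

end Integration

/-! ### Complete positivity -/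

theorem SeriesNonneg.of_lexNonneg {z : ℂ⟦X⟧} (him : ∀ k, (PowerSeries.coeff k z).im = 0)
    (hlex : LexNonneg fun k => (PowerSeries.coeff k z).re) : SeriesNonneg z := by
  classical
  refine ⟨PowerSeries.mk fun k => (PowerSeries.coeff k z).re, ?_, ?_⟩
  · ext k
    rw [PowerSeries.coeff_map, PowerSeries.coeff_mk]
    exact Complex.ext rfl (him k)
  · by_cases h : ∃ k, (PowerSeries.coeff k z).re ≠ 0
    · right
      have hlt (i : ℕ) (hi : i < Nat.find h) : (PowerSeries.coeff i z).re = 0 :=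
        not_not.1 (Nat.find_min h hi)
      refine ⟨Nat.find h, ?_, fun i hi => ?_⟩
      · rw [PowerSeries.coeff_mk]
        exact (hlex _ hlt).lt_of_ne (Nat.find_spec h).symm
      · rw [PowerSeries.coeff_mk, hlt i hi]
    · left
      push Not at h
      ext k
      rw [PowerSeries.coeff_mk, h k, map_zero]

/-- An entry of a series of matrices as an element of the star product algebra. -/
def fnEntry {n : ℕ} {M : Type*} [TopologicalSpace M] [ChartedSpace (EuclideanSpace ℝ (Fin n)) M]
    {P : PoissonBracket n M} (S : HermitianStarProduct P) {m : ℕ}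
    (F : FormalSeries (Matrix (Fin m) (Fin m) (SmoothFn n M))) (k j : Fin m) : StarAlg S :=
  FormalSeries.entry k j F

open StarAlg in
/-- The form of a matrix `F* ⋆ F` evaluated with the deformed evaluation functional is a sum of
values on squares. -/
theorem formAt_matrix_mul {n : ℕ} {M : Type*} [TopologicalSpace M]
    [ChartedSpace (EuclideanSpace ℝ (Fin n)) M] {P : PoissonBracket n M}
    (S : HermitianStarProduct P) (Φ : ℕ → SmoothFn n M →ₗ[ℂ] SmoothFn n M) {m : ℕ}
    (F : FormalSeries (Matrix (Fin m) (Fin m) (SmoothFn n M))) (q : ℕ) (y : M) (v : Fin m → ℂ) :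
    formAt Finset.univ (∑ p ∈ antidiagonal q, (Φ p.1).mapMatrix
      (((S.toHermitianDeformation.matrix m).mul (star F) F).coeff p.2)) y v =
    ∑ k, (PowerSeries.coeff q (ptFunctional S Φ y
      (star (∑ j, (PowerSeries.C (v j) : ℂ⟦X⟧) • fnEntry S F k j) *
        ∑ j, (PowerSeries.C (v j) : ℂ⟦X⟧) • fnEntry S F k j))).re := by
  have hentry (i j : Fin m) : evalAt n y ((∑ p ∈ antidiagonal q, (Φ p.1).mapMatrix
      (((S.toHermitianDeformation.matrix m).mul (star F) F).coeff p.2)) i j) =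
        ∑ k, PowerSeries.coeff q (ptFunctional S Φ y (star (fnEntry S F k i) * fnEntry S F k j)) := by
    rw [← map_sum, ← map_sum, coeff_ptFunctional, Matrix.sum_apply, map_sum]
    rfl
  rw [formAt, hermForm, ← Complex.re_sum]
  congr 1
  have hk (k : Fin m) : PowerSeries.coeff q (ptFunctional S Φ y
      (star (∑ j, (PowerSeries.C (v j) : ℂ⟦X⟧) • fnEntry S F k j) *
        ∑ j, (PowerSeries.C (v j) : ℂ⟦X⟧) • fnEntry S F k j)) =
      ∑ i, ∑ j, star (v i) * v j * PowerSeries.coeff q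
        (ptFunctional S Φ y (star (fnEntry S F k i) * fnEntry S F k j)) := by
    rw [star_sum, Finset.sum_mul_sum, map_sum, map_sum]
    refine Finset.sum_congr rfl fun i _ => ?_
    rw [map_sum, map_sum]
    refine Finset.sum_congr rfl fun j _ => ?_
    rw [star_C_smul, smul_mul_smul_comm, ← map_mul, map_smul, smul_eq_mul,
      PowerSeries.coeff_C_mul]
  rw [Finset.sum_congr rfl fun k _ => hk k]
  simp only [hentry, Finset.mul_sum]
  conv_rhs => rw [Finset.sum_comm]
  refine Finset.sum_congr rfl fun i _ => ?_
  rw [Finset.sum_comm]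

end DefQuant

end

open DefQuant in
theorem mainTheorem1 (n : ℕ) (M : Type*) [TopologicalSpace M] [T2Space M]
    [SecondCountableTopology M] [ChartedSpace (EuclideanSpace ℝ (Fin n)) M]
    [IsManifold (𝓡 n) ∞ M] (P : DefQuant.PoissonBracket n M)
    (S : DefQuant.HermitianStarProduct P) :
    S.toHermitianDeformation.IsCompletelyPositive := by
  intro m ω₀ hω₀
  replace hω₀ : IsPositiveFunctional ω₀ := hω₀
  obtain ⟨Φ, hΦ0, hΦstar, hΦ⟩ := exists_lexNonneg_ptFunctional S
  refine ⟨seriesFunctional fun r => ω₀ ∘ₗ (Φ r).mapMatrix, fun a => ?_, fun F => ?_⟩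
  · rw [coeff_seriesFunctional, Finset.Nat.antidiagonal_zero, Finset.sum_singleton, hΦ0]
    rfl
  · set G := (S.toHermitianDeformation.matrix m).mul (star F) F
    have hG (r : ℕ) : star (G.coeff r) = G.coeff r := by
      rw [← FormalSeries.coeff_star]
      congr 1
      have := (S.toHermitianDeformation.matrix m).star_mul (star F) F
      rwa [show star (star F) = F from FormalSeries.ext (funext fun r => star_star _)] at this
    -- The coefficients of `∑ λ ^ r Φ_r` applied to the entries of `F* ⋆ F`.
    let H (q : ℕ) := ∑ p ∈ antidiagonal q, (Φ p.1).mapMatrix (G.coeff p.2)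
    have hH (q : ℕ) : star (H q) = H q := by
      rw [star_sum]
      refine Finset.sum_congr rfl fun p _ => ?_
      ext1 i j
      have := congrFun (congrFun (hG p.2) i) j
      change star (Φ p.1 (G.coeff p.2 j i)) = Φ p.1 (G.coeff p.2 i j)
      rw [← this, ← hΦstar]
      rfl
    have hcoeff (q : ℕ) : PowerSeries.coeff q
        (seriesFunctional (fun r => ω₀ ∘ₗ (Φ r).mapMatrix) G) = ω₀ (H q) := by
      rw [coeff_seriesFunctional, map_sum]
      rfl
    refine SeriesNonneg.of_lexNonneg (fun k => ?_) ?_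
    · rw [hcoeff]
      exact hω₀.im_eq_zero (hH k)
    · simp only [hcoeff]
      refine hω₀.lexNonneg hH fun y v => ?_
      have e := fun q => formAt_matrix_mul S Φ F q y v
      simp only [H, G, e]
      exact LexNonneg.sum _ fun k _ => hΦ y _
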